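/- **Setting.** Let $U\subset\mathbb C^k$ be a connected open set and let $0\le p\le k-1$. Let $\mathcal P$ be a convex cone of $\mathcal C^2$ functions on $U$ which contains the constants and a smooth strictly plurisubharmonic function, separates the points of $U$, and satisfies $h\circ u\in\mathcal P$ for every $u\in\mathcal P$ and every smooth convex increasing (i.e. non-decreasing) function $h:\mathbb R\to\mathbb R$. A closed subset $F$ of $U$ is *locally complete $\mathcal P$-pluripolar* if every point of $F$ has an open neighbourhood $V\subset U$ such that $F\cap V=\{z\in V:\ v(z)=-\infty\}$ for some $v:V\to[-\infty,\infty)$, $v\not\equiv-\infty$, which is the pointwise limit on $V$ of a decreasing sequence of (restrictions of) functions of $\mathcal P$. A current of bidegree $(r,r)$ is *positive* if it is non-negative on all smooth compactly supported test forms of bidegree $(k-r,k-r)$ which at every point lie in the convex cone generated by the forms $i\alpha_1\wedge\bar\alpha_1\wedge\dots\wedge i\alpha_{k-r}\wedge\bar\alpha_{k-r}$ with $\alpha_j$ of type $(1,0)$; $R\le S$ means that $S-R$ is positive. A positive $(p,p)$-current $T$ is *$\mathcal P$-directed* if $T\wedge i\partial\bar\partial u$ is positive for every $u\in\mathcal P$.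 A current on $U\setminus F$ of order zero has *locally finite mass near $F$* if every point of $F$ has a neighbourhood $W$ such that the mass of the current on $W\setminus F$ is finite. If $R$ is such a current, its *extension by zero* (trivial extension) $\widetilde R$ is the current of order zero on $U$ which equals $R$ on $U\setminus F$ and has no mass on $F$. **Theorem.** Let $F\subset U$ be closed in $U$ and locally complete $\mathcal P$-pluripolar. Let $T$ be a positive $\mathcal P$-directed $(p,p)$-current on $U\setminus F$ with locally finite mass near $F$, and assume that there is a positive $(p+1,p+1)$-current $S$ on $U\setminus F$ with locally finite mass near $F$ such that $i\partial\bar\partial T\le S$ on $U\setminus F$. Then $i\partial\bar\partial T$ has order zero on $U\setminus F$ and locally finite mass near $F$, and, if $\widetilde T$ and $\widetilde{\partial\bar\partial T}$ denote the extensions by zero to $U$ of $T$ and $\partial\bar\partial T$, the current $$i\,\widetilde{\partial\bar\partial T}-i\,\partial\bar\partial\widetilde T$$ is positive on $U$. If moreover $dT$ has order zero and locally finite mass near $F$, then $\widetilde{dT}=d\widetilde T$. -/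

import Mathlib

open TopologicalSpace Topology Filter
open scoped ENNReal ContDiff Distributions

noncomputable section

namespace DirectedCurrents

/-! ### Exterior forms on `ℂ^k` -/

/-- The complex Euclidean space `ℂ^k`. -/
abbrev CSpace (k : ℕ) : Type := EuclideanSpace ℂ (Fin k)

/-- Complex-valued (constant) exterior forms of degree `n` on `ℂ^k`, i.e. alternating
`ℝ`-multilinear maps. -/
abbrev Form (k n : ℕ) : Type := CSpace k [⋀^Fin n]→L[ℝ] ℂ

variable {k n : ℕ}

section LinearParts

variable (k) (G : Type*) [NormedAddCommGroup G] [NormedSpace ℝ G] [NormedSpace ℂ G]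
  [IsScalarTower ℝ ℂ G]

/-- Precomposition with multiplication by `i` on `ℂ^k`: `A ↦ (v ↦ A (i v))`. -/
def precompI : (CSpace k →L[ℝ] G) →L[ℂ] (CSpace k →L[ℝ] G) :=
  LinearMap.mkContinuous
    { toFun := fun A => A.comp
        ((Complex.I • ContinuousLinearMap.id ℂ (CSpace k)).restrictScalars ℝ)
      map_add' := fun A B => by ext v; simp
      map_smul' := fun c A => by ext v; simp }
    ‖(Complex.I • ContinuousLinearMap.id ℂ (CSpace k)).restrictScalars ℝ‖
    (fun A => by
      rw [mul_comm]
      exact ContinuousLinearMap.opNorm_comp_le _ _)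

/-- The `ℂ`-linear part `v ↦ (A v - i A (i v)) / 2` of an `ℝ`-linear map `A`. -/
def linPart : (CSpace k →L[ℝ] G) →L[ℂ] (CSpace k →L[ℝ] G) :=
  (1 / 2 : ℂ) • (ContinuousLinearMap.id ℂ _ - Complex.I • precompI k G)

/-- The `ℂ`-antilinear part `v ↦ (A v + i A (i v)) / 2` of an `ℝ`-linear map `A`. -/
def antiPart : (CSpace k →L[ℝ] G) →L[ℂ] (CSpace k →L[ℝ] G) :=
  (1 / 2 : ℂ) • (ContinuousLinearMap.id ℂ _ + Complex.I • precompI k G)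

end LinearParts

variable (k n) in
/-- Alternatization `A ↦ ((v₀, …, vₙ) ↦ ∑ᵢ (-1)ⁱ A vᵢ (v₀, …, v̂ᵢ, …, vₙ))`, as a `ℂ`-linear map.
It sends `v ↦ a v • β` to the wedge product `a ∧ β`. -/
def alt : (CSpace k →L[ℝ] Form k n) →L[ℂ] Form k (n + 1) where
  toFun := ContinuousAlternatingMap.alternatizeUncurryFin
  map_add' := ContinuousAlternatingMap.alternatizeUncurryFin_add
  map_smul' := ContinuousAlternatingMap.alternatizeUncurryFin_smul
  cont := (ContinuousAlternatingMap.alternatizeUncurryFinCLM ℝ (CSpace k) ℂ).continuous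

/-- The wedge product with `β` of the 2-form `∑ bᵢⱼ aᵢ ∧ aⱼ` associated with the bilinear form
`B = ∑ bᵢⱼ aᵢ ⊗ aⱼ` (the `aᵢ` being `ℝ`-linear forms): `B = a ⊗ b` gives `a ∧ (b ∧ β)`. -/
def wedgeBilin (B : CSpace k →L[ℝ] CSpace k →L[ℝ] ℂ) (β : Form k n) : Form k (n + 1 + 1) :=
  alt k (n + 1) (((alt k n).restrictScalars ℝ).comp
    ((ContinuousLinearMap.compL ℝ (CSpace k) ℂ (Form k n)
      ((ContinuousLinearMap.toSpanSingleton ℂ β).restrictScalars ℝ)).comp B))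

/-- The bilinear form `α ⊗ ᾱ : (v, w) ↦ α v * conj (α w)` of a `(1,0)`-form `α`. -/
def sesq (α : CSpace k →L[ℂ] ℂ) : CSpace k →L[ℝ] CSpace k →L[ℝ] ℂ :=
  (ContinuousLinearMap.mul ℝ ℂ).bilinearComp (α.restrictScalars ℝ)
    ((Complex.conjCLE : ℂ →L[ℝ] ℂ).comp (α.restrictScalars ℝ))

/-- The form `iα₁ ∧ ᾱ₁ ∧ … ∧ iα_q ∧ ᾱ_q`. -/
def elementary : (q : ℕ) → (Fin q → (CSpace k →L[ℂ] ℂ)) → Form k (2 * q)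
  | 0, _ => ContinuousAlternatingMap.constOfIsEmpty ℝ (CSpace k) (Fin 0) (1 : ℂ)
  | q + 1, α => Complex.I • wedgeBilin (n := 2 * q) (sesq (α 0)) (elementary q (Fin.tail α))

variable (k) in
/-- The convex cone of strongly positive `(q,q)`-forms, generated by the forms
`iα₁ ∧ ᾱ₁ ∧ … ∧ iα_q ∧ ᾱ_q` with `(1,0)`-forms `α₁, …, α_q`. -/
def stronglyPositive (q : ℕ) : PointedCone ℝ (Form k (2 * q)) :=
  Submodule.span _ (Set.range (elementary (k := k) q))

/-- `β` has type (bidegree) `(a,b)`. -/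
def IsOfType (a b : ℕ) (β : Form k n) : Prop :=
  ∀ (c : ℂ) (v : Fin n → CSpace k),
    β (fun j => c • v j) = c ^ a * (starRingEnd ℂ c) ^ b * β v

/-- The complex Hessian `(v, w) ↦ ∑ ∂²u/∂z_j∂z̄_l v_j conj(w_l)` of `u` at `x`. -/
def levi (u : CSpace k → ℝ) (x : CSpace k) : CSpace k →L[ℝ] CSpace k →L[ℝ] ℂ :=
  linPart k (CSpace k →L[ℝ] ℂ)
    (fderiv ℝ (fun y => antiPart k ℂ (fderiv ℝ (fun z => (u z : ℂ)) y)) x)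

/-- The form `(i∂∂̄u)(x) ∧ β`. -/
def iddbarWedge (u : CSpace k → ℝ) (x : CSpace k) (β : Form k n) : Form k (n + 1 + 1) :=
  Complex.I • wedgeBilin (levi u x) β

/-! ### Differential operators on test forms -/

/-- Smooth compactly supported forms of degree `n` in the open set `Ω`. -/
abbrev TestForm (Ω : Opens (CSpace k)) (n : ℕ) : Type := 𝓓(Ω, Form k n)

variable {Ω : Opens (CSpace k)}

variable (Ω n) in
/-- The exterior derivative `d` on test forms. -/
def dTest : TestForm Ω n →L[ℂ] TestForm Ω (n + 1) :=
  (TestFunction.postcompCLM (alt k n)).comp (TestFunction.fderivCLM ℂ ⊤ ⊤)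

variable (Ω n) in
/-- The operator `∂` on test forms. -/
def delTest : TestForm Ω n →L[ℂ] TestForm Ω (n + 1) :=
  (TestFunction.postcompCLM ((alt k n).comp (linPart k (Form k n)))).comp
    (TestFunction.fderivCLM ℂ ⊤ ⊤)

variable (Ω n) in
/-- The operator `∂̄` on test forms. -/
def delbarTest : TestForm Ω n →L[ℂ] TestForm Ω (n + 1) :=
  (TestFunction.postcompCLM ((alt k n).comp (antiPart k (Form k n)))).comp
    (TestFunction.fderivCLM ℂ ⊤ ⊤)

/-! ### Currents -/

/-- Currents of (real) dimension `n` on `Ω`: continuous linear functionals on the space of test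
forms of degree `n`. -/
abbrev Current (Ω : Opens (CSpace k)) (n : ℕ) : Type := TestForm Ω n →L[ℂ] ℂ

/-- The exterior derivative of a current of dimension `n + 1` (hence of degree `2k - n - 1`), by
duality: `⟨dT, φ⟩ = (-1)^(deg T + 1) ⟨T, dφ⟩`. -/
def currentD (T : Current Ω (n + 1)) : Current Ω n :=
  (-1 : ℂ) ^ n • T.comp (dTest n Ω)

/-- The current `i∂∂̄T`, by duality: `⟨i∂∂̄T, φ⟩ = ⟨T, i∂∂̄φ⟩`. -/
def currentIddbar (T : Current Ω (n + 1 + 1)) : Current Ω n :=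
  Complex.I • T.comp ((delTest (n + 1) Ω).comp (delbarTest n Ω))

/-- `T` has bidimension `(r,s)`, i.e. bidegree `(k-r,k-s)`: it vanishes on test forms of any other
type. -/
def IsOfBidimension (r s : ℕ) (T : Current Ω n) : Prop :=
  ∀ a b : ℕ, (a, b) ≠ (r, s) → ∀ φ : TestForm Ω n, (∀ x, IsOfType a b (φ x)) → T φ = 0

/-- Positive currents of bidimension `(q,q)`, i.e. of bidegree `(k-q,k-q)`: nonnegative on all test
forms that are pointwise strongly positive. -/
def IsPositive (q : ℕ) (T : Current Ω (2 * q)) : Prop :=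
  IsOfBidimension q q T ∧
    ∀ φ : TestForm Ω (2 * q), (∀ x, φ x ∈ stronglyPositive k q) → ∃ c : ℝ, 0 ≤ c ∧ T φ = c

/-- The mass `‖T‖_A` of `T` on `A ⊆ Ω`: on open sets `W` it is the supremum of `|T φ|` over the
test forms `φ` supported in `W` with `|φ| ≤ 1`, on other sets it is defined by outer regularity. -/
def mass (T : Current Ω n) (A : Set (CSpace k)) : ℝ≥0∞ :=
  ⨅ (W : Set (CSpace k)) (_ : IsOpen W) (_ : A ⊆ W),
    ⨆ (φ : TestForm Ω n) (_ : tsupport φ ⊆ W) (_ : ∀ x, ‖φ x‖ ≤ 1), ‖T φ‖ₑ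

/-- `T` has order zero: it has finite mass on the compact subsets of `Ω`. -/
def IsOfOrderZero (T : Current Ω n) : Prop :=
  ∀ K : Set (CSpace k), IsCompact K → K ⊆ Ω → mass T K < ⊤

/-- A current `T` on `Ω = U \ F` has locally finite mass near `F`. -/
def HasLocallyFiniteMassNear (F : Set (CSpace k)) (T : Current Ω n) : Prop :=
  ∀ a ∈ F, ∃ W ∈ 𝓝 a, mass T (W ∩ Ω) < ⊤

/-- The open set `U \ F`, for `F` closed in `U`. -/
def sdiffOpens (U : Opens (CSpace k)) (F : Set (CSpace k))
    (hF : IsClosed ((↑) ⁻¹' F : Set U)) : Opens (CSpace k) where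
  carrier := (U : Set (CSpace k)) \ F
  is_open' := by
    have h := U.isOpen.isOpenEmbedding_subtypeVal.isOpenMap _ hF.isOpen_compl
    convert h using 1
    ext x
    simp [and_comm]

/-- `T'` is the extension by zero (trivial extension) to `U` of the current `T` on `Ω = U \ F`:
it has order zero, restricts to `T` on `Ω` and has no mass on `F`. -/
structure IsZeroExtension {U : Opens (CSpace k)} (F : Set (CSpace k)) (T : Current Ω n)
    (T' : Current U n) : Prop where
  isOfOrderZero : IsOfOrderZero T'
  restrict : ∀ (φ : TestForm Ω n) (ψ : TestForm U n), (∀ x, φ x = ψ x) → T' ψ = T φ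
  mass_eq_zero : mass T' F = 0

/-- The value of `T` on the continuous compactly supported form `η` is `c`: this is the limit of
`T (ψ j)` for all sequences of test forms `ψ j` converging uniformly to `η` with supports in a
fixed compact subset of `Ω`. (For `T` of order zero there is exactly one such `c`.) -/
def PairsTo (T : Current Ω n) (η : CSpace k → Form k n) (c : ℂ) : Prop :=
  ∀ (ψ : ℕ → TestForm Ω n) (K : Set (CSpace k)), IsCompact K → K ⊆ Ω →
    (∀ j, tsupport (ψ j) ⊆ K) → TendstoUniformly (fun j x => ψ j x) η atTop →
    Tendsto (fun j => T (ψ j)) atTop (𝓝 c)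

/-! ### The cone of functions, directed currents, pluripolar sets -/

/-- A convex cone `P` of `C²` functions on `U` which contains the constants and a smooth strictly
plurisubharmonic function, separates points, and is stable under composition with smooth convex
increasing functions. (Only the restrictions to `U` of the elements of `P` matter.) -/
structure IsAdmissibleCone (U : Opens (CSpace k)) (P : Set (CSpace k → ℝ)) : Prop where
  contDiffOn : ∀ u ∈ P, ContDiffOn ℝ 2 u U
  add_mem : ∀ u ∈ P, ∀ v ∈ P, u + v ∈ P
  smul_mem : ∀ c : ℝ, 0 ≤ c → ∀ u ∈ P, c • u ∈ P
  const_mem : ∀ c : ℝ, (fun _ => c) ∈ P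
  exists_strictlyPsh : ∃ ρ ∈ P, ContDiffOn ℝ ∞ ρ U ∧
    ∀ x ∈ U, ∀ v : CSpace k, v ≠ 0 → 0 < (levi ρ x v v).re
  separates : ∀ x ∈ U, ∀ y ∈ U, x ≠ y → ∃ u ∈ P, u x ≠ u y
  comp_mem : ∀ u ∈ P, ∀ h : ℝ → ℝ, ContDiff ℝ ∞ h → ConvexOn ℝ Set.univ h → Monotone h →
    h ∘ u ∈ P

/-- A positive current `T` of bidimension `(q+1,q+1)` on `Ω` is `P`-directed: the current
`T ∧ i∂∂̄u` is positive for every `u ∈ P`. Since `u` is only of class `C²`, this current is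
`φ ↦ ⟨T, i∂∂̄u ∧ φ⟩` where `T`, which has order zero, is evaluated on a continuous form. -/
def IsPDirected {q : ℕ} (P : Set (CSpace k → ℝ)) (T : Current Ω (2 * (q + 1))) : Prop :=
  ∀ u ∈ P, ∀ φ : TestForm Ω (2 * q), (∀ x, φ x ∈ stronglyPositive k q) →
    ∃ c : ℝ, 0 ≤ c ∧ PairsTo (n := 2 * q + 1 + 1) T (fun x => iddbarWedge u x (φ x)) c

/-- `v : V → [-∞, ∞)` is the limit of a decreasing sequence of elements of `P`. -/
def IsDecreasingLimit (P : Set (CSpace k → ℝ)) (V : Set (CSpace k)) (v : CSpace k → EReal) :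
    Prop :=
  ∃ u : ℕ → CSpace k → ℝ, (∀ j, u j ∈ P) ∧ (∀ x ∈ V, Antitone fun j => u j x) ∧
    ∀ x ∈ V, Tendsto (fun j => ((u j x : ℝ) : EReal)) atTop (𝓝 (v x))

/-- `F` is locally complete `P`-pluripolar in `U`: each point of `F` has an open neighbourhood
`V ⊆ U` in which `F` is the set `{v = -∞}` for a decreasing limit `v ≢ -∞` on `V` of functions in
`P`. -/
def IsLocallyCompletePluripolar (P : Set (CSpace k → ℝ)) (U : Opens (CSpace k))
    (F : Set (CSpace k)) : Prop :=
  ∀ a ∈ F, ∃ V : Set (CSpace k), IsOpen V ∧ a ∈ V ∧ V ⊆ U ∧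
    ∃ v : CSpace k → EReal, IsDecreasingLimit P V v ∧ (∃ x ∈ V, v x ≠ ⊥) ∧
      F ∩ V = {x ∈ V | v x = ⊥}

end DirectedCurrents

end

open DirectedCurrents

open TopologicalSpace Topology Filter
open scoped ENNReal ContDiff Distributions

noncomputable section

namespace DirectedCurrents

/-! ### Regularization -/

section Regularization

open MeasureTheory ContinuousLinearMap

/-! Everything is local, and the only difficulty is near a point `a` of `F`. There, composing the
functions that decrease to the defining function of `F` with a convex increasing function produces
elements of the cone that vanish near `F`, are at most one, and tend to one off `F`. After cutting
off and smoothing they give cut-offs `w n` of `U \ F` for which `T ∧ i∂∂̄(w n)` is positive up to an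
error `O(1/n)` (`exists_isApproxSequence`). For such a `w` and a test form `φ`, the product formula
expands `⟨i∂∂̄T, w φ⟩` into `⟨T, w i∂∂̄φ⟩`, two mixed terms containing `∂w` or `∂̄w` once, and `⟨T,
i∂∂̄w ∧ φ⟩`. The left side and the first term converge to the values of the extensions by zero.
Hence, if the mixed terms tend to zero, `D - i∂∂̄T'` is the limit of `T ∧ i∂∂̄(w n)`, which is
positive. The identity for `dT` follows in the same way, its only error terms being mixed terms.
What controls the mixed terms is an energy estimate (`exists_energy_bound`). Put `R = S - i∂∂̄T`,
which is positive, and test it against `(exp(m w) - 1) ψ² β`, where `β` is a fixed form interior to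
the cone and `ψ` a bump function. Since `i∂∂̄ exp(m w) = m exp(m w) i∂∂̄w + m² exp(m w) i∂w ∧ ∂̄w`,
the energy of `w` and the value of `R` appear with the same sign. Directedness takes care of the
term in `i∂∂̄w`, the Cauchy–Schwarz inequality absorbs the mixed terms into half the energy, and the
remaining terms are `O(exp m)`. With `m = 1` this bounds the mass of `R` near `F`, hence that of
`i∂∂̄T` (`IsApproxSequence.mass_lt_top`). For large `m`, division by `exp m` shows that the energy
with weight `exp(-m (1 - w)) ψ²` is `O(1/m²)` (`IsApproxSequence.energy_le`). In Cauchy–Schwarz the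
inverse weight falls on the fixed form `Ψ`, where it tends to one because `w n → 1` outside a null
set. So the mixed terms are eventually `O(1/m)` for each `m`, and they tend to zero
(`IsApproxSequence.tendsto_mixed`). Order zero and extension by zero are handled through measures.
The total variation of a current of order zero is additive, so the Riesz theorem gives a dominating
measure (`exists_dominating_measure`), and convergence along cut-offs becomes dominated convergence.
-/

theorem exists_convex_transition : ∃ H : ℝ → ℝ, ContDiff ℝ ∞ H ∧ ConvexOn ℝ Set.univ H ∧
    Monotone H ∧ (∀ t ≤ 0, H t = 0) ∧ H 1 = 1 := by
  -- A primitive of a smooth step: its derivative is non-negative and monotone, so it is monotone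
  -- and convex. Dividing by its value at 1 normalizes it.
  let G : ℝ → ℝ := fun t => ∫ s in (0 : ℝ)..t, Real.smoothTransition s
  have hG : ∀ t, HasDerivAt G (Real.smoothTransition t) t := fun t =>
    Real.smoothTransition.continuous.integral_hasStrictDerivAt 0 t |>.hasDerivAt
  have hG' : deriv G = Real.smoothTransition := funext fun t => (hG t).deriv
  have hd : Differentiable ℝ G := fun t => (hG t).differentiableAt
  have hs : ContDiff ℝ ∞ G := by
    rw [contDiff_infty_iff_deriv, hG']
    exact ⟨hd, Real.smoothTransition.contDiff⟩
  have hm : Monotone G := monotone_of_deriv_nonneg hd fun t => by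
    rw [hG']; exact Real.smoothTransition.nonneg t
  have hc : ConvexOn ℝ Set.univ G := by
    refine Monotone.convexOn_univ_of_deriv hd ?_
    rw [hG']
    exact Real.smoothTransition.monotone
  have h0 : ∀ t ≤ 0, G t = 0 := fun t ht => by
    refine intervalIntegral.integral_zero_ae (Filter.Eventually.of_forall fun s hs => ?_)
    rw [Set.uIoc_of_ge ht] at hs
    exact Real.smoothTransition.zero_of_nonpos hs.2
  have h1 : 0 < G 1 := intervalIntegral.intervalIntegral_pos_of_pos_on
    (Real.smoothTransition.continuous.intervalIntegrable _ _)
    (fun s hs => Real.smoothTransition.pos_of_pos hs.1) one_pos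
  refine ⟨fun t => (G 1)⁻¹ * G t, contDiff_const.mul hs, ?_, ?_, fun t ht => ?_, ?_⟩
  · exact hc.smul (inv_nonneg.2 h1.le)
  · exact fun s t hst => mul_le_mul_of_nonneg_left (hm hst) (inv_nonneg.2 h1.le)
  · change (G 1)⁻¹ * G t = 0
    rw [h0 t ht, mul_zero]
  · exact inv_mul_cancel₀ h1.ne'

theorem exists_bump {V : Type*} [NormedAddCommGroup V] {r : ℝ} (hr : 0 < r) :
    ∃ ρ : ContDiffBump (0 : V), ρ.rOut = r :=
  ⟨{ rIn := r / 2, rOut := r, rIn_pos := half_pos hr, rIn_lt_rOut := half_lt_self hr }, rfl⟩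

/-! ### Mollification: derivatives, supports, bounds. -/

section Convolution

variable {V : Type*} [NormedAddCommGroup V] [NormedSpace ℝ V] [FiniteDimensional ℝ V]
  [MeasurableSpace V] [BorelSpace V]
  {E : Type*} [NormedAddCommGroup E] [NormedSpace ℝ E]

/-- Convolution with a normalized bump function. -/
def mollify (ρ : ContDiffBump (0 : V)) (g : V → E) : V → E :=
  MeasureTheory.convolution (ρ.normed Measure.addHaar) g (lsmul ℝ ℝ) Measure.addHaar

theorem hasFDerivAt_mollify (ρ : ContDiffBump (0 : V)) {g : V → E}
    (hg : ContDiff ℝ 1 g) (hgc : HasCompactSupport g) (x : V) :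
    HasFDerivAt (mollify ρ g) (mollify ρ (fderiv ℝ g) x) x :=
  hgc.hasFDerivAt_convolution_right (μ := Measure.addHaar) (lsmul ℝ ℝ)
    (ρ.continuous_normed (μ := Measure.addHaar)).locallyIntegrable hg x

theorem contDiff_mollify (ρ : ContDiffBump (0 : V)) {g : V → E}
    (hg : Continuous g) : ContDiff ℝ ∞ (mollify ρ g) :=
  ρ.hasCompactSupport_normed.contDiff_convolution_left (n := (⊤ : ℕ∞)) _ ρ.contDiff_normed
    hg.locallyIntegrable

/-- Uniform continuity of `g` makes `δ` independent of the point. It is used both for a function and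
for its second derivative. -/
theorem exists_mollify_close [CompleteSpace E] {g : V → E} (hg : Continuous g)
    (hgc : HasCompactSupport g) {ε : ℝ} (hε : 0 < ε) :
    ∃ δ > 0, ∀ ρ : ContDiffBump (0 : V), ρ.rOut ≤ δ → ∀ x, ‖mollify ρ g x - g x‖ ≤ ε := by
  have hu := hgc.uniformContinuous_of_continuous hg
  obtain ⟨δ, hδ, h⟩ := Metric.uniformContinuous_iff.1 hu ε hε
  refine ⟨δ, hδ, fun ρ hρ x => ?_⟩
  rw [← dist_eq_norm]
  refine ρ.dist_normed_convolution_le hg.aestronglyMeasurable fun y hy => ?_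
  exact (h (lt_of_lt_of_le (Metric.mem_ball.1 hy) hρ)).le

theorem tsupport_mollify_subset (ρ : ContDiffBump (0 : V)) (g : V → E) :
    tsupport (mollify ρ g) ⊆ Metric.cthickening ρ.rOut (tsupport g) := by
  refine closure_minimal ?_ Metric.isClosed_cthickening
  refine (support_convolution_subset _).trans ?_
  rw [ρ.support_normed_eq]
  rintro _ ⟨u, hu, v, hv, rfl⟩
  refine Metric.mem_cthickening_of_dist_le _ v _ _ (subset_tsupport _ hv) ?_
  rw [dist_eq_norm, add_sub_cancel_right]
  exact (mem_ball_zero_iff.1 hu).le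

theorem hasCompactSupport_mollify (ρ : ContDiffBump (0 : V)) {g : V → E}
    (hgc : HasCompactSupport g) : HasCompactSupport (mollify ρ g) :=
  have : ProperSpace V := FiniteDimensional.proper ℝ V
  hgc.cthickening.of_isClosed_subset (isClosed_tsupport _) (tsupport_mollify_subset ρ g)

theorem mollify_nonneg (ρ : ContDiffBump (0 : V)) {g : V → ℝ}
    (hg0 : ∀ x, 0 ≤ g x) (x : V) : 0 ≤ mollify ρ g x :=
  integral_nonneg fun y => mul_nonneg (ρ.nonneg_normed y) (hg0 _)

theorem mollify_le_one (ρ : ContDiffBump (0 : V)) {g : V → ℝ}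
    (hg : Continuous g) (hg1 : ∀ x, g x ≤ 1) (x : V) : mollify ρ g x ≤ 1 := by
  rw [← ρ.integral_normed (μ := Measure.addHaar)]
  refine integral_mono ?_ ρ.integrable_normed fun y => ?_
  · exact (ρ.continuous_normed.mul
      (hg.comp (continuous_const.sub continuous_id))).integrable_of_hasCompactSupport
      ρ.hasCompactSupport_normed.mul_right
  · exact mul_le_of_le_one_right (ρ.nonneg_normed y) (hg1 _)

/-- The derivatives fall on `g` and not on the kernel, so that closeness of second derivatives
reduces to uniform closeness of a mollified continuous function. -/
theorem fderiv_fderiv_mollify (ρ : ContDiffBump (0 : V)) {g : V → ℝ}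
    (hg : ContDiff ℝ 2 g) (hgc : HasCompactSupport g) (x : V) :
    fderiv ℝ (fderiv ℝ (mollify ρ g)) x = mollify ρ (fderiv ℝ (fderiv ℝ g)) x := by
  have e1 : fderiv ℝ (mollify ρ g) = mollify ρ (fderiv ℝ g) :=
    funext fun x => (hasFDerivAt_mollify ρ (hg.of_le (by norm_num)) hgc x).fderiv
  rw [e1]
  exact (hasFDerivAt_mollify ρ (hg.fderiv_right (by norm_num)) (hgc.fderiv ℝ) x).fderiv

/-- Approximation in the `C²` topology by smooth functions. -/
theorem exists_smooth_approx {W : Set V} (hW : IsOpen W) {g : V → ℝ} (hg : ContDiff ℝ 2 g)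
    (hgc : HasCompactSupport g) (hgW : tsupport g ⊆ W) (hg0 : ∀ x, 0 ≤ g x) (hg1 : ∀ x, g x ≤ 1)
    {ε : ℝ} (hε : 0 < ε) :
    ∃ w : V → ℝ, ContDiff ℝ ∞ w ∧ HasCompactSupport w ∧ tsupport w ⊆ W ∧ (∀ x, 0 ≤ w x) ∧
      (∀ x, w x ≤ 1) ∧ (∀ x, |w x - g x| ≤ ε) ∧
      ∀ x, ‖fderiv ℝ (fderiv ℝ w) x - fderiv ℝ (fderiv ℝ g) x‖ ≤ ε := by
  have hg1' : ContDiff ℝ 1 (fderiv ℝ g) := hg.fderiv_right (by norm_num)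
  have hgc' : HasCompactSupport (fderiv ℝ g) := hgc.fderiv ℝ
  have hg2 : Continuous (fderiv ℝ (fderiv ℝ g)) := hg1'.continuous_fderiv one_ne_zero
  have hE : CompleteSpace (V →L[ℝ] V →L[ℝ] ℝ) := inferInstance
  have hcl := fun g' h h' => @exists_mollify_close V _ _ _ _ _ (V →L[ℝ] V →L[ℝ] ℝ) _ _ hE g' h h'
    ε hε
  obtain ⟨δ₁, hδ₁, h1⟩ := exists_mollify_close hg.continuous hgc hε
  have hgc2 : HasCompactSupport (fderiv ℝ (fderiv ℝ g)) := hgc'.fderiv ℝ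
  obtain ⟨δ₂, hδ₂, h2⟩ := hcl (fderiv ℝ (fderiv ℝ g)) hg2 hgc2
  obtain ⟨δ₃, hδ₃, h3⟩ := hgc.isCompact.exists_cthickening_subset_open hW hgW
  have hr : 0 < min δ₁ (min δ₂ δ₃) := lt_min hδ₁ (lt_min hδ₂ hδ₃)
  obtain ⟨ρ, hρ⟩ := exists_bump (V := V) hr
  have e2 := fun x => fderiv_fderiv_mollify ρ hg hgc x
  refine ⟨mollify ρ g, contDiff_mollify ρ hg.continuous, hasCompactSupport_mollify ρ hgc,
    (tsupport_mollify_subset ρ g).trans ((Metric.cthickening_mono ?_ _).trans h3),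
    mollify_nonneg ρ hg0, mollify_le_one ρ hg.continuous hg1, fun x => ?_, fun x => ?_⟩
  · rw [hρ]
    exact (min_le_right _ _).trans (min_le_right _ _)
  · exact h1 ρ (hρ.trans_le (min_le_left _ _)) x
  · rw [e2]
    exact h2 ρ (hρ.trans_le ((min_le_right _ _).trans (min_le_left _ _))) x

end Convolution

end Regularization

/-! ### Instances on spaces of forms

Shortcuts through the normed space structure; they help unification. -/

namespace FormInstances

variable {k n : ℕ}

scoped instance (priority := 2000) formNormedAddCommGroup : NormedAddCommGroup (Form k n) :=
  inferInstance
scoped instance (priority := 2000) formNormedSpaceComplex : NormedSpace ℂ (Form k n) :=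
  inferInstance
scoped instance (priority := 2000) formNormedSpaceReal : NormedSpace ℝ (Form k n) :=
  inferInstance
scoped instance (priority := 2000) formModuleComplex : Module ℂ (Form k n) :=
  NormedSpace.toModule
scoped instance (priority := 2000) formModuleReal : Module ℝ (Form k n) := NormedSpace.toModule
scoped instance (priority := 2000) formSMulComplex : SMul ℂ (Form k n) :=
  formModuleComplex.toSMul
scoped instance (priority := 2000) formSMulReal : SMul ℝ (Form k n) := formModuleReal.toSMul
scoped instance (priority := 2000) formAddCommGroup : AddCommGroup (Form k n) :=
  NormedAddCommGroup.toAddCommGroup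
scoped instance (priority := 2000) formZero : Zero (Form k n) :=
  AddCommGroup.toAddGroup.toSubNegMonoid.toZero

end FormInstances

open scoped FormInstances

/-! ### Test forms as functions -/

section TestFunctions

variable {k n m : ℕ} {Ω Ω' : Opens (CSpace k)}

/-- `f` is a smooth form with compact support in `Ω`. -/
structure IsTest (Ω : Opens (CSpace k)) (f : CSpace k → Form k n) : Prop where
  smooth : ContDiff ℝ ∞ f
  compact : HasCompactSupport f
  subset : tsupport f ⊆ Ω

/-- The test form given by a function. -/
def IsTest.toTest {f : CSpace k → Form k n} (hf : IsTest Ω f) : TestForm Ω n :=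
  ⟨f, hf.smooth, hf.compact, hf.subset⟩

open Classical in
/-- The value of a current on a form, zero if the form is not a test form. -/
def ev (T : Current Ω n) (f : CSpace k → Form k n) : ℂ :=
  if h : IsTest Ω f then T h.toTest else 0

theorem isTest_coe (φ : TestForm Ω n) : IsTest Ω (φ : CSpace k → Form k n) :=
  ⟨φ.contDiff, φ.hasCompactSupport, φ.tsupport_subset⟩

theorem ev_of_isTest (T : Current Ω n) {f : CSpace k → Form k n} (hf : IsTest Ω f) :
    ev T f = T hf.toTest := dif_pos hf

theorem ev_coe (T : Current Ω n) (φ : TestForm Ω n) : ev T φ = T φ := by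
  rw [ev_of_isTest T (isTest_coe φ)]; rfl

theorem IsTest.add {f g : CSpace k → Form k n} (hf : IsTest Ω f) (hg : IsTest Ω g) :
    IsTest Ω (fun x => f x + g x) :=
  isTest_coe (hf.toTest + hg.toTest)

theorem IsTest.sub {f g : CSpace k → Form k n} (hf : IsTest Ω f) (hg : IsTest Ω g) :
    IsTest Ω (fun x => f x - g x) :=
  isTest_coe (hf.toTest - hg.toTest)

theorem IsTest.const_smul {f : CSpace k → Form k n} (hf : IsTest Ω f) (c : ℂ) :
    IsTest Ω (fun x => c • f x) :=
  isTest_coe (c • hf.toTest)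

theorem IsTest.zero : IsTest Ω (fun _ : CSpace k => (0 : Form k n)) :=
  isTest_coe (0 : TestForm Ω n)

theorem IsTest.sum {ι : Type*} (s : Finset ι) {f : ι → CSpace k → Form k n}
    (hf : ∀ i ∈ s, IsTest Ω (f i)) : IsTest Ω (fun x => ∑ i ∈ s, f i x) := by
  classical
  induction s using Finset.induction_on with
  | empty => simpa using IsTest.zero
  | insert a s ha ih =>
    simp only [Finset.sum_insert ha]
    exact (hf a (Finset.mem_insert_self a s)).add
      (ih fun i hi => hf i (Finset.mem_insert_of_mem hi))

theorem ev_add (T : Current Ω n) {f g : CSpace k → Form k n} (hf : IsTest Ω f)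
    (hg : IsTest Ω g) : ev T (fun x => f x + g x) = ev T f + ev T g := by
  rw [ev_of_isTest T hf, ev_of_isTest T hg, ev_of_isTest T (hf.add hg), ← map_add]; rfl

theorem ev_sub (T : Current Ω n) {f g : CSpace k → Form k n} (hf : IsTest Ω f)
    (hg : IsTest Ω g) : ev T (fun x => f x - g x) = ev T f - ev T g := by
  rw [ev_of_isTest T hf, ev_of_isTest T hg, ev_of_isTest T (hf.sub hg), ← map_sub]; rfl

theorem ev_const_smul (T : Current Ω n) {f : CSpace k → Form k n} (hf : IsTest Ω f) (c : ℂ) :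
    ev T (fun x => c • f x) = c * ev T f := by
  rw [ev_of_isTest T hf, ev_of_isTest T (hf.const_smul c), ← smul_eq_mul, ← map_smul]; rfl

theorem ev_zero (T : Current Ω n) : ev T (fun _ => 0) = 0 := by
  rw [ev_of_isTest T IsTest.zero, ← map_zero T]; rfl

theorem ev_sum (T : Current Ω n) {ι : Type*} (s : Finset ι) {f : ι → CSpace k → Form k n}
    (hf : ∀ i ∈ s, IsTest Ω (f i)) : ev T (fun x => ∑ i ∈ s, f i x) = ∑ i ∈ s, ev T (f i) := by
  classical
  induction s using Finset.induction_on with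
  | empty => simpa using ev_zero T
  | insert a s ha ih =>
    have h1 : ∀ i ∈ s, IsTest Ω (f i) := fun i hi => hf i (Finset.mem_insert_of_mem hi)
    simp only [Finset.sum_insert ha]
    rw [ev_add T (hf a (Finset.mem_insert_self a s)) (IsTest.sum s h1), ih h1]

theorem ev_sub_current (T S : Current Ω n) (f : CSpace k → Form k n) :
    ev (T - S) f = ev T f - ev S f := by
  by_cases h : IsTest Ω f
  · simp [ev_of_isTest _ h]
  · simp [ev, h]

/-- A smooth form vanishing off a compact subset of `Ω` is a test form. -/
theorem IsTest.of_eq_zero {f : CSpace k → Form k n} (hf : ContDiff ℝ ∞ f) {K : Set (CSpace k)}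
    (hK : IsCompact K) (hKΩ : K ⊆ Ω) (h : ∀ x, x ∉ K → f x = 0) : IsTest Ω f := by
  have h1 : tsupport f ⊆ K := closure_minimal
    (fun x hx => by by_contra h2; exact hx (h x h2)) hK.isClosed
  exact ⟨hf, hK.of_isClosed_subset (isClosed_tsupport f) h1, h1.trans hKΩ⟩

theorem IsTest.eq_zero {f : CSpace k → Form k n} {x : CSpace k} (hx : x ∉ tsupport f) :
    f x = 0 := image_eq_zero_of_notMem_tsupport hx

theorem IsTest.mono {f : CSpace k → Form k n} (hf : IsTest Ω f) (h : Ω ≤ Ω') : IsTest Ω' f :=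
  ⟨hf.smooth, hf.compact, hf.subset.trans h⟩

/-- A smooth form vanishing wherever the test form `f` does is a test form. -/
theorem IsTest.of_zero_of_zero {f : CSpace k → Form k n} (hf : IsTest Ω f)
    {g : CSpace k → Form k m} (hg : ContDiff ℝ ∞ g) (h : ∀ x, f x = 0 → g x = 0) : IsTest Ω g :=
  .of_eq_zero hg hf.compact hf.subset fun _ hx => h _ (IsTest.eq_zero hx)

theorem IsTest.smul_real {f : CSpace k → Form k n} (hf : IsTest Ω f) {g : CSpace k → ℝ}
    (hg : ContDiff ℝ ∞ g) : IsTest Ω (fun x => g x • f x) :=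
  hf.of_zero_of_zero (hg.smul hf.smooth) fun x hx => by simp [hx]

/-- Product of a smooth form and a smooth function with compact support in `Ω`. -/
theorem IsTest.cut {w : CSpace k → ℝ} (hw : ContDiff ℝ ∞ w) (hwc : HasCompactSupport w)
    (hwΩ : tsupport w ⊆ Ω) {f : CSpace k → Form k n} (hf : ContDiff ℝ ∞ f) :
    IsTest Ω (fun x => w x • f x) :=
  .of_eq_zero (hw.smul hf) hwc hwΩ fun x hx => by
    rw [image_eq_zero_of_notMem_tsupport hx, zero_smul]

/-! ### Differential operators on functions with values in forms -/

/-- The exterior derivative. -/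
def dF (f : CSpace k → Form k n) (x : CSpace k) : Form k (n + 1) := alt k n (fderiv ℝ f x)

/-- The operator `∂`. -/
def delF (f : CSpace k → Form k n) (x : CSpace k) : Form k (n + 1) :=
  alt k n (linPart k (Form k n) (fderiv ℝ f x))

/-- The operator `∂̄`. -/
def delbarF (f : CSpace k → Form k n) (x : CSpace k) : Form k (n + 1) :=
  alt k n (antiPart k (Form k n) (fderiv ℝ f x))

theorem coe_dTest (φ : TestForm Ω n) : (dTest n Ω φ : CSpace k → Form k (n + 1)) = dF φ := by
  funext x
  simp [dTest, dF]

theorem coe_delTest (φ : TestForm Ω n) :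
    (delTest n Ω φ : CSpace k → Form k (n + 1)) = delF φ := by
  funext x
  simp [delTest, delF]

theorem coe_delbarTest (φ : TestForm Ω n) :
    (delbarTest n Ω φ : CSpace k → Form k (n + 1)) = delbarF φ := by
  funext x
  simp [delbarTest, delbarF]

theorem IsTest.dF {f : CSpace k → Form k n} (hf : IsTest Ω f) : IsTest Ω (dF f) := by
  have := isTest_coe (dTest n Ω hf.toTest)
  rwa [coe_dTest] at this

theorem IsTest.delF {f : CSpace k → Form k n} (hf : IsTest Ω f) : IsTest Ω (delF f) := by
  have := isTest_coe (delTest n Ω hf.toTest)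
  rwa [coe_delTest] at this

theorem IsTest.delbarF {f : CSpace k → Form k n} (hf : IsTest Ω f) : IsTest Ω (delbarF f) := by
  have := isTest_coe (delbarTest n Ω hf.toTest)
  rwa [coe_delbarTest] at this

theorem ev_currentD (T : Current Ω (n + 1)) {f : CSpace k → Form k n} (hf : IsTest Ω f) :
    ev (currentD T) f = (-1 : ℂ) ^ n * ev T (dF f) := by
  have h : (dTest n Ω hf.toTest : CSpace k → Form k (n + 1)) = DirectedCurrents.dF f :=
    coe_dTest _
  rw [← h, ev_coe, ev_of_isTest _ hf]
  rfl

theorem ev_currentIddbar (T : Current Ω (n + 1 + 1)) {f : CSpace k → Form k n}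
    (hf : IsTest Ω f) :
    ev (currentIddbar T) f = Complex.I * ev T (delF (delbarF f)) := by
  have h : (delTest (n + 1) Ω (delbarTest n Ω hf.toTest) : CSpace k → Form k (n + 1 + 1))
      = DirectedCurrents.delF (DirectedCurrents.delbarF f) := by
    rw [coe_delTest, coe_delbarTest]; rfl
  rw [← h, ev_coe, ev_of_isTest _ hf]
  rfl

theorem tsupport_dF (f : CSpace k → Form k n) : tsupport (dF f) ⊆ tsupport f :=
  (tsupport_comp_subset (map_zero _) (fderiv ℝ f)).trans (tsupport_fderiv_subset ℝ)

theorem tsupport_delF (f : CSpace k → Form k n) : tsupport (delF f) ⊆ tsupport f :=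
  (tsupport_comp_subset (g := fun A => alt k n (linPart k (Form k n) A)) (by simp)
    (fderiv ℝ f)).trans (tsupport_fderiv_subset ℝ)

theorem tsupport_delbarF (f : CSpace k → Form k n) : tsupport (delbarF f) ⊆ tsupport f :=
  (tsupport_comp_subset (g := fun A => alt k n (antiPart k (Form k n) A)) (by simp)
    (fderiv ℝ f)).trans (tsupport_fderiv_subset ℝ)

/-! ### Mass -/

/-- By homogeneity: `C⁻¹ • f` competes in the supremum over every open set containing `A`. If `f` is
not a test form, the left side is zero. -/
theorem enorm_ev_le_mass_mul (T : Current Ω n) {A : Set (CSpace k)} {f : CSpace k → Form k n}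
    (hA : tsupport f ⊆ A) {C : ℝ} (hC : 0 < C) (hfC : ∀ x, ‖f x‖ ≤ C) :
    ‖ev T f‖ₑ ≤ mass T A * ENNReal.ofReal C := by
  by_cases hf : IsTest Ω f
  swap
  · simp [ev, hf]
  have hC' : ENNReal.ofReal C ≠ 0 := by simpa using hC
  rw [← ENNReal.div_le_iff_le_mul (Or.inl hC') (Or.inl ENNReal.ofReal_ne_top)]
  refine le_iInf₂ fun W _ => le_iInf fun hAW => ?_
  have h1 : IsTest Ω (fun x => ((C⁻¹ : ℝ) : ℂ) • f x) := hf.const_smul _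
  have h2 : ‖T h1.toTest‖ₑ = ‖ev T f‖ₑ / ENNReal.ofReal C := by
    rw [← ev_of_isTest T h1, ev_const_smul T hf, enorm_mul, mul_comm, div_eq_mul_inv]
    congr 1
    rw [← ENNReal.ofReal_inv_of_pos hC, ← ofReal_norm, Complex.norm_real,
      Real.norm_of_nonneg (by positivity)]
  rw [← h2]
  refine le_iSup₂_of_le h1.toTest ?_ (le_iSup_of_le ?_ le_rfl)
  · refine (closure_mono fun x hx => ?_).trans (hA.trans hAW)
    intro h3
    exact hx (by simp [IsTest.toTest, h3])
  · intro x
    change ‖((C⁻¹ : ℝ) : ℂ) • f x‖ ≤ 1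
    rw [norm_smul, Complex.norm_real, Real.norm_of_nonneg (by positivity), inv_mul_le_iff₀ hC,
      mul_one]
    exact hfC x

theorem mass_mono (T : Current Ω n) {A B : Set (CSpace k)} (h : A ⊆ B) : mass T A ≤ mass T B :=
  le_iInf₂ fun W hW => le_iInf fun hB => iInf₂_le_of_le W hW (iInf_le _ (h.trans hB))

/-- To bound the mass of `A` it is enough to bound the current on forms supported in an open set
containing `A`. -/
theorem mass_le_of_forall (T : Current Ω n) {A W : Set (CSpace k)} (hW : IsOpen W) (hA : A ⊆ W)
    {C : ℝ≥0∞} (h : ∀ f : CSpace k → Form k n, IsTest Ω f → tsupport f ⊆ W →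
      (∀ x, ‖f x‖ ≤ 1) → ‖ev T f‖ₑ ≤ C) : mass T A ≤ C := by
  refine iInf₂_le_of_le W hW (iInf_le_of_le hA ?_)
  refine iSup₂_le fun φ h1 => iSup_le fun h2 => ?_
  rw [← ev_coe]
  exact h φ (isTest_coe φ) h1 h2

end TestFunctions

/-! ### Exterior algebra -/

section ExteriorAlgebra

variable {k n : ℕ}

/-- The wedge product of a linear form and an exterior form. -/
def wedge (a : CSpace k →L[ℝ] ℂ) (β : Form k n) : Form k (n + 1) := alt k n (a.smulRight β)

theorem alt_apply (A : CSpace k →L[ℝ] Form k n) (v : Fin (n + 1) → CSpace k) :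
    alt k n A v = ∑ i : Fin (n + 1), (-1 : ℤ) ^ (i : ℕ) • A (v i) (i.removeNth v) :=
  ContinuousAlternatingMap.alternatizeUncurryFin_apply A v

theorem wedge_add_left (a b : CSpace k →L[ℝ] ℂ) (β : Form k n) :
    wedge (a + b) β = wedge a β + wedge b β := by
  rw [wedge, wedge, wedge, ← map_add]
  congr 1
  ext1 v
  simp [add_smul]

theorem wedge_add_right (a : CSpace k →L[ℝ] ℂ) (β γ : Form k n) :
    wedge a (β + γ) = wedge a β + wedge a γ := by
  rw [wedge, wedge, wedge, ← map_add]
  congr 1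
  ext1 v
  simp [smul_add]

theorem wedge_smul_left (c : ℂ) (a : CSpace k →L[ℝ] ℂ) (β : Form k n) :
    wedge (c • a) β = c • wedge a β := by
  rw [wedge, wedge, ← map_smul]
  congr 1
  ext1 v
  simp [mul_smul]

theorem wedge_smul_right (c : ℂ) (a : CSpace k →L[ℝ] ℂ) (β : Form k n) :
    wedge a (c • β) = c • wedge a β := by
  rw [wedge, wedge, ← map_smul]
  congr 1
  ext1 v
  simp [smul_comm c]

/-- The wedge product as a bilinear map. -/
def wedgeL : (CSpace k →L[ℝ] ℂ) →ₗ[ℂ] Form k n →ₗ[ℂ] Form k (n + 1) :=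
  LinearMap.mk₂ ℂ wedge wedge_add_left wedge_smul_left wedge_add_right wedge_smul_right

theorem wedgeL_apply (a : CSpace k →L[ℝ] ℂ) (β : Form k n) : wedgeL a β = wedge a β := rfl

/-- Supplies the symmetric bilinear map whose double alternatization, being zero, gives the sign
rule `alt_wedge`. -/
theorem exists_symmetrization {G : Type*} [NormedAddCommGroup G] [NormedSpace ℝ G]
    [NormedSpace ℂ G] [IsScalarTower ℝ ℂ G] (a : CSpace k →L[ℝ] ℂ) (A : CSpace k →L[ℝ] G) :
    ∃ f : CSpace k →L[ℝ] CSpace k →L[ℝ] G, ∀ v w, f v w = a v • A w + a w • A v := by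
  let f1 : CSpace k →L[ℝ] CSpace k →L[ℝ] G := a.smulRight A
  exact ⟨f1 + f1.flip, fun v w => by simp [f1]⟩

/-- Alternating twice kills a symmetric bilinear map, the algebraic fact behind `d² = 0`. Applied to
the symmetrization of `a ⊗ A`, the two halves give `a ∧ alt A` and `alt B`, which must cancel. Both
anticommutativity and the sign in the Leibniz rule come from here. -/
theorem alt_wedge (a : CSpace k →L[ℝ] ℂ) (A : CSpace k →L[ℝ] Form k n)
    (B : CSpace k →L[ℝ] Form k (n + 1)) (hB : ∀ v, B v = wedge a (A v)) :
    alt k (n + 1) B = - wedge a (alt k n A) := by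
  obtain ⟨f, hf'⟩ := exists_symmetrization a A
  have hf : ∀ x y, f x y = f y x := fun x y => by rw [hf', hf', add_comm]
  have h0 := ContinuousAlternatingMap.alternatizeUncurryFin_alternatizeUncurryFinCLM_comp_of_symmetric
    hf
  have h1 : (ContinuousAlternatingMap.alternatizeUncurryFinCLM ℝ (CSpace k) ℂ).comp f
      = a.smulRight (alt k n A) + B := by
    ext1 v
    have h2 : f v = a v • A + a.smulRight (A v) := by
      ext1 w
      simp [hf']
    have h3 : alt k n (f v) = a v • alt k n A + wedge a (A v) := by
      rw [h2, map_add, map_smul]; rfl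
    rw [add_apply, hB v]
    exact h3
  rw [h1] at h0
  have h4 : alt k (n + 1) (a.smulRight (alt k n A)) + alt k (n + 1) B = 0 := by
    rw [← map_add]; exact h0
  exact eq_neg_of_add_eq_zero_right h4

theorem wedge_anticomm (a b : CSpace k →L[ℝ] ℂ) (β : Form k n) :
    wedge a (wedge b β) = - wedge b (wedge a β) := by
  refine alt_wedge b (a.smulRight β) _ fun v => ?_
  simp only [ContinuousLinearMap.smulRight_apply]
  rw [wedge_smul_right]

theorem wedgeBilin_smulRight (a b : CSpace k →L[ℝ] ℂ) (β : Form k n) :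
    wedgeBilin (a.smulRight b) β = wedge a (wedge b β) := by
  rw [wedgeBilin, wedge]
  congr 1
  ext1 v
  change alt k n _ = a v • alt k n (b.smulRight β)
  rw [← map_smul]
  congr 1
  ext1 w
  simp [mul_smul]

theorem wedgeBilin_apply (B : CSpace k →L[ℝ] CSpace k →L[ℝ] ℂ) (β : Form k n)
    (C : CSpace k →L[ℝ] Form k (n + 1)) (hC : ∀ v, C v = wedge (B v) β) :
    wedgeBilin B β = alt k (n + 1) C := by
  rw [wedgeBilin]
  congr 1
  ext1 v
  rw [hC]
  rfl

theorem wedgeBilin_add (B C : CSpace k →L[ℝ] CSpace k →L[ℝ] ℂ) (β : Form k n) :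
    wedgeBilin (B + C) β = wedgeBilin B β + wedgeBilin C β := by
  rw [wedgeBilin, wedgeBilin, wedgeBilin, ← map_add]
  congr 1
  ext1 v
  change wedge (B v + C v) β = wedge (B v) β + wedge (C v) β
  exact wedge_add_left _ _ _

theorem wedgeBilin_smul (c : ℂ) (B : CSpace k →L[ℝ] CSpace k →L[ℝ] ℂ) (β : Form k n) :
    wedgeBilin (c • B) β = c • wedgeBilin B β := by
  rw [wedgeBilin, wedgeBilin, ← map_smul]
  congr 1
  ext1 v
  exact wedge_smul_left c (B v) β

theorem wedgeBilin_smul_right (c : ℂ) (B : CSpace k →L[ℝ] CSpace k →L[ℝ] ℂ) (β : Form k n) :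
    wedgeBilin B (c • β) = c • wedgeBilin B β := by
  rw [wedgeBilin, wedgeBilin, ← map_smul]
  congr 1
  ext1 v
  exact wedge_smul_right c (B v) β

/-- The conjugate of a complex valued `ℝ`-linear form. -/
def conjForm (a : CSpace k →L[ℝ] ℂ) : CSpace k →L[ℝ] ℂ := (Complex.conjCLE : ℂ →L[ℝ] ℂ).comp a

theorem conjForm_apply (a : CSpace k →L[ℝ] ℂ) (v : CSpace k) :
    conjForm a v = starRingEnd ℂ (a v) := rfl

theorem conjForm_add (a b : CSpace k →L[ℝ] ℂ) : conjForm (a + b) = conjForm a + conjForm b := by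
  ext v; simp [conjForm_apply]

theorem conjForm_smul (c : ℂ) (a : CSpace k →L[ℝ] ℂ) :
    conjForm (c • a) = starRingEnd ℂ c • conjForm a := by
  ext v; simp [conjForm_apply]

theorem sesq_eq (α : CSpace k →L[ℂ] ℂ) :
    sesq α = (α.restrictScalars ℝ).smulRight (conjForm (α.restrictScalars ℝ)) := by
  ext v w
  simp [sesq, conjForm_apply]

theorem elementary_succ {q : ℕ} (α : Fin (q + 1) → (CSpace k →L[ℂ] ℂ)) :
    elementary (q + 1) α = (Complex.I • wedge ((α 0).restrictScalars ℝ)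
      (wedge (conjForm ((α 0).restrictScalars ℝ)) (elementary q (Fin.tail α))) :
        Form k (2 * q + 1 + 1)) := by
  rw [← wedgeBilin_smulRight, ← sesq_eq]
  rfl

/-! ### Linear and antilinear parts -/

section Parts

variable {G : Type*} [NormedAddCommGroup G] [NormedSpace ℝ G] [NormedSpace ℂ G]
  [IsScalarTower ℝ ℂ G]

theorem linPart_apply (A : CSpace k →L[ℝ] G) (v : CSpace k) :
    linPart k G A v = (1 / 2 : ℂ) • (A v - Complex.I • A (Complex.I • v)) := rfl

theorem antiPart_apply (A : CSpace k →L[ℝ] G) (v : CSpace k) :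
    antiPart k G A v = (1 / 2 : ℂ) • (A v + Complex.I • A (Complex.I • v)) := rfl

theorem linPart_add_antiPart (A : CSpace k →L[ℝ] G) : linPart k G A + antiPart k G A = A := by
  ext v
  rw [add_apply, linPart_apply, antiPart_apply]
  module

theorem ofReal_smul_eq (r : ℝ) (x : G) : (r : ℂ) • x = r • x := algebraMap_smul ℂ r x

theorem map_complex_smul (A : CSpace k →L[ℝ] G) (c : ℂ) (v : CSpace k) :
    A (c • v) = (c.re : ℂ) • A v + (c.im : ℂ) • A (Complex.I • v) := by
  have h : c • v = c.re • v + c.im • (Complex.I • v) := by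
    conv_lhs => rw [← Complex.re_add_im c]
    rw [add_smul, mul_smul]
    simp only [Complex.coe_smul]
  rw [h, map_add, map_smul, map_smul, ofReal_smul_eq, ofReal_smul_eq]

theorem linPart_smul_apply (A : CSpace k →L[ℝ] G) (c : ℂ) (v : CSpace k) :
    linPart k G A (c • v) = c • linPart k G A v := by
  rw [map_complex_smul (linPart k G A) c v]
  have h : linPart k G A (Complex.I • v) = Complex.I • linPart k G A v := by
    rw [linPart_apply, linPart_apply, smul_smul Complex.I Complex.I v, Complex.I_mul_I,
      neg_one_smul, map_neg]
    have := Complex.I_mul_I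
    match_scalars <;> first | ring1 | linear_combination (1 / 2 : ℂ) * this
  rw [h, smul_smul, ← add_smul, Complex.re_add_im]

theorem antiPart_smul_apply (A : CSpace k →L[ℝ] G) (c : ℂ) (v : CSpace k) :
    antiPart k G A (c • v) = starRingEnd ℂ c • antiPart k G A v := by
  rw [map_complex_smul (antiPart k G A) c v]
  have h : antiPart k G A (Complex.I • v) = -Complex.I • antiPart k G A v := by
    rw [antiPart_apply, antiPart_apply, smul_smul Complex.I Complex.I v, Complex.I_mul_I,
      neg_one_smul, map_neg]
    have := Complex.I_mul_I
    match_scalars <;> first | ring1 | linear_combination (1 / 2 : ℂ) * this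
  rw [h, smul_smul, ← add_smul]
  congr 1
  apply Complex.ext <;> simp

/-- The coordinate form `dz_j`. -/
def dz (j : Fin k) : CSpace k →L[ℂ] ℂ := EuclideanSpace.proj j

theorem apply_eq_sum_parts (A : CSpace k →L[ℝ] G) (v : CSpace k) :
    A v = ∑ j, (dz j v • linPart k G A (EuclideanSpace.single j 1) +
      starRingEnd ℂ (dz j v) • antiPart k G A (EuclideanSpace.single j 1)) := by
  have hv : v = ∑ j, v j • EuclideanSpace.single j (1 : ℂ) := by
    ext i
    simp [Finset.sum_apply, Pi.single_apply]
  conv_lhs => rw [← linPart_add_antiPart A, add_apply, hv]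
  rw [map_sum, map_sum, ← Finset.sum_add_distrib]
  refine Finset.sum_congr rfl fun j _ => ?_
  rw [linPart_smul_apply, antiPart_smul_apply]
  rfl

end Parts

/-! ### Types -/

theorem IsOfType.add {a b : ℕ} {β γ : Form k n} (hβ : IsOfType a b β) (hγ : IsOfType a b γ) :
    IsOfType a b (β + γ) := fun c v => by
  rw [ContinuousAlternatingMap.add_apply, hβ, hγ, ContinuousAlternatingMap.add_apply]; ring

theorem IsOfType.smul {a b : ℕ} {β : Form k n} (hβ : IsOfType a b β) (c : ℂ) :
    IsOfType a b (c • β) := fun d v => by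
  have h : ∀ w, (c • β) w = c * β w := fun w => rfl
  rw [h, h, hβ]; ring

theorem IsOfType.alt_lin {a b : ℕ} {A : CSpace k →L[ℝ] Form k n}
    (hA : ∀ v, IsOfType a b (A v)) (hl : ∀ (c : ℂ) v, A (c • v) = c • A v) :
    IsOfType (a + 1) b (alt k n A) := fun c v => by
  rw [alt_apply, alt_apply, Finset.mul_sum]
  refine Finset.sum_congr rfl fun i _ => ?_
  have h : A (c • v i) (i.removeNth fun j => c • v j)
      = c * (c ^ a * (starRingEnd ℂ c) ^ b * A (v i) (i.removeNth v)) := by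
    rw [hl, ← hA (v i)]; rfl
  rw [h]
  simp only [zsmul_eq_mul]
  ring

theorem IsOfType.alt_anti {a b : ℕ} {A : CSpace k →L[ℝ] Form k n}
    (hA : ∀ v, IsOfType a b (A v)) (hl : ∀ (c : ℂ) v, A (c • v) = starRingEnd ℂ c • A v) :
    IsOfType a (b + 1) (alt k n A) := fun c v => by
  rw [alt_apply, alt_apply, Finset.mul_sum]
  refine Finset.sum_congr rfl fun i _ => ?_
  have h : A (c • v i) (i.removeNth fun j => c • v j)
      = starRingEnd ℂ c * (c ^ a * (starRingEnd ℂ c) ^ b * A (v i) (i.removeNth v)) := by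
    rw [hl, ← hA (v i)]; rfl
  rw [h]
  simp only [zsmul_eq_mul]
  ring

theorem IsOfType.wedge_lin {a b : ℕ} {β : Form k n} (hβ : IsOfType a b β)
    {α : CSpace k →L[ℝ] ℂ} (hα : ∀ (c : ℂ) v, α (c • v) = c * α v) :
    IsOfType (a + 1) b (wedge α β) :=
  IsOfType.alt_lin (fun v => by simpa using hβ.smul (α v)) fun c v => by
    simp only [ContinuousLinearMap.smulRight_apply, hα, mul_smul]

theorem IsOfType.wedge_anti {a b : ℕ} {β : Form k n} (hβ : IsOfType a b β)
    {α : CSpace k →L[ℝ] ℂ} (hα : ∀ (c : ℂ) v, α (c • v) = starRingEnd ℂ c * α v) :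
    IsOfType a (b + 1) (wedge α β) :=
  IsOfType.alt_anti (fun v => by simpa using hβ.smul (α v)) fun c v => by
    simp only [ContinuousLinearMap.smulRight_apply, hα, mul_smul]

theorem conjForm_smul_apply {α : CSpace k →L[ℂ] ℂ} (c : ℂ) (v : CSpace k) :
    conjForm (α.restrictScalars ℝ) (c • v)
      = starRingEnd ℂ c * conjForm (α.restrictScalars ℝ) v := by
  simp [conjForm_apply]

theorem isOfType_elementary : ∀ {q : ℕ} (α : Fin q → (CSpace k →L[ℂ] ℂ)),
    IsOfType q q (elementary q α)
  | 0, α => fun c v => by simp [elementary]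
  | q + 1, α => by
    rw [elementary_succ]
    refine IsOfType.smul ?_ _
    exact ((isOfType_elementary (Fin.tail α)).wedge_anti conjForm_smul_apply).wedge_lin
      fun c v => by simp

/-! ### Words in the coordinate forms -/

/-- `β` is a wedge product of `a` forms `dz_j` and `b` forms `dz̄_j`, in some order. -/
inductive IsWord : (n a b : ℕ) → Form k n → Prop
  | nil : IsWord 0 0 0 (ContinuousAlternatingMap.constOfIsEmpty ℝ (CSpace k) (Fin 0) (1 : ℂ))
  | lin {n a b : ℕ} {β : Form k n} (j : Fin k) : IsWord n a b β →
      IsWord (n + 1) (a + 1) b (wedge ((dz j).restrictScalars ℝ) β)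
  | anti {n a b : ℕ} {β : Form k n} (j : Fin k) : IsWord n a b β →
      IsWord (n + 1) a (b + 1) (wedge (conjForm ((dz j).restrictScalars ℝ)) β)

theorem IsWord.isOfType {a b : ℕ} {β : Form k n} (h : IsWord n a b β) : IsOfType a b β := by
  induction h with
  | nil => intro c v; simp
  | lin j _ ih => exact ih.wedge_lin fun c v => by simp
  | anti j _ ih => exact ih.wedge_anti conjForm_smul_apply

theorem IsWord.add_eq {a b : ℕ} {β : Form k n} (h : IsWord n a b β) : a + b = n := by
  induction h with
  | nil => rfl
  | lin j _ ih => omega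
  | anti j _ ih => omega

/-- Induction on the degree. A form of degree `n + 1` is `1/(n + 1)` times the alternatization of
its curried map, and that map splits along the `dz_j` and `dz̄_j` into forms of degree `n`. -/
theorem span_isWord : ∀ n : ℕ,
    Submodule.span ℂ {β : Form k n | ∃ a b, IsWord n a b β} = ⊤
  | 0 => by
    rw [eq_top_iff]
    intro β _
    have : β = β 0 • ContinuousAlternatingMap.constOfIsEmpty ℝ (CSpace k) (Fin 0) (1 : ℂ) := by
      ext v
      rw [Subsingleton.elim v 0]
      change β 0 = β 0 * 1
      rw [mul_one]
    rw [this]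
    exact Submodule.smul_mem _ _ (Submodule.subset_span ⟨0, 0, .nil⟩)
  | n + 1 => by
    have key : ∀ (a : CSpace k →L[ℝ] ℂ), (∀ n' a' b' (β : Form k n'), IsWord n' a' b' β →
        ∃ a'' b'', IsWord (n' + 1) a'' b'' (wedge a β)) → ∀ β : Form k n,
        wedge a β ∈ Submodule.span ℂ {β : Form k (n + 1) | ∃ a b, IsWord (n + 1) a b β} := by
      intro a ha β
      have hβ : β ∈ Submodule.span ℂ {β : Form k n | ∃ a b, IsWord n a b β} := by
        rw [span_isWord n]; trivial
      induction hβ using Submodule.span_induction with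
      | mem x hx =>
        obtain ⟨a', b', h⟩ := hx
        exact Submodule.subset_span (ha _ _ _ _ h)
      | zero =>
        rw [← wedgeL_apply, map_zero]; exact Submodule.zero_mem _
      | add x y _ _ hx hy => rw [wedge_add_right]; exact Submodule.add_mem _ hx hy
      | smul c x _ hx => rw [wedge_smul_right]; exact Submodule.smul_mem _ _ hx
    rw [eq_top_iff]
    intro β _
    have h1 : ((n + 1 : ℕ) : ℂ) • β = ∑ j,
        (wedge ((dz j).restrictScalars ℝ)
          (linPart k (Form k n) β.curryLeft (EuclideanSpace.single j 1)) +
        wedge (conjForm ((dz j).restrictScalars ℝ))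
          (antiPart k (Form k n) β.curryLeft (EuclideanSpace.single j 1))) := by
      have h2 : alt k n β.curryLeft = (n + 1) • β :=
        ContinuousAlternatingMap.alternatizeUncurryFin_curryLeft β
      rw [Nat.cast_smul_eq_nsmul, ← h2]
      simp only [wedge, ← map_add]
      rw [← map_sum]
      congr 1
      ext1 v
      rw [apply_eq_sum_parts β.curryLeft v, sum_apply]
      rfl
    have h3 : β = (((n + 1 : ℕ) : ℂ))⁻¹ • (((n + 1 : ℕ) : ℂ) • β) := by
      rw [smul_smul, inv_mul_cancel₀ (by exact_mod_cast Nat.succ_ne_zero n), one_smul]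
    rw [h3, h1]
    refine Submodule.smul_mem _ _ (Submodule.sum_mem _ fun j _ => Submodule.add_mem _ ?_ ?_)
    · exact key _ (fun _ _ _ _ h => ⟨_, _, .lin j h⟩) _
    · exact key _ (fun _ _ _ _ h => ⟨_, _, .anti j h⟩) _

theorem wedge_neg (a : CSpace k →L[ℝ] ℂ) (β : Form k n) : wedge a (-β) = -wedge a β :=
  map_neg (wedgeL a) β

/-- Anticommutativity carries some letter `dz_j` to the front, at the price of a sign. The indices
stay free, tied by equations, so that the induction on words applies; this is why the equality of
forms is heterogeneous. -/
theorem IsWord.exists_lin {m c b : ℕ} {β : Form k m} (h : IsWord m c b β) :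
    ∀ n a, m = n + 1 → c = a + 1 → ∃ (j : Fin k) (γ : Form k n), IsWord n a b γ ∧
      (HEq β (wedge ((dz j).restrictScalars ℝ) γ) ∨
        HEq β (-wedge ((dz j).restrictScalars ℝ) γ)) := by
  induction h with
  | nil => intro n a h; omega
  | @lin n a b β j h _ =>
    intro n' a' h1 h2
    obtain rfl : n = n' := by omega
    obtain rfl : a = a' := by omega
    exact ⟨j, β, h, Or.inl HEq.rfl⟩
  | @anti n c b β i h ih =>
    intro n' a h1 h2
    obtain rfl : n = n' := by omega
    have h3 := h.add_eq
    obtain ⟨m, rfl⟩ : ∃ m, n = m + 1 := ⟨n - 1, by omega⟩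
    obtain ⟨j, γ, hγ, hβ⟩ := ih m a rfl h2
    refine ⟨j, _, IsWord.anti i hγ, ?_⟩
    rcases hβ with hβ | hβ
    · right
      rw [eq_of_heq hβ, ← wedge_anticomm]
    · left
      rw [eq_of_heq hβ, wedge_neg, wedge_anticomm, neg_neg]

theorem IsWord.exists_anti {m a c : ℕ} {β : Form k m} (h : IsWord m a c β) :
    ∀ n b, m = n + 1 → c = b + 1 → ∃ (j : Fin k) (γ : Form k n), IsWord n a b γ ∧
      (HEq β (wedge (conjForm ((dz j).restrictScalars ℝ)) γ) ∨
        HEq β (-wedge (conjForm ((dz j).restrictScalars ℝ)) γ)) := by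
  induction h with
  | nil => intro n a h; omega
  | @anti n a b β j h _ =>
    intro n' b' h1 h2
    obtain rfl : n = n' := by omega
    obtain rfl : b = b' := by omega
    exact ⟨j, β, h, Or.inl HEq.rfl⟩
  | @lin n a c β i h ih =>
    intro n' b h1 h2
    obtain rfl : n = n' := by omega
    have h3 := h.add_eq
    obtain ⟨m, rfl⟩ : ∃ m, n = m + 1 := ⟨n - 1, by omega⟩
    obtain ⟨j, γ, hγ, hβ⟩ := ih m b rfl h2
    refine ⟨j, _, IsWord.lin i hγ, ?_⟩
    rcases hβ with hβ | hβ
    · right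
      rw [eq_of_heq hβ, ← wedge_anticomm]
    · left
      rw [eq_of_heq hβ, wedge_neg, wedge_anticomm, neg_neg]

/-- Polarization of `iα ∧ ᾱ`. -/
theorem wedge_wedge_conj_polarization (a b : CSpace k →L[ℝ] ℂ) (β : Form k n) :
    wedge a (wedge (conjForm b) β) = (-Complex.I / 4) •
      (Complex.I • wedge (a + b) (wedge (conjForm (a + b)) β)
        - Complex.I • wedge (a + (-1 : ℂ) • b) (wedge (conjForm (a + (-1 : ℂ) • b)) β)
        + Complex.I • (Complex.I • wedge (a + Complex.I • b)
            (wedge (conjForm (a + Complex.I • b)) β))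
        - Complex.I • (Complex.I • wedge (a + (-Complex.I) • b)
            (wedge (conjForm (a + (-Complex.I) • b)) β))) := by
  simp only [conjForm_add, conjForm_smul, wedge_add_left, wedge_add_right, wedge_smul_left,
    wedge_smul_right, map_neg, map_one, Complex.conj_I]
  have h4 : Complex.I ^ 4 = 1 := Complex.I_pow_four
  match_scalars <;> ring_nf <;> simp only [Complex.I_sq, h4] <;> ring

/-- Bring one `dz_i` and one `dz̄_j` to the front and treat the remaining word by induction.
Polarization then turns `dz_i ∧ dz̄_j` into a complex combination of four forms `iα ∧ ᾱ`. This is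
what allows positivity to control all the coefficients of a current. -/
theorem IsWord.mem_span_elementary : ∀ {q : ℕ} {β : Form k (2 * q)}, IsWord (2 * q) q q β →
    β ∈ Submodule.span ℂ (Set.range (elementary (k := k) q))
  | 0, β, h => by
    cases h
    exact Submodule.subset_span ⟨Fin.elim0, rfl⟩
  | q + 1, β, h => by
    obtain ⟨i, γ, hγ, hβ⟩ := h.exists_lin (2 * q + 1) q rfl rfl
    obtain ⟨j, δ, hδ, hγ'⟩ := hγ.exists_anti (2 * q) q rfl rfl
    have key : ∀ (a b : CSpace k →L[ℂ] ℂ) (ε : Form k (2 * q)),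
        ε ∈ Submodule.span ℂ (Set.range (elementary (k := k) q)) →
        (wedge (a.restrictScalars ℝ) (wedge (conjForm (b.restrictScalars ℝ)) ε) :
          Form k (2 * q + 1 + 1)) ∈
          Submodule.span ℂ (Set.range (elementary (k := k) (q + 1))) := by
      intro a b ε hε
      induction hε using Submodule.span_induction with
      | mem x hx =>
        obtain ⟨α, rfl⟩ := hx
        have h1 : ∀ c : CSpace k →L[ℂ] ℂ, (Complex.I • wedge (c.restrictScalars ℝ)
            (wedge (conjForm (c.restrictScalars ℝ)) (elementary q α)) :
            Form k (2 * q + 1 + 1)) ∈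
            Submodule.span ℂ (Set.range (elementary (k := k) (q + 1))) := by
          intro c
          refine Submodule.subset_span ⟨Fin.cons c α, ?_⟩
          rw [elementary_succ]
          simp
        rw [wedge_wedge_conj_polarization]
        refine Submodule.smul_mem _ _ (Submodule.sub_mem _ (Submodule.add_mem _
          (Submodule.sub_mem _ ?_ ?_) (Submodule.smul_mem _ _ ?_)) (Submodule.smul_mem _ _ ?_))
        · exact h1 (a + b)
        · exact h1 (a + (-1 : ℂ) • b)
        · exact h1 (a + Complex.I • b)
        · exact h1 (a + (-Complex.I) • b)
      | zero =>
        rw [← wedgeL_apply, ← wedgeL_apply, map_zero, map_zero]; exact Submodule.zero_mem _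
      | add x y _ _ hx hy =>
        rw [wedge_add_right, wedge_add_right]; exact Submodule.add_mem _ hx hy
      | smul c x _ hx =>
        rw [wedge_smul_right, wedge_smul_right]; exact Submodule.smul_mem _ _ hx
    have h1 := key (dz i) (dz j) δ hδ.mem_span_elementary
    rcases hγ' with hγ' | hγ' <;> rcases hβ with hβ | hβ <;>
      rw [eq_of_heq hβ, eq_of_heq hγ'] <;> try rw [wedge_neg]
    · exact h1
    · exact Submodule.neg_mem _ h1
    · exact Submodule.neg_mem _ h1
    · rw [neg_neg]; exact h1

end ExteriorAlgebra

/-! ### Finite spanning families -/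

section Frames

variable {k n : ℕ}

scoped instance finiteDimensional_form : FiniteDimensional ℂ (Form k n) := by
  have h1 : FiniteDimensional ℝ (MultilinearMap ℝ (fun _ : Fin n => CSpace k) ℂ) := inferInstance
  let L : Form k n →ₗ[ℝ] MultilinearMap ℝ (fun _ : Fin n => CSpace k) ℂ :=
    { toFun := fun f => f.toMultilinearMap
      map_add' := fun f g => rfl
      map_smul' := fun c f => rfl }
  have hL : Function.Injective L := fun f g h => by
    ext v
    exact DFunLike.congr_fun h v
  have h2 : FiniteDimensional ℝ (Form k n) := FiniteDimensional.of_injective L hL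
  exact Module.Finite.of_restrictScalars_finite ℝ ℂ (Form k n)

/-- The family need not be independent: a linear right inverse of the map `c ↦ ∑ c i • e i` selects
coordinates, continuous by finite dimension. -/
theorem exists_coordinates {V : Type*} [NormedAddCommGroup V] [NormedSpace ℂ V]
    [FiniteDimensional ℂ V] {ι : Type*} [Fintype ι] (e : ι → V)
    (he : Submodule.span ℂ (Set.range e) = ⊤) :
    ∃ c : ι → (V →L[ℂ] ℂ), ∀ v, v = ∑ i, c i v • e i := by
  have h1 : LinearMap.range (Fintype.linearCombination ℂ e) = ⊤ := by
    rw [Fintype.range_linearCombination, he]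
  obtain ⟨g, hg⟩ := LinearMap.exists_rightInverse_of_surjective _ h1
  refine ⟨fun i => LinearMap.toContinuousLinearMap ((LinearMap.proj i).comp g), fun v => ?_⟩
  have h2 := LinearMap.congr_fun hg v
  simp only [LinearMap.comp_apply, Fintype.linearCombination_apply, LinearMap.id_apply] at h2
  exact h2.symm

theorem exists_elementary_family (k q : ℕ) :
    ∃ (N : ℕ) (E : Fin N → Fin q → (CSpace k →L[ℂ] ℂ)),
      Submodule.span ℂ (Set.range fun l => elementary q (E l))
        = Submodule.span ℂ (Set.range (elementary (k := k) q)) := by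
  have h : (Submodule.span ℂ (Set.range (elementary (k := k) q))).FG :=
    IsNoetherian.noetherian _
  obtain ⟨t, ht, hspan⟩ := (Submodule.fg_span_iff_fg_span_finset_subset _).1 h
  choose! E hE using fun x (hx : x ∈ t) => ht hx
  refine ⟨t.card, fun l => E (t.equivFin.symm l), ?_⟩
  rw [hspan]
  congr 1
  ext x
  constructor
  · rintro ⟨l, rfl⟩
    simp only
    rw [hE _ (t.equivFin.symm l).2]
    exact (t.equivFin.symm l).2
  · intro hx
    refine ⟨t.equivFin ⟨x, hx⟩, ?_⟩
    simp [hE x hx]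

/-- The number of elements of a finite family of forms `iα₁ ∧ ᾱ₁ ∧ … ∧ iα_q ∧ ᾱ_q` with the same
complex span as all of them. -/
def frameCard (k q : ℕ) : ℕ := (exists_elementary_family k q).choose

/-- A finite family of forms `iα₁ ∧ ᾱ₁ ∧ … ∧ iα_q ∧ ᾱ_q` with the same complex span as all of
them. -/
def frame (k q : ℕ) (l : Fin (frameCard k q)) : Form k (2 * q) :=
  elementary q ((exists_elementary_family k q).choose_spec.choose l)

theorem span_frame (k q : ℕ) : Submodule.span ℂ (Set.range (frame k q))
    = Submodule.span ℂ (Set.range (elementary (k := k) q)) :=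
  (exists_elementary_family k q).choose_spec.choose_spec

theorem exists_frame_eq (q : ℕ) (l : Fin (frameCard k q)) :
    ∃ α, frame k q l = elementary q α := ⟨_, rfl⟩

variable (k) in
/-- The sum of the forms of the frame: a strongly positive form in the interior of the cone. -/
def frameSum (q : ℕ) : Form k (2 * q) := ∑ l, frame k q l

/-- Forms of degree `2q` decompose along the frame, up to forms whose type is not `(q,q)`. -/
theorem exists_frame_decomposition (k q : ℕ) :
    ∃ (c : Fin (frameCard k q) → (Form k (2 * q) →L[ℂ] ℂ)) (M : ℕ) (e : Fin M → Form k (2 * q))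
      (d : Fin M → (Form k (2 * q) →L[ℂ] ℂ)),
      (∀ i, ∃ a b, (a, b) ≠ (q, q) ∧ IsOfType a b (e i)) ∧
      ∀ β, β = ∑ l, c l β • frame k q l + ∑ i, d i β • e i := by
  let S : Set (Form k (2 * q)) := {β | ∃ a b, (a, b) ≠ (q, q) ∧ IsOfType a b β}
  obtain ⟨t, ht, hspan⟩ := (Submodule.fg_span_iff_fg_span_finset_subset (R := ℂ) S).1
    (IsNoetherian.noetherian _)
  let e : Fin t.card → Form k (2 * q) := fun i => t.equivFin.symm i
  have he : Set.range e = t := by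
    ext x
    constructor
    · rintro ⟨l, rfl⟩
      exact (t.equivFin.symm l).2
    · intro hx
      exact ⟨t.equivFin ⟨x, hx⟩, by simp [e]⟩
  -- Words span all forms; a word of type `(q,q)` lies in the span of the frame, and every other
  -- word lies in `S`.
  have hall : Submodule.span ℂ (Set.range (Sum.elim (frame k q) e)) = ⊤ := by
    rw [Set.Sum.elim_range, Submodule.span_union, span_frame, he, ← hspan, eq_top_iff,
      ← span_isWord, Submodule.span_le]
    rintro β ⟨a, b, h⟩
    by_cases hab : (a, b) = (q, q)
    · obtain ⟨rfl, rfl⟩ := Prod.mk.inj hab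
      exact Submodule.mem_sup_left h.mem_span_elementary
    · exact Submodule.mem_sup_right (Submodule.subset_span ⟨a, b, hab, h.isOfType⟩)
  obtain ⟨c, hc⟩ := exists_coordinates _ hall
  refine ⟨fun l => c (Sum.inl l), t.card, e, fun i => c (Sum.inr i), fun i => ?_, fun β => ?_⟩
  · exact ht (t.equivFin.symm i).2
  · conv_lhs => rw [hc β]
    rw [Fintype.sum_sum_type]
    rfl

/-- Forms of degree `2q+1` decompose along the products of a coordinate form and an element of the
frame, up to forms whose type is neither `(q+1,q)` nor `(q,q+1)`. -/
theorem exists_frame_decomposition_odd (k q : ℕ) :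
    ∃ (c d : Fin k → Fin (frameCard k q) → (Form k (2 * q + 1) →L[ℂ] ℂ)) (M : ℕ)
      (e : Fin M → Form k (2 * q + 1)) (f : Fin M → (Form k (2 * q + 1) →L[ℂ] ℂ)),
      (∀ i, ∃ a b, (a, b) ≠ (q + 1, q) ∧ (a, b) ≠ (q, q + 1) ∧ IsOfType a b (e i)) ∧
      ∀ β, β = ∑ j, ∑ l, (c j l β • wedge (conjForm ((dz j).restrictScalars ℝ)) (frame k q l)
        + d j l β • wedge ((dz j).restrictScalars ℝ) (frame k q l)) + ∑ i, f i β • e i := by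
  let S : Set (Form k (2 * q + 1)) :=
    {β | ∃ a b, (a, b) ≠ (q + 1, q) ∧ (a, b) ≠ (q, q + 1) ∧ IsOfType a b β}
  obtain ⟨t, ht, hspan⟩ := (Submodule.fg_span_iff_fg_span_finset_subset (R := ℂ) S).1
    (IsNoetherian.noetherian _)
  let e : Fin t.card → Form k (2 * q + 1) := fun i => t.equivFin.symm i
  have he : Set.range e = t := by
    ext x
    constructor
    · rintro ⟨l, rfl⟩
      exact (t.equivFin.symm l).2
    · intro hx
      exact ⟨t.equivFin ⟨x, hx⟩, by simp [e]⟩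
  let u : Fin k × Fin (frameCard k q) → Form k (2 * q + 1) :=
    fun x => wedge (conjForm ((dz x.1).restrictScalars ℝ)) (frame k q x.2)
  let w : Fin k × Fin (frameCard k q) → Form k (2 * q + 1) :=
    fun x => wedge ((dz x.1).restrictScalars ℝ) (frame k q x.2)
  -- Stated for a general family `a`, so as to serve both for `dz_j` and for `dz̄_j`.
  have hspanw : ∀ (a : Fin k → CSpace k →L[ℝ] ℂ) (j : Fin k) (γ : Form k (2 * q)),
      IsWord (2 * q) q q γ → wedge (a j) γ ∈ Submodule.span ℂ
        (Set.range fun x : Fin k × Fin (frameCard k q) => wedge (a x.1) (frame k q x.2)) := by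
    intro a j γ hγ
    have h1 := hγ.mem_span_elementary
    rw [← span_frame] at h1
    clear hγ
    induction h1 using Submodule.span_induction with
    | mem x hx =>
      obtain ⟨l, rfl⟩ := hx
      exact Submodule.subset_span ⟨(j, l), rfl⟩
    | zero => rw [← wedgeL_apply, map_zero]; exact Submodule.zero_mem _
    | add x y _ _ hx hy => rw [wedge_add_right]; exact Submodule.add_mem _ hx hy
    | smul c x _ hx => rw [wedge_smul_right]; exact Submodule.smul_mem _ _ hx
  have hall : Submodule.span ℂ (Set.range (Sum.elim (Sum.elim u w) e)) = ⊤ := by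
    rw [Set.Sum.elim_range, Set.Sum.elim_range, Submodule.span_union, Submodule.span_union, he,
      ← hspan, eq_top_iff, ← span_isWord, Submodule.span_le]
    rintro β ⟨a, b, h⟩
    by_cases hab : (a, b) = (q, q + 1)
    · obtain ⟨rfl, rfl⟩ := Prod.mk.inj hab
      obtain ⟨j, γ, hγ, hβ⟩ := h.exists_anti (2 * a) a rfl rfl
      refine Submodule.mem_sup_left (Submodule.mem_sup_left ?_)
      have h1 := hspanw (fun j => conjForm ((dz j).restrictScalars ℝ)) j γ hγ
      rcases hβ with hβ | hβ <;> rw [eq_of_heq hβ]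
      · exact h1
      · exact Submodule.neg_mem _ h1
    by_cases hab' : (a, b) = (q + 1, q)
    · obtain ⟨rfl, rfl⟩ := Prod.mk.inj hab'
      obtain ⟨j, γ, hγ, hβ⟩ := h.exists_lin (2 * b) b rfl rfl
      refine Submodule.mem_sup_left (Submodule.mem_sup_right ?_)
      have h1 := hspanw (fun j => (dz j).restrictScalars ℝ) j γ hγ
      rcases hβ with hβ | hβ <;> rw [eq_of_heq hβ]
      · exact h1
      · exact Submodule.neg_mem _ h1
    · exact Submodule.mem_sup_right (Submodule.subset_span ⟨a, b, hab', hab, h.isOfType⟩)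
  obtain ⟨c, hc⟩ := exists_coordinates _ hall
  refine ⟨fun j l => c (Sum.inl (Sum.inl (j, l))), fun j l => c (Sum.inl (Sum.inr (j, l))),
    t.card, e, fun i => c (Sum.inr i), fun i => ?_, fun β => ?_⟩
  · exact ht (t.equivFin.symm i).2
  · conv_lhs => rw [hc β]
    rw [Fintype.sum_sum_type, Fintype.sum_sum_type, Fintype.sum_prod_type, Fintype.sum_prod_type]
    simp only [Finset.sum_add_distrib]
    rfl

end Frames

/-! ### Cut-off functions -/

section Cutoff

open scoped Manifold

variable {k : ℕ}

theorem exists_cutoff {K W : Set (CSpace k)} (hK : IsCompact K) (hW : IsOpen W) (hKW : K ⊆ W) :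
    ∃ χ : CSpace k → ℝ, ContDiff ℝ ∞ χ ∧ HasCompactSupport χ ∧ tsupport χ ⊆ W ∧
      (∀ x, 0 ≤ χ x) ∧ (∀ x, χ x ≤ 1) ∧ ∀ᶠ x in 𝓝ˢ K, χ x = 1 := by
  obtain ⟨L, hL, hKL, hLW⟩ := exists_compact_between hK hW hKW
  obtain ⟨f, h1, h2, h3⟩ := exists_contMDiffMap_one_nhds_of_subset_interior (n := (⊤ : ℕ∞))
    𝓘(ℝ, CSpace k) hK.isClosed hKL
  have h4 : tsupport f ⊆ L := closure_minimal
    (fun x hx => by by_contra h; exact hx (h2 x h)) hL.isClosed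
  exact ⟨f, f.contMDiff.contDiff, hL.of_isClosed_subset (isClosed_tsupport _) h4, h4.trans hLW,
    fun x => (h3 x).1, fun x => (h3 x).2, h1⟩

/-- Near `x` the constant `max 0 (f x - δ/2)` lies in all the prescribed intervals, and a smooth
partition of unity glues such constants because the intervals are convex. It serves to split a test
form in smooth proportions. -/
theorem exists_smooth_approx_below {f : CSpace k → ℝ} (hf : Continuous f) (hf0 : ∀ x, 0 ≤ f x)
    {δ : ℝ} (hδ : 0 < δ) :
    ∃ g : CSpace k → ℝ, ContDiff ℝ ∞ g ∧ (∀ x, 0 ≤ g x) ∧ (∀ x, g x ≤ f x) ∧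
      ∀ x, f x ≤ g x + δ := by
  obtain ⟨g, hg⟩ := exists_contMDiffMap_forall_mem_convex_of_local_const (n := (⊤ : ℕ∞))
    𝓘(ℝ, CSpace k) (t := fun x => Set.Icc (max 0 (f x - δ)) (f x))
    (fun x => convex_Icc _ _) fun x => by
      refine ⟨max 0 (f x - δ / 2), ?_⟩
      have h1 : ∀ᶠ y in 𝓝 x, |f y - f x| < δ / 2 := by
        have := Metric.tendsto_nhds.1 (hf.tendsto x) (δ / 2) (by positivity)
        simpa [Real.dist_eq] using this
      filter_upwards [h1] with y hy
      rw [abs_lt] at hy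
      refine ⟨max_le_max le_rfl (by linarith), max_le (hf0 y) (by linarith)⟩
  refine ⟨g, g.contMDiff.contDiff, fun x => (le_max_left _ _).trans (hg x).1,
    fun x => (hg x).2, fun x => ?_⟩
  have := (le_max_right _ _).trans (hg x).1
  linarith

end Cutoff

/-! ### The total variation measure of a current of order zero -/

section Variation

open MeasureTheory
open scoped NNReal CompactlySupported

variable {k n : ℕ} {Ω : Opens (CSpace k)}

/-- The total variation of the current `N` on the function `f`: the supremum of `|N ψ|` over all
test forms with `|ψ| ≤ f`. -/
def variation (N : Current Ω n) (f : CSpace k → ℝ) : ℝ≥0∞ :=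
  ⨆ ψ : {ψ : CSpace k → Form k n // IsTest Ω ψ ∧ ∀ x, ‖ψ x‖ ≤ f x}, ‖ev N ψ.1‖ₑ

theorem le_variation (N : Current Ω n) {f : CSpace k → ℝ} {ψ : CSpace k → Form k n}
    (hψ : IsTest Ω ψ) (h : ∀ x, ‖ψ x‖ ≤ f x) : ‖ev N ψ‖ₑ ≤ variation N f :=
  le_iSup (fun ψ : {ψ : CSpace k → Form k n // IsTest Ω ψ ∧ ∀ x, ‖ψ x‖ ≤ f x} => ‖ev N ψ.1‖ₑ)
    ⟨ψ, hψ, h⟩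

theorem variation_le (N : Current Ω n) {f : CSpace k → ℝ} {C : ℝ≥0∞}
    (h : ∀ ψ : CSpace k → Form k n, IsTest Ω ψ → (∀ x, ‖ψ x‖ ≤ f x) → ‖ev N ψ‖ₑ ≤ C) :
    variation N f ≤ C := iSup_le fun ψ => h ψ.1 ψ.2.1 ψ.2.2

theorem exists_unit_mul_eq_norm (z : ℂ) : ∃ c : ℂ, ‖c‖ = 1 ∧ c * z = ‖z‖ := by
  by_cases hz : z = 0
  · exact ⟨1, by simp, by simp [hz]⟩
  · have h : (‖z‖ : ℂ) ≠ 0 := by simpa using hz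
    refine ⟨starRingEnd ℂ z / ‖z‖, ?_, ?_⟩
    · have h' : ‖z‖ ≠ 0 := by simpa using hz
      rw [norm_div, RCLike.norm_conj, Complex.norm_real, norm_norm, div_self h']
    · rw [div_mul_eq_mul_div, Complex.conj_mul', sq, mul_div_assoc, div_self h, mul_one]

/-- Unimodular constants rotate two competitors so that both values become non-negative reals; the
moduli then add up on the sum of the forms. -/
theorem add_variation_le (N : Current Ω n) {f g : CSpace k → ℝ} (hf : ∀ x, 0 ≤ f x)
    (hg : ∀ x, 0 ≤ g x) :
    variation N f + variation N g ≤ variation N (fun x => f x + g x) := by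
  have : Nonempty {ψ : CSpace k → Form k n // IsTest Ω ψ ∧ ∀ x, ‖ψ x‖ ≤ f x} :=
    ⟨⟨_, IsTest.zero, by simpa using hf⟩⟩
  have : Nonempty {ψ : CSpace k → Form k n // IsTest Ω ψ ∧ ∀ x, ‖ψ x‖ ≤ g x} :=
    ⟨⟨_, IsTest.zero, by simpa using hg⟩⟩
  refine ENNReal.iSup_add_iSup_le fun ψ φ => ?_
  obtain ⟨c, hc, hcψ⟩ := exists_unit_mul_eq_norm (ev N ψ.1)
  obtain ⟨d, hd, hdφ⟩ := exists_unit_mul_eq_norm (ev N φ.1)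
  have h1 := ψ.2.1.const_smul c
  have h2 := φ.2.1.const_smul d
  have h3 := le_variation N (f := fun x => f x + g x) (h1.add h2) fun x => by
    refine (norm_add_le _ _).trans (add_le_add ?_ ?_)
    · rw [norm_smul, hc, one_mul]; exact ψ.2.2 x
    · rw [norm_smul, hd, one_mul]; exact φ.2.2 x
  refine le_trans (le_of_eq ?_) h3
  rw [ev_add N h1 h2, ev_const_smul N ψ.2.1, ev_const_smul N φ.2.1, hcψ, hdφ, ← Complex.ofReal_add,
    ← ofReal_norm, ← ofReal_norm, ← ofReal_norm, Complex.norm_real,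
    Real.norm_of_nonneg (by positivity), ENNReal.ofReal_add (by positivity) (by positivity)]

/-- A competitor `ψ` for `f + g` is split in the proportions `f' : g' : 2δ`, where `f'` and `g'` are
smooth minorants within `δ` of `f` and `g`. The denominator `f' + g' + 2δ` is positive and dominates
`‖ψ‖`, so the first two pieces compete for `f` and `g`. The third has norm at most `2δ`, and its
contribution vanishes with `δ` by order zero. -/
theorem variation_add_le {N : Current Ω n} (hN : IsOfOrderZero N) {f g : CSpace k → ℝ}
    (hf : ∀ x, 0 ≤ f x) (hg : ∀ x, 0 ≤ g x) (hfc : Continuous f) (hgc : Continuous g) :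
    variation N (fun x => f x + g x) ≤ variation N f + variation N g := by
  refine variation_le N fun ψ hψ hψfg => ?_
  have hK : mass N (tsupport ψ) < ⊤ := hN _ hψ.compact hψ.subset
  have key : ∀ δ : ℝ, 0 < δ → ‖ev N ψ‖ₑ ≤ variation N f + variation N g
      + mass N (tsupport ψ) * ENNReal.ofReal (2 * δ) := by
    intro δ hδ
    obtain ⟨f', hf's, hf'0, hf'f, hf'δ⟩ := exists_smooth_approx_below hfc hf hδ
    obtain ⟨g', hg's, hg'0, hg'g, hg'δ⟩ := exists_smooth_approx_below hgc hg hδ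
    have hpos : ∀ x, 0 < f' x + g' x + 2 * δ := fun x => by
      have := hf'0 x; have := hg'0 x; positivity
    have hden : ContDiff ℝ ∞ (fun x => f' x + g' x + 2 * δ) :=
      (hf's.add hg's).add contDiff_const
    have hq : ∀ h : CSpace k → ℝ, ContDiff ℝ ∞ h →
        ContDiff ℝ ∞ (fun x => h x / (f' x + g' x + 2 * δ)) :=
      fun h hh => hh.div hden fun x => (hpos x).ne'
    have hle : ∀ x, f x + g x ≤ f' x + g' x + 2 * δ := fun x => by
      have := hf'δ x; have := hg'δ x; linarith
    have hbound : ∀ (h : CSpace k → ℝ), (∀ x, 0 ≤ h x) → ∀ x,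
        ‖(h x / (f' x + g' x + 2 * δ)) • ψ x‖ ≤ h x := by
      intro h hh x
      rw [norm_smul, Real.norm_of_nonneg (div_nonneg (hh x) (hpos x).le), div_mul_eq_mul_div,
        div_le_iff₀ (hpos x)]
      exact mul_le_mul_of_nonneg_left ((hψfg x).trans (hle x)) (hh x)
    have t1 := hψ.smul_real (hq f' hf's)
    have t2 := hψ.smul_real (hq g' hg's)
    have t3 := hψ.smul_real (hq (fun _ => 2 * δ) contDiff_const)
    have hsum : ψ = fun x => ((f' x / (f' x + g' x + 2 * δ)) • ψ x
        + (g' x / (f' x + g' x + 2 * δ)) • ψ x) + (2 * δ / (f' x + g' x + 2 * δ)) • ψ x := by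
      funext x
      rw [← add_smul, ← add_smul, ← add_div, ← add_div, div_self (hpos x).ne', one_smul]
    have hev : ev N ψ = ev N (fun x => (f' x / (f' x + g' x + 2 * δ)) • ψ x)
        + ev N (fun x => (g' x / (f' x + g' x + 2 * δ)) • ψ x)
        + ev N (fun x => (2 * δ / (f' x + g' x + 2 * δ)) • ψ x) := by
      conv_lhs => rw [hsum]
      rw [ev_add N (t1.add t2) t3, ev_add N t1 t2]
    rw [hev]
    refine (enorm_add_le _ _).trans (add_le_add ((enorm_add_le _ _).trans (add_le_add ?_ ?_)) ?_)
    · exact le_variation N t1 fun x => (hbound f' hf'0 x).trans (hf'f x)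
    · exact le_variation N t2 fun x => (hbound g' hg'0 x).trans (hg'g x)
    · refine enorm_ev_le_mass_mul N ?_ (by positivity) (hbound (fun _ => 2 * δ) fun _ => by positivity)
      refine closure_mono fun x hx h0 => hx ?_
      simp [h0]
  have hlim : Tendsto (fun δ : ℝ => variation N f + variation N g
      + mass N (tsupport ψ) * ENNReal.ofReal (2 * δ)) (𝓝[>] 0)
      (𝓝 (variation N f + variation N g + mass N (tsupport ψ) * ENNReal.ofReal (2 * 0))) := by
    refine Tendsto.const_add _ (ENNReal.Tendsto.const_mul ?_ (Or.inr hK.ne))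
    refine ENNReal.tendsto_ofReal (Tendsto.mono_left ?_ nhdsWithin_le_nhds)
    exact (continuous_const.mul continuous_id).tendsto 0
  rw [mul_zero, ENNReal.ofReal_zero, mul_zero, add_zero] at hlim
  exact ge_of_tendsto hlim (by filter_upwards [self_mem_nhdsWithin] with δ hδ using key δ hδ)

theorem mul_variation_le (N : Current Ω n) (f : CSpace k → ℝ) (c : ℝ≥0) :
    c * variation N f ≤ variation N (fun x => c * f x) := by
  rw [variation, ENNReal.mul_iSup]
  refine iSup_le fun ψ => ?_
  have h := le_variation N (f := fun x => (c : ℝ) * f x) (ψ.2.1.const_smul ((c : ℝ) : ℂ)) fun x => by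
    rw [norm_smul, Complex.norm_real, NNReal.norm_eq]
    exact mul_le_mul_of_nonneg_left (ψ.2.2 x) c.2
  rw [ev_const_smul N ψ.2.1, enorm_mul] at h
  refine le_trans (le_of_eq ?_) h
  congr 1
  rw [← ofReal_norm, Complex.norm_real, NNReal.norm_eq, ENNReal.ofReal_coe_nnreal]

theorem variation_mul (N : Current Ω n) (f : CSpace k → ℝ) {c : ℝ≥0} (hc : 0 < c) :
    variation N (fun x => c * f x) = c * variation N f := by
  refine le_antisymm ?_ (mul_variation_le N f c)
  have h := mul_variation_le N (fun x => (c : ℝ) * f x) c⁻¹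
  have h1 : (fun x => ((c⁻¹ : ℝ≥0) : ℝ) * ((c : ℝ) * f x)) = f := by
    funext x
    rw [← mul_assoc, NNReal.coe_inv, inv_mul_cancel₀ (by exact_mod_cast hc.ne'), one_mul]
  rw [h1] at h
  calc variation N (fun x => c * f x)
      = c * ((c⁻¹ : ℝ≥0) * variation N (fun x => c * f x)) := by
        rw [← mul_assoc, ← ENNReal.coe_mul, mul_inv_cancel₀ hc.ne', ENNReal.coe_one, one_mul]
    _ ≤ c * variation N f := by gcongr

theorem variation_zero (N : Current Ω n) : variation N (fun _ => 0) = 0 := by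
  refine le_antisymm (variation_le N fun ψ _ h => ?_) zero_le
  have : ψ = fun _ => 0 := funext fun x => by simpa using h x
  rw [this, ev_zero]
  simp

/-- Extension by zero of a compactly supported function on `Ω`. -/
def extendZero (F : C_c(Ω, ℝ≥0)) : CSpace k → ℝ :=
  Function.extend (Subtype.val : Ω → CSpace k) (fun y => (F y : ℝ)) 0

theorem extendZero_coe (F : C_c(Ω, ℝ≥0)) (y : Ω) : extendZero F y = F y :=
  Subtype.val_injective.extend_apply _ _ y

theorem extendZero_of_notMem (F : C_c(Ω, ℝ≥0)) {x : CSpace k} (hx : x ∉ Ω) :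
    extendZero F x = 0 :=
  Function.extend_apply' _ _ x (by rintro ⟨y, rfl⟩; exact hx y.2)

theorem hasCompactSupport_coe (F : C_c(Ω, ℝ≥0)) : HasCompactSupport fun y => (F y : ℝ) :=
  F.hasCompactSupport.comp_left (g := fun r : ℝ≥0 => (r : ℝ)) rfl

theorem continuous_extendZero (F : C_c(Ω, ℝ≥0)) : Continuous (extendZero F) :=
  HasCompactSupport.continuous_extend_zero Ω.isOpen (by fun_prop) (hasCompactSupport_coe F)

theorem extendZero_nonneg (F : C_c(Ω, ℝ≥0)) (x : CSpace k) : 0 ≤ extendZero F x := by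
  by_cases hx : x ∈ Ω
  · rw [extendZero_coe F ⟨x, hx⟩]; exact (F _).2
  · rw [extendZero_of_notMem F hx]

theorem tsupport_extendZero (F : C_c(Ω, ℝ≥0)) :
    tsupport (extendZero F) ⊆ Subtype.val '' tsupport F := by
  have h := (F.hasCompactSupport.isCompact.image (continuous_subtype_val)).isClosed
  refine closure_minimal (fun x hx => ?_) h
  by_cases hxΩ : x ∈ Ω
  · refine ⟨⟨x, hxΩ⟩, subset_tsupport _ ?_, rfl⟩
    intro h0
    apply hx
    rw [extendZero_coe F ⟨x, hxΩ⟩, h0]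
    rfl
  · exact absurd (extendZero_of_notMem F hxΩ) hx

theorem variation_extendZero_le (N : Current Ω n) {F : C_c(Ω, ℝ≥0)} {C : ℝ} (hC : 0 < C)
    (hF : ∀ y, (F y : ℝ) ≤ C) :
    variation N (extendZero F) ≤ mass N (Subtype.val '' tsupport F) * ENNReal.ofReal C := by
  refine variation_le N fun ψ _ h => enorm_ev_le_mass_mul N ?_ hC fun x => ?_
  · have hsub : Function.support ψ ⊆ Function.support (extendZero F) := ?_
    · exact (closure_mono hsub).trans (tsupport_extendZero F)
    intro x hx h0
    apply hx
    have := h x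
    rw [h0] at this
    exact norm_le_zero_iff.1 this
  · refine (h x).trans ?_
    by_cases hx : x ∈ Ω
    · rw [extendZero_coe F ⟨x, hx⟩]; exact hF _
    · rw [extendZero_of_notMem F hx]; exact hC.le

theorem variation_extendZero_lt_top {N : Current Ω n} (hN : IsOfOrderZero N) (F : C_c(Ω, ℝ≥0)) :
    variation N (extendZero F) < ⊤ := by
  obtain ⟨C, hC⟩ := (continuous_extendZero F).norm.bounded_above_of_compact_support
    (HasCompactSupport.norm (f := extendZero F) ((F.hasCompactSupport.isCompact.image
      continuous_subtype_val).of_isClosed_subset (isClosed_tsupport _) (tsupport_extendZero F)))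
  refine (variation_extendZero_le N (C := max C 1) (by positivity) fun y => ?_).trans_lt
    (ENNReal.mul_lt_top (hN _ (F.hasCompactSupport.isCompact.image continuous_subtype_val) ?_)
      ENNReal.ofReal_lt_top)
  · have := hC y
    rw [norm_norm, extendZero_coe] at this
    exact (Real.le_norm_self _).trans (this.trans (le_max_left _ _))
  · rintro _ ⟨y, _, rfl⟩
    exact y.2

/-- The total variation of a current of order zero as a functional on continuous functions with
compact support. -/
def variationFunctional {N : Current Ω n} (hN : IsOfOrderZero N) : C_c(Ω, ℝ≥0) →ₗ[ℝ≥0] ℝ≥0 where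
  toFun F := (variation N (extendZero F)).toNNReal
  map_add' F G := by
    have h : extendZero (F + G) = fun x => extendZero F x + extendZero G x := by
      funext x
      by_cases hx : x ∈ Ω
      · have h1 := extendZero_coe (F + G) ⟨x, hx⟩
        have h2 := extendZero_coe F ⟨x, hx⟩
        have h3 := extendZero_coe G ⟨x, hx⟩
        simp only at h1 h2 h3
        rw [h1, h2, h3]
        simp
      · simp [extendZero_of_notMem _ hx]
    rw [h, ← ENNReal.toNNReal_add (variation_extendZero_lt_top hN F).ne
      (variation_extendZero_lt_top hN G).ne]
    congr 1
    exact le_antisymm (variation_add_le hN (extendZero_nonneg F) (extendZero_nonneg G)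
      (continuous_extendZero F) (continuous_extendZero G))
      (add_variation_le N (extendZero_nonneg F) (extendZero_nonneg G))
  map_smul' c F := by
    have h : extendZero (c • F) = fun x => c * extendZero F x := by
      funext x
      by_cases hx : x ∈ Ω
      · have h1 := extendZero_coe (c • F) ⟨x, hx⟩
        have h2 := extendZero_coe F ⟨x, hx⟩
        simp only at h1 h2
        rw [h1, h2]
        simp
      · simp [extendZero_of_notMem _ hx]
    rw [h]
    rcases eq_or_lt_of_le (zero_le (a := c)) with rfl | hc
    · simp [variation_zero]
    · rw [variation_mul N _ hc]
      simp

/-- A current of order zero is dominated by a measure, which on open sets is at most the mass. -/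
theorem exists_dominating_measure {N : Current Ω n} (hN : IsOfOrderZero N) :
    ∃ μ : Measure (CSpace k), μ (Ω : Set (CSpace k))ᶜ = 0 ∧
      (∀ O : Set (CSpace k), IsOpen O → O ⊆ Ω → μ O ≤ mass N O) ∧
      ∀ ψ : CSpace k → Form k n, ‖ev N ψ‖ₑ ≤ ∫⁻ x, ‖ψ x‖ₑ ∂μ := by
  have : LocallyCompactSpace Ω := Ω.isOpen.locallyCompactSpace
  -- The Riesz measure lives on the locally compact space `Ω`; its push-forward therefore gives no
  -- mass to the complement of `Ω`.
  set ν : Measure Ω := NNRealRMK.rieszMeasure (variationFunctional hN) with hν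
  have hval : Measurable (Subtype.val : Ω → CSpace k) := measurable_subtype_coe
  have hνF : ∀ F : C_c(Ω, ℝ≥0), ∫⁻ y, F y ∂ν = variation N (extendZero F) := fun F => by
    rw [hν, NNRealRMK.lintegral_rieszMeasure]
    exact ENNReal.coe_toNNReal (variation_extendZero_lt_top hN F).ne
  refine ⟨ν.map Subtype.val, ?_, fun O hO hOΩ => ?_, fun ψ => ?_⟩
  · rw [Measure.map_apply hval Ω.isOpen.measurableSet.compl]
    convert measure_empty (μ := ν)
    ext y
    simp
  · rw [Measure.map_apply hval hO.measurableSet]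
    have hO' : IsOpen ((Subtype.val : Ω → CSpace k) ⁻¹' O) := hO.preimage continuous_subtype_val
    rw [hO'.measure_eq_iSup_isCompact]
    -- Inner regularity of open sets: a compact `K` is tested with a continuous `F`, equal to one on
    -- `K` and supported in `O`, whose variation is at most the mass of `O`.
    refine iSup₂_le fun K hKO => iSup_le fun hK => ?_
    obtain ⟨L, hL, hKL, hLO⟩ := exists_compact_between hK hO' hKO
    obtain ⟨f, hfK, hfL, hfc, hf01⟩ := exists_continuous_one_zero_of_isCompact hK
      isOpen_interior.isClosed_compl (Set.disjoint_compl_right_iff_subset.2 hKL)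
    have hfO : tsupport f ⊆ (Subtype.val : Ω → CSpace k) ⁻¹' O :=
      (closure_minimal (fun y hy => by
        by_contra hyL
        exact hy (hfL fun h => hyL (interior_subset h))) hL.isClosed).trans hLO
    let F : C_c(Ω, ℝ≥0) :=
      { toFun := fun y => (f y).toNNReal
        continuous_toFun := by fun_prop
        hasCompactSupport' := HasCompactSupport.comp_left (g := Real.toNNReal) hfc
          Real.toNNReal_zero }
    have hFf : ∀ y, F y = (f y).toNNReal := fun y => rfl
    calc ν K = ∫⁻ y, K.indicator 1 y ∂ν := (lintegral_indicator_one hK.measurableSet).symm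
      _ ≤ ∫⁻ y, F y ∂ν := by
        refine lintegral_mono fun y => ?_
        by_cases hy : y ∈ K
        · simp [hy, hFf, hfK hy]
        · simp [hy]
      _ = variation N (extendZero F) := hνF F
      _ ≤ mass N (Subtype.val '' tsupport F) * ENNReal.ofReal 1 := by
        refine variation_extendZero_le N one_pos fun y => ?_
        rw [hFf, Real.coe_toNNReal _ (hf01 y).1]
        exact (hf01 y).2
      _ ≤ mass N O := by
        rw [ENNReal.ofReal_one, mul_one]
        refine mass_mono N ?_
        rintro _ ⟨y, hy, rfl⟩
        exact hfO (tsupport_comp_subset Real.toNNReal_zero f hy)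
  · by_cases hψ : IsTest Ω ψ
    swap
    · simp [ev, hψ]
    let F : C_c(Ω, ℝ≥0) :=
      { toFun := fun y => ‖ψ y‖₊
        continuous_toFun := hψ.smooth.continuous.nnnorm.comp continuous_subtype_val
        hasCompactSupport' := by
          have h1 : IsCompact ((Subtype.val : Ω → CSpace k) ⁻¹' tsupport ψ) := by
            rw [Topology.IsInducing.subtypeVal.isCompact_preimage_iff]
            · exact hψ.compact
            · rw [Subtype.range_coe]; exact hψ.subset
          refine HasCompactSupport.of_support_subset_isCompact h1 fun y hy => ?_
          refine subset_tsupport _ fun h0 => hy ?_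
          simp [h0] }
    have hFψ : ∀ y, F y = ‖ψ y‖₊ := fun y => rfl
    calc ‖ev N ψ‖ₑ ≤ variation N (extendZero F) := le_variation N hψ fun x => by
          by_cases hx : x ∈ Ω
          · rw [extendZero_coe F ⟨x, hx⟩]; exact le_rfl
          · rw [IsTest.eq_zero fun h => hx (hψ.subset h), norm_zero]
            exact extendZero_nonneg F x
      _ = ∫⁻ y, F y ∂ν := (hνF F).symm
      _ = ∫⁻ x, ‖ψ x‖ₑ ∂(ν.map Subtype.val) := by
        rw [lintegral_map hψ.smooth.continuous.enorm.measurable hval]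
        rfl

end Variation

/-! ### Extension by zero -/

section ZeroExtension

open MeasureTheory

variable {k n : ℕ} {U Ω : Opens (CSpace k)}

theorem tsupport_subset_of_zero {X α β : Type*} [TopologicalSpace X] [Zero α] [Zero β] {f : X → α}
    {g : X → β} (h : ∀ x, f x = 0 → g x = 0) : tsupport g ⊆ tsupport f :=
  closure_mono fun x hx h0 => hx (h x h0)

/-- `N` is dominated by the measure `μ`. -/
def IsDominated (N : Current Ω n) (μ : Measure (CSpace k)) : Prop :=
  ∀ ψ : CSpace k → Form k n, ‖ev N ψ‖ₑ ≤ ∫⁻ x, ‖ψ x‖ₑ ∂μ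

/-- `μ` is finite near each point of `U`. -/
def IsFiniteNear (U : Opens (CSpace k)) (μ : Measure (CSpace k)) : Prop :=
  ∀ x ∈ U, ∃ W ∈ 𝓝 x, μ W < ⊤

theorem IsFiniteNear.measure_lt_top {μ : Measure (CSpace k)} (hμ : IsFiniteNear U μ)
    {K : Set (CSpace k)} (hK : IsCompact K) (hKU : K ⊆ U) : μ K < ⊤ := by
  refine hK.measure_lt_top_of_nhdsWithin fun x hx => ?_
  obtain ⟨W, hW, hμW⟩ := hμ x (hKU hx)
  exact ⟨W, mem_nhdsWithin_of_mem_nhds hW, hμW⟩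

theorem lintegral_enorm_le {μ : Measure (CSpace k)} {f : CSpace k → Form k n}
    {K : Set (CSpace k)} (hfK : tsupport f ⊆ K) {C : ℝ} (hC : ∀ x, ‖f x‖ ≤ C) :
    ∫⁻ x, ‖f x‖ₑ ∂μ ≤ ENNReal.ofReal C * μ K := by
  calc ∫⁻ x, ‖f x‖ₑ ∂μ ≤ ∫⁻ x, (tsupport f).indicator (fun _ => ENNReal.ofReal C) x ∂μ := by
        refine lintegral_mono fun x => ?_
        by_cases hx : x ∈ tsupport f
        · rw [Set.indicator_of_mem hx, ← ofReal_norm]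
          exact ENNReal.ofReal_le_ofReal (hC x)
        · simp [IsTest.eq_zero hx]
    _ = ENNReal.ofReal C * μ (tsupport f) := by
        rw [lintegral_indicator (isClosed_tsupport f).measurableSet, setLIntegral_const]
    _ ≤ ENNReal.ofReal C * μ K := by gcongr

theorem IsTest.exists_bound {f : CSpace k → Form k n} (hf : IsTest Ω f) :
    ∃ C : ℝ, 0 < C ∧ ∀ x, ‖f x‖ ≤ C := by
  obtain ⟨C, hC⟩ := hf.smooth.continuous.bounded_above_of_compact_support hf.compact
  exact ⟨max C 1, by positivity, fun x => (hC x).trans (le_max_left _ _)⟩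

theorem IsTest.lintegral_lt_top {μ : Measure (CSpace k)} (hμ : IsFiniteNear U μ)
    {f : CSpace k → Form k n} (hf : IsTest U f) : ∫⁻ x, ‖f x‖ₑ ∂μ < ⊤ := by
  obtain ⟨C, _, hC⟩ := hf.exists_bound
  exact (lintegral_enorm_le subset_rfl hC).trans_lt
    (ENNReal.mul_lt_top ENNReal.ofReal_lt_top (hμ.measure_lt_top hf.compact hf.subset))

/-- Dominated convergence with majorant `‖f‖`. Convergence of the cut-offs is needed only where `f ≠
0`, since the approximating sequences are controlled only on a ball. -/
theorem tendsto_lintegral_one_sub {μ : Measure (CSpace k)} {f : CSpace k → Form k n}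
    (hf : Continuous f) (hfμ : ∫⁻ x, ‖f x‖ₑ ∂μ ≠ ⊤) {w : ℕ → CSpace k → ℝ}
    (hw : ∀ j, Continuous (w j)) (hw0 : ∀ j x, 0 ≤ w j x) (hw1 : ∀ j x, w j x ≤ 1)
    (hlim : ∀ᵐ x ∂μ, f x ≠ 0 → Tendsto (fun j => w j x) atTop (𝓝 1)) :
    Tendsto (fun j => ∫⁻ x, ‖(1 - w j x) • f x‖ₑ ∂μ) atTop (𝓝 0) := by
  have h0 : (0 : ℝ≥0∞) = ∫⁻ _, 0 ∂μ := by simp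
  rw [h0]
  refine tendsto_lintegral_of_dominated_convergence (fun x => ‖f x‖ₑ)
    (fun j => ((continuous_const.sub (hw j)).smul hf).enorm.measurable) (fun j => ?_) hfμ ?_
  · refine Eventually.of_forall fun x => ?_
    change ‖(1 - w j x) • f x‖ₑ ≤ ‖f x‖ₑ
    rw [enorm_smul]
    refine mul_le_of_le_one_left zero_le ?_
    rw [← ofReal_norm, Real.norm_of_nonneg (by linarith [hw1 j x])]
    exact ENNReal.ofReal_le_one.2 (by linarith [hw0 j x])
  · filter_upwards [hlim] with x hx
    by_cases hfx : f x = 0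
    · simp [hfx]
    · have h1 : Tendsto (fun j => (1 - w j x) • f x) atTop (𝓝 ((1 - 1 : ℝ) • f x)) :=
        (tendsto_const_nhds.sub (hx hfx)).smul_const _
      rw [sub_self, zero_smul] at h1
      simpa using h1.enorm

/-- A smooth function with values in `[0,1]` and compact support in `Ω`. -/
structure IsCutoff (Ω : Opens (CSpace k)) (w : CSpace k → ℝ) : Prop where
  smooth : ContDiff ℝ ∞ w
  compact : HasCompactSupport w
  subset : tsupport w ⊆ Ω
  nonneg : ∀ x, 0 ≤ w x
  le_one : ∀ x, w x ≤ 1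

theorem IsCutoff.isTest_smul {w : CSpace k → ℝ} (hw : IsCutoff Ω w) {f : CSpace k → Form k n}
    (hf : ContDiff ℝ ∞ f) : IsTest Ω (fun x => w x • f x) :=
  IsTest.cut hw.smooth hw.compact hw.subset hf

theorem exists_cutoff_seq (Ω : Opens (CSpace k)) :
    ∃ w : ℕ → CSpace k → ℝ, (∀ j, IsCutoff Ω (w j)) ∧
      ∀ x ∈ Ω, Tendsto (fun j => w j x) atTop (𝓝 1) := by
  have : LocallyCompactSpace Ω := Ω.isOpen.locallyCompactSpace
  have hK : ∀ j, IsCompact ((Subtype.val : Ω → CSpace k) '' compactCovering Ω j) := fun j =>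
    (isCompact_compactCovering Ω j).image continuous_subtype_val
  have hKΩ : ∀ j, (Subtype.val : Ω → CSpace k) '' compactCovering Ω j ⊆ Ω := by
    rintro j _ ⟨y, _, rfl⟩
    exact y.2
  choose w h1 h2 h3 h4 h5 h6 using fun j => exists_cutoff (hK j) Ω.isOpen (hKΩ j)
  refine ⟨w, fun j => ⟨h1 j, h2 j, h3 j, h4 j, h5 j⟩, fun x hx => ?_⟩
  obtain ⟨i, hi⟩ := exists_mem_compactCovering (⟨x, hx⟩ : Ω)
  refine tendsto_const_nhds.congr' ?_
  filter_upwards [eventually_ge_atTop i] with j hj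
  exact ((h6 j).self_of_nhdsSet x ⟨⟨x, hx⟩, compactCovering_subset Ω hj hi, rfl⟩).symm

/-- A current on `Ω` dominated by a measure that is finite near the points of `U` extends to `U`. -/
theorem exists_extension {N : Current Ω n} {μ : Measure (CSpace k)} (hN : IsDominated N μ)
    (hμ : IsFiniteNear U μ) (hΩ : μ (Ω : Set (CSpace k))ᶜ = 0) :
    ∃ N' : Current U n, IsDominated N' μ ∧
      ∀ ψ : CSpace k → Form k n, IsTest Ω ψ → IsTest U ψ → ev N' ψ = ev N ψ := by
  obtain ⟨w, hw, hlim⟩ := exists_cutoff_seq Ω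
  have hlim' : ∀ᵐ x ∂μ, Tendsto (fun j => w j x) atTop (𝓝 1) := by
    have : ∀ᵐ x ∂μ, x ∈ Ω := by
      rw [ae_iff]; exact hΩ
    filter_upwards [this] with x hx using hlim x hx
  have hsmall : ∀ φ : TestForm U n,
      Tendsto (fun j => ∫⁻ x, ‖(1 - w j x) • φ x‖ₑ ∂μ) atTop (𝓝 0) := fun φ =>
    tendsto_lintegral_one_sub φ.continuous ((isTest_coe φ).lintegral_lt_top hμ).ne
      (fun j => (hw j).smooth.continuous) (fun j => (hw j).nonneg) (fun j => (hw j).le_one)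
      (hlim'.mono fun x hx _ => hx)
  have htest : ∀ (φ : TestForm U n) j, IsTest Ω (fun x => w j x • φ x) := fun φ j =>
    (hw j).isTest_smul φ.contDiff
  -- From `w i - w j = (1 - w j) - (1 - w i)`: both integrals tend to zero, so the values on `w j •
  -- φ` form a Cauchy sequence.
  have hdiff : ∀ (φ : TestForm U n) i j,
      ‖ev N (fun x => w i x • φ x) - ev N (fun x => w j x • φ x)‖ₑ ≤
        ∫⁻ x, ‖(1 - w i x) • φ x‖ₑ ∂μ + ∫⁻ x, ‖(1 - w j x) • φ x‖ₑ ∂μ := by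
    intro φ i j
    rw [← ev_sub N (htest φ i) (htest φ j)]
    refine (hN _).trans ?_
    have hm : Measurable fun x => ‖(1 - w i x) • φ x‖ₑ :=
      ((continuous_const.sub (hw i).smooth.continuous).smul φ.continuous).enorm.measurable
    rw [← lintegral_add_left hm]
    refine lintegral_mono fun x => ?_
    have : w i x • φ x - w j x • φ x = (1 - w j x) • φ x - (1 - w i x) • φ x := by module
    rw [this, add_comm]
    exact enorm_sub_le
  have hex : ∀ φ : TestForm U n, ∃ c, Tendsto (fun j => ev N (fun x => w j x • φ x)) atTop (𝓝 c) := by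
    intro φ
    refine cauchySeq_tendsto_of_complete (EMetric.cauchySeq_iff.2 fun ε hε => ?_)
    have h1 := (tendsto_order.1 (hsmall φ)).2 (ε / 2) (ENNReal.half_pos hε.ne')
    obtain ⟨M, hM⟩ := eventually_atTop.1 h1
    refine ⟨M, fun i hi j hj => ?_⟩
    rw [edist_eq_enorm_sub]
    refine (hdiff φ i j).trans_lt ?_
    rw [← ENNReal.add_halves ε]
    exact ENNReal.add_lt_add (hM i hi) (hM j hj)
  choose L hL using hex
  have hbound : ∀ φ : TestForm U n, ‖L φ‖ₑ ≤ ∫⁻ x, ‖φ x‖ₑ ∂μ := by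
    intro φ
    refine le_of_tendsto (hL φ).enorm (Eventually.of_forall fun j => (hN _).trans ?_)
    refine lintegral_mono fun x => ?_
    rw [enorm_smul]
    refine mul_le_of_le_one_left zero_le ?_
    rw [← ofReal_norm, Real.norm_of_nonneg ((hw j).nonneg x)]
    exact ENNReal.ofReal_le_one.2 ((hw j).le_one x)
  have hadd : ∀ φ ψ : TestForm U n, L (φ + ψ) = L φ + L ψ := by
    intro φ ψ
    refine tendsto_nhds_unique (hL (φ + ψ)) (((hL φ).add (hL ψ)).congr fun j => ?_)
    rw [← ev_add N (htest φ j) (htest ψ j)]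
    congr 1
    funext x
    exact (smul_add _ _ _).symm
  have hsmul : ∀ (c : ℂ) (φ : TestForm U n), L (c • φ) = c • L φ := by
    intro c φ
    refine tendsto_nhds_unique (hL (c • φ)) (((hL φ).const_smul c).congr fun j => ?_)
    rw [smul_eq_mul, ← ev_const_smul N (htest φ j)]
    congr 1
    funext x
    exact (smul_comm (w j x) c (φ x)).symm
  -- Continuity is checked on the forms supported in each compact `K`, where `L` is bounded by `μ K`
  -- times the sup norm.
  let N' : Current U n := TestFunction.mkCLM ℂ L hadd hsmul fun K hKU => by
    have hK : μ K < ⊤ := hμ.measure_lt_top K.isCompact hKU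
    let G : ContDiffMapSupportedIn (CSpace k) (Form k n) ⊤ K →+ ℂ :=
      { toFun := L ∘ TestFunction.ofSupportedIn hKU
        map_zero' := by
          have h := hadd 0 0
          rw [add_zero] at h
          exact left_eq_add.1 h
        map_add' := fun f g => hadd (TestFunction.ofSupportedIn hKU f)
          (TestFunction.ofSupportedIn hKU g) }
    have hG : ∀ f, ‖G f‖ ≤ (μ K).toReal * ‖ContDiffMapSupportedIn.toBoundedContinuousFunctionCLM ℝ f‖ := by
      intro f
      have h1 : ‖G f‖ₑ ≤ ENNReal.ofReal ‖ContDiffMapSupportedIn.toBoundedContinuousFunctionCLM ℝ f‖ * μ K := by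
        refine (hbound (TestFunction.ofSupportedIn hKU f)).trans ?_
        refine lintegral_enorm_le (f.tsupport_subset) fun x => ?_
        exact (ContDiffMapSupportedIn.toBoundedContinuousFunctionCLM ℝ f).norm_coe_le_norm x
      rw [← ofReal_norm, ENNReal.ofReal_le_iff_le_toReal
        (ENNReal.mul_lt_top ENNReal.ofReal_lt_top hK).ne, ENNReal.toReal_mul,
        ENNReal.toReal_ofReal (norm_nonneg _), mul_comm] at h1
      exact h1
    have hc : Tendsto (fun f => (μ K).toReal * ‖ContDiffMapSupportedIn.toBoundedContinuousFunctionCLM (E := CSpace k) (F := Form k n) (n := ⊤) (K := K) ℝ f‖)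
        (𝓝 0) (𝓝 0) := by
      have : Continuous (fun f => (μ K).toReal * ‖ContDiffMapSupportedIn.toBoundedContinuousFunctionCLM (E := CSpace k) (F := Form k n) (n := ⊤) (K := K) ℝ f‖) :=
        continuous_const.mul (ContinuousLinearMap.continuous _).norm
      have h := this.tendsto 0
      rwa [map_zero, norm_zero, mul_zero] at h
    have h0 : ContinuousAt G 0 := by
      rw [ContinuousAt, map_zero]
      exact squeeze_zero_norm hG hc
    exact continuous_of_continuousAt_zero G h0
  have hN' : ∀ φ, N' φ = L φ := fun φ => rfl
  refine ⟨N', fun ψ => ?_, fun ψ hψ hψU => ?_⟩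
  · by_cases hψ : IsTest U ψ
    · rw [ev_of_isTest N' hψ, hN']
      exact hbound hψ.toTest
    · simp [ev, hψ]
  · rw [ev_of_isTest N' hψU, hN']
    refine tendsto_nhds_unique (hL hψU.toTest) ?_
    have h1 := hsmall hψU.toTest
    rw [tendsto_iff_edist_tendsto_0]
    refine tendsto_of_tendsto_of_tendsto_of_le_of_le tendsto_const_nhds h1 (fun _ => zero_le)
      fun j => ?_
    rw [edist_comm, edist_eq_enorm_sub, ← ev_sub N hψ (htest hψU.toTest j)]
    refine (hN _).trans (lintegral_mono fun x => ?_)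
    have : ψ x - w j x • (hψU.toTest : CSpace k → Form k n) x
        = (1 - w j x) • (hψU.toTest : CSpace k → Form k n) x := by
      rw [sub_smul, one_smul]; rfl
    rw [this]

/-- The error is the value of `N'` on `(1 - w j) • φ`, which dominated convergence sends to zero.
The cut-offs are arbitrary: later they are the almost directed ones. -/
theorem ev_tendsto_of_isDominated {N : Current Ω n} {N' : Current U n} {μ : Measure (CSpace k)}
    (hN' : IsDominated N' μ) (hμ : IsFiniteNear U μ) (hΩ : μ (Ω : Set (CSpace k))ᶜ = 0)
    (hΩU : Ω ≤ U)
    (hres : ∀ ψ : CSpace k → Form k n, IsTest Ω ψ → IsTest U ψ → ev N' ψ = ev N ψ)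
    {w : ℕ → CSpace k → ℝ} (hw : ∀ j, IsCutoff Ω (w j)) {φ : CSpace k → Form k n}
    (hφ : IsTest U φ) (hlim : ∀ x ∈ Ω, φ x ≠ 0 → Tendsto (fun j => w j x) atTop (𝓝 1)) :
    Tendsto (fun j => ev N (fun x => w j x • φ x)) atTop (𝓝 (ev N' φ)) := by
  have hlim' : ∀ᵐ x ∂μ, φ x ≠ 0 → Tendsto (fun j => w j x) atTop (𝓝 1) := by
    have : ∀ᵐ x ∂μ, x ∈ Ω := by
      rw [ae_iff]; exact hΩ
    filter_upwards [this] with x hx using hlim x hx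
  have h1 := tendsto_lintegral_one_sub hφ.smooth.continuous (hφ.lintegral_lt_top hμ).ne
    (fun j => (hw j).smooth.continuous) (fun j => (hw j).nonneg) (fun j => (hw j).le_one) hlim'
  rw [tendsto_iff_edist_tendsto_0]
  refine tendsto_of_tendsto_of_tendsto_of_le_of_le tendsto_const_nhds h1 (fun _ => zero_le)
    fun j => ?_
  have ht := (hw j).isTest_smul hφ.smooth
  rw [edist_comm, edist_eq_enorm_sub, ← hres _ ht (ht.mono hΩU), ← ev_sub N' hφ (ht.mono hΩU)]
  refine (hN' _).trans (lintegral_mono fun x => ?_)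
  have : φ x - w j x • φ x = (1 - w j x) • φ x := by rw [sub_smul, one_smul]
  rw [this]

/-! ### Extension by zero across `F`: existence, uniqueness, computation. -/

variable {F : Set (CSpace k)} {hF : IsClosed ((↑) ⁻¹' F : Set U)}

theorem sdiffOpens_le : sdiffOpens U F hF ≤ U := fun _ hx => hx.1

/-- The measure is bounded by the mass on open subsets of `U \ F` and charges nothing else. So
finiteness at points of `F` comes from the mass hypothesis, and finiteness elsewhere from order
zero. -/
theorem exists_measure_isFiniteNear {N : Current (sdiffOpens U F hF) n} (hN : IsOfOrderZero N)
    (hNF : HasLocallyFiniteMassNear F N) :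
    ∃ μ : Measure (CSpace k), μ (sdiffOpens U F hF : Set (CSpace k))ᶜ = 0 ∧ IsDominated N μ ∧
      IsFiniteNear U μ := by
  obtain ⟨μ, h0, hO, hdom⟩ := exists_dominating_measure hN
  refine ⟨μ, h0, hdom, fun x hx => ?_⟩
  by_cases hxF : x ∈ F
  · obtain ⟨W, hW, hmass⟩ := hNF x hxF
    refine ⟨interior W, interior_mem_nhds.2 hW, ?_⟩
    have h1 : μ (interior W) ≤ μ (interior W ∩ sdiffOpens U F hF) + 0 := by
      rw [← h0]
      refine (measure_mono fun y hy => ?_).trans (measure_union_le _ _)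
      by_cases hyΩ : y ∈ (sdiffOpens U F hF : Set (CSpace k))
      · exact Or.inl ⟨hy, hyΩ⟩
      · exact Or.inr hyΩ
    rw [add_zero] at h1
    refine h1.trans_lt ((hO _ (isOpen_interior.inter (sdiffOpens U F hF).isOpen)
      Set.inter_subset_right).trans_lt ((mass_mono N ?_).trans_lt hmass))
    exact Set.inter_subset_inter_left _ interior_subset
  · have hxΩ : x ∈ (sdiffOpens U F hF : Set (CSpace k)) := ⟨hx, hxF⟩
    obtain ⟨K, hK, hxK, hKΩ⟩ := exists_compact_subset (sdiffOpens U F hF).isOpen hxΩ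
    refine ⟨interior K, isOpen_interior.mem_nhds hxK, ?_⟩
    exact (hO _ isOpen_interior (interior_subset.trans hKΩ)).trans_lt
      ((mass_mono N interior_subset).trans_lt (hN K hK hKΩ))

/-- Outer regularity is applied on the subspace `U`, since `μ` is only known to be locally finite
there. -/
theorem exists_isOpen_measure_lt {μ : Measure (CSpace k)} (hμ : IsFiniteNear U μ)
    (hFU : F ⊆ U) (h0 : μ F = 0) {ε : ℝ≥0∞} (hε : 0 < ε) :
    ∃ W, IsOpen W ∧ F ⊆ W ∧ W ⊆ U ∧ μ W ≤ ε := by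
  have : LocallyCompactSpace U := U.isOpen.locallyCompactSpace
  let ν : Measure U := μ.comap Subtype.val
  have hν : ∀ s : Set U, ν s = μ (Subtype.val '' s) := fun s =>
    (MeasurableEmbedding.subtype_coe U.isOpen.measurableSet).comap_apply μ s
  have hfin : IsLocallyFiniteMeasure ν := ⟨fun x => by
    obtain ⟨W, hW, hμW⟩ := hμ x x.2
    refine ⟨Subtype.val ⁻¹' W, continuous_subtype_val.continuousAt.preimage_mem_nhds hW, ?_⟩
    rw [hν]
    exact (measure_mono (Set.image_preimage_subset _ _)).trans_lt hμW⟩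
  have hνF : ν (Subtype.val ⁻¹' F) = 0 := by
    rw [hν]
    exact measure_mono_null (Set.image_preimage_subset _ _) h0
  obtain ⟨W, hFW, hW, hνW⟩ := Set.exists_isOpen_lt_of_lt (μ := ν) (Subtype.val ⁻¹' F) ε
    (by rw [hνF]; exact hε)
  refine ⟨Subtype.val '' W, U.isOpen.isOpenEmbedding_subtypeVal.isOpenMap _ hW, ?_, ?_, ?_⟩
  · intro x hx
    exact ⟨⟨x, hFU hx⟩, hFW hx, rfl⟩
  · rintro _ ⟨y, _, rfl⟩
    exact y.2
  · rw [← hν]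
    exact hνW.le

theorem isZeroExtension_of_isDominated {N : Current (sdiffOpens U F hF) n} {N' : Current U n}
    {μ : Measure (CSpace k)} (hFU : F ⊆ U) (hN' : IsDominated N' μ) (hμ : IsFiniteNear U μ)
    (h0 : μ (sdiffOpens U F hF : Set (CSpace k))ᶜ = 0)
    (hres : ∀ ψ : CSpace k → Form k n, IsTest (sdiffOpens U F hF) ψ → IsTest U ψ →
      ev N' ψ = ev N ψ) : IsZeroExtension F N N' where
  isOfOrderZero K hK hKU := by
    obtain ⟨V, hKV, hV, hμV⟩ := hK.exists_open_superset_measure_lt_top' (μ := μ) fun x hx => by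
      obtain ⟨W, hW, hμW⟩ := hμ x (hKU hx)
      exact ⟨W, hW, hμW⟩
    refine (mass_le_of_forall N' hV hKV fun f _ hfV hf1 => (hN' f).trans
      (lintegral_enorm_le hfV hf1)).trans_lt ?_
    exact ENNReal.mul_lt_top ENNReal.ofReal_lt_top hμV
  restrict φ ψ h := by
    have h1 : (ψ : CSpace k → Form k n) = φ := funext fun x => (h x).symm
    have h2 := hres φ (isTest_coe φ) (h1 ▸ isTest_coe ψ)
    rw [ev_coe, ← h1, ev_coe] at h2
    exact h2
  mass_eq_zero := by
    have hsub : F ⊆ (sdiffOpens U F hF : Set (CSpace k))ᶜ := fun x hx h => h.2 hx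
    have hμF : μ F = 0 := measure_mono_null hsub h0
    refine le_antisymm (le_of_forall_pos_le_add fun ε hε => ?_) zero_le
    obtain ⟨W, hW, hFW, _, hμW⟩ := exists_isOpen_measure_lt hμ hFU hμF hε
    rw [zero_add]
    refine mass_le_of_forall N' hW hFW fun f _ hfV hf1 => (hN' f).trans
      ((lintegral_enorm_le hfV hf1).trans ?_)
    rwa [ENNReal.ofReal_one, one_mul]

/-- The extension by zero is unique. -/
theorem IsZeroExtension.ext {N : Current (sdiffOpens U F hF) n} {N₁ N₂ : Current U n}
    (h₁ : IsZeroExtension F N N₁) (h₂ : IsZeroExtension F N N₂) : N₁ = N₂ := by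
  refine ContinuousLinearMap.ext fun φ => ?_
  rw [← ev_coe, ← ev_coe N₂]
  have hφ := isTest_coe φ
  obtain ⟨C, hC0, hC⟩ := hφ.exists_bound
  have key : ∀ ε : ℝ≥0∞, 0 < ε → ‖ev N₁ φ - ev N₂ φ‖ₑ ≤ ε * ENNReal.ofReal C
      + ε * ENNReal.ofReal C := by
    intro ε hε
    -- The mass of `F` is an infimum over open neighbourhoods, so its vanishing gives a
    -- neighbourhood of mass at most `ε`.
    have hW : ∀ N' : Current U n, mass N' F = 0 → ∃ W, IsOpen W ∧ F ⊆ W ∧ mass N' W ≤ ε := by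
      intro N' h0
      have h1 : mass N' F < ε := by rwa [h0]
      simp only [mass, iInf_lt_iff] at h1
      obtain ⟨W, hW, hFW, hlt⟩ := h1
      refine ⟨W, hW, hFW, le_trans ?_ hlt.le⟩
      exact iInf₂_le_of_le W hW (iInf_le _ subset_rfl)
    obtain ⟨W₁, hW₁, hFW₁, hm₁⟩ := hW N₁ h₁.mass_eq_zero
    obtain ⟨W₂, hW₂, hFW₂, hm₂⟩ := hW N₂ h₂.mass_eq_zero
    -- `F` is closed only in `U`, so compactness is obtained inside `U` and pushed forward.
    have hK : IsCompact (tsupport φ ∩ F) := by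
      have h3 : IsCompact ((Subtype.val : U → CSpace k) ⁻¹' tsupport φ) := by
        rw [Topology.IsInducing.subtypeVal.isCompact_preimage_iff]
        · exact hφ.compact
        · rw [Subtype.range_coe]; exact hφ.subset
      have h4 := (h3.inter_right hF).image continuous_subtype_val
      convert h4 using 1
      ext x
      constructor
      · rintro ⟨hx1, hx2⟩
        exact ⟨⟨x, hφ.subset hx1⟩, ⟨hx1, hx2⟩, rfl⟩
      · rintro ⟨y, ⟨hy1, hy2⟩, rfl⟩
        exact ⟨hy1, hy2⟩
    -- Since `χ = 1` near `tsupport φ ∩ F`, the form `(1 - χ) • φ` is a test form on `U \ F`, where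
    -- both extensions agree. The other piece `χ • φ` lives where both masses are at most `ε`.
    obtain ⟨χ, hχs, hχc, hχW, hχ0, hχ1, hχK⟩ := exists_cutoff hK (hW₁.inter hW₂)
      (fun x hx => ⟨hFW₁ hx.2, hFW₂ hx.2⟩)
    have t1 := hφ.smul_real hχs
    have t2 := hφ.smul_real (contDiff_const.sub hχs : ContDiff ℝ ∞ fun x => 1 - χ x)
    have hsplit : (φ : CSpace k → Form k n) = fun x => χ x • φ x + (1 - χ x) • φ x := by
      funext x
      module
    have hΩ : IsTest (sdiffOpens U F hF) (fun x => (1 - χ x) • φ x) := by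
      refine ⟨t2.smooth, t2.compact, fun x hx => ⟨t2.subset hx, fun hxF => ?_⟩⟩
      have hxφ : x ∈ tsupport φ := tsupport_subset_of_zero (fun y h0 => by simp [h0]) hx
      have h5 : ∀ᶠ y in 𝓝 x, χ y = 1 := hχK.filter_mono (nhds_le_nhdsSet (s := tsupport φ ∩ F) ⟨hxφ, hxF⟩)
      have h6 : (fun x => (1 - χ x) • φ x) =ᶠ[𝓝 x] 0 := by
        filter_upwards [h5] with y hy
        simp [hy]
      exact (notMem_tsupport_iff_eventuallyEq.2 h6) hx
    have hev : ∀ N' : Current U n, ev N' φ = ev N' (fun x => χ x • φ x)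
        + ev N' (fun x => (1 - χ x) • φ x) := fun N' => by
      conv_lhs => rw [hsplit]
      exact ev_add N' t1 t2
    have heq : ev N₁ (fun x => (1 - χ x) • φ x) = ev N₂ (fun x => (1 - χ x) • φ x) := by
      rw [ev_of_isTest N₁ t2, ev_of_isTest N₂ t2, h₁.restrict hΩ.toTest t2.toTest fun x => rfl,
        h₂.restrict hΩ.toTest t2.toTest fun x => rfl]
    have hb : ∀ N' : Current U n, ∀ W, W₁ ∩ W₂ ⊆ W → mass N' W ≤ ε →
        ‖ev N' (fun x => χ x • φ x)‖ₑ ≤ ε * ENNReal.ofReal C := by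
      intro N' W hWW hm
      refine (enorm_ev_le_mass_mul N' (A := W) ?_ hC0 fun x => ?_).trans (by gcongr)
      · exact (tsupport_subset_of_zero fun y h0 => by simp [h0]).trans (hχW.trans hWW)
      · rw [norm_smul, Real.norm_of_nonneg (hχ0 x)]
        exact (mul_le_of_le_one_left (norm_nonneg _) (hχ1 x)).trans (hC x)
    rw [hev N₁, hev N₂, heq, add_sub_add_right_eq_sub]
    exact enorm_sub_le.trans (add_le_add (hb N₁ W₁ Set.inter_subset_left hm₁)
      (hb N₂ W₂ Set.inter_subset_right hm₂))
  have hlim : Tendsto (fun ε : ℝ≥0∞ => ε * ENNReal.ofReal C + ε * ENNReal.ofReal C) (𝓝[>] 0)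
      (𝓝 (0 * ENNReal.ofReal C + 0 * ENNReal.ofReal C)) := by
    have : Tendsto (fun ε : ℝ≥0∞ => ε) (𝓝[>] 0) (𝓝 0) := tendsto_nhdsWithin_of_tendsto_nhds tendsto_id
    have h := ENNReal.Tendsto.mul_const (b := ENNReal.ofReal C) this (Or.inr ENNReal.ofReal_ne_top)
    exact h.add h
  rw [zero_mul, zero_add] at hlim
  have h0 := ge_of_tendsto hlim (by filter_upwards [self_mem_nhdsWithin] with ε hε using key ε hε)
  rw [nonpos_iff_eq_zero, enorm_eq_zero, sub_eq_zero] at h0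
  exact h0

/-- Existence of the extension by zero. -/
theorem exists_isZeroExtension (hFU : F ⊆ U) {N : Current (sdiffOpens U F hF) n}
    (hN : IsOfOrderZero N) (hNF : HasLocallyFiniteMassNear F N) :
    ∃ (N' : Current U n) (μ : Measure (CSpace k)), IsZeroExtension F N N' ∧ IsDominated N μ ∧
      IsDominated N' μ ∧ IsFiniteNear U μ ∧ μ (sdiffOpens U F hF : Set (CSpace k))ᶜ = 0 := by
  obtain ⟨μ, h0, hdom, hfin⟩ := exists_measure_isFiniteNear hN hNF
  obtain ⟨N', hN', hres⟩ := exists_extension hdom hfin h0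
  exact ⟨N', μ, isZeroExtension_of_isDominated hFU hN' hfin h0 hres, hdom, hN', hfin, h0⟩

theorem IsZeroExtension.ev_eq {N : Current (sdiffOpens U F hF) n} {N' : Current U n}
    (h : IsZeroExtension F N N') {ψ : CSpace k → Form k n} (hψ : IsTest (sdiffOpens U F hF) ψ) :
    ev N' ψ = ev N ψ := by
  rw [ev_of_isTest N' (hψ.mono sdiffOpens_le), ev_of_isTest N hψ]
  exact h.restrict hψ.toTest _ fun x => rfl

/-- The extension by zero is computed by cut-off functions. -/
theorem IsZeroExtension.ev_tendsto (hFU : F ⊆ U) {N : Current (sdiffOpens U F hF) n}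
    {N' : Current U n} (h : IsZeroExtension F N N') (hN : IsOfOrderZero N)
    (hNF : HasLocallyFiniteMassNear F N) {w : ℕ → CSpace k → ℝ}
    (hw : ∀ j, IsCutoff (sdiffOpens U F hF) (w j)) {φ : CSpace k → Form k n}
    (hφ : IsTest U φ)
    (hlim : ∀ x ∈ sdiffOpens U F hF, φ x ≠ 0 → Tendsto (fun j => w j x) atTop (𝓝 1)) :
    Tendsto (fun j => ev N (fun x => w j x • φ x)) atTop (𝓝 (ev N' φ)) := by
  obtain ⟨N'', μ, hext, _, hN'', hfin, h0⟩ := exists_isZeroExtension hFU hN hNF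
  rw [h.ext hext]
  exact ev_tendsto_of_isDominated hN'' hfin h0 sdiffOpens_le
    (fun ψ hψ _ => hext.ev_eq hψ) hw hφ hlim

end ZeroExtension

/-! ### Positive currents -/

section Positive

open MeasureTheory

variable {k n q : ℕ} {Ω : Opens (CSpace k)}

theorem IsOfBidimension.ev_eq_zero {r s : ℕ} {T : Current Ω n} (hT : IsOfBidimension r s T)
    {a b : ℕ} (hab : (a, b) ≠ (r, s)) {f : CSpace k → Form k n} (hf : ∀ x, IsOfType a b (f x)) :
    ev T f = 0 := by
  by_cases h : IsTest Ω f
  · rw [ev_of_isTest T h]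
    exact hT a b hab h.toTest hf
  · simp [ev, h]

theorem IsPositive.ev_nonneg {T : Current Ω (2 * q)} (hT : IsPositive q T)
    {f : CSpace k → Form k (2 * q)} (hf : IsTest Ω f) (hpos : ∀ x, f x ∈ stronglyPositive k q) :
    ∃ c : ℝ, 0 ≤ c ∧ ev T f = c := by
  rw [ev_of_isTest T hf]
  exact hT.2 hf.toTest hpos

theorem smul_mem_stronglyPositive {c : ℝ} (hc : 0 ≤ c) {β : Form k (2 * q)}
    (hβ : β ∈ stronglyPositive k q) : c • β ∈ stronglyPositive k q :=
  Submodule.smul_mem (stronglyPositive k q) ⟨c, hc⟩ hβ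

theorem frame_mem (l : Fin (frameCard k q)) : frame k q l ∈ stronglyPositive k q :=
  Submodule.subset_span ⟨_, rfl⟩

theorem frameSum_mem : frameSum k q ∈ stronglyPositive k q :=
  Submodule.sum_mem _ fun l _ => frame_mem l

theorem isOfType_frame (l : Fin (frameCard k q)) : IsOfType q q (frame k q l) :=
  isOfType_elementary _

/-- Product of a test function and a constant form. -/
theorem isTest_smul_const {g : CSpace k → ℝ} (hg : ContDiff ℝ ∞ g) (hgc : HasCompactSupport g)
    (hgΩ : tsupport g ⊆ Ω) (β : Form k n) : IsTest Ω (fun x => g x • β) :=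
  IsTest.cut hg hgc hgΩ contDiff_const

/-- Both `g + f` and `g - f` are non-negative, so `T` takes non-negative real values `c` and `d` on
their products with `β`; the claim is `|c - d| ≤ c + d`. -/
theorem IsPositive.norm_ev_smul_le {T : Current Ω (2 * q)} (hT : IsPositive q T)
    {f g : CSpace k → ℝ} (hf : ContDiff ℝ ∞ f) (hg : ContDiff ℝ ∞ g) (hgc : HasCompactSupport g)
    (hgΩ : tsupport g ⊆ Ω) (hfg : ∀ x, |f x| ≤ g x) {β : Form k (2 * q)}
    (hβ : β ∈ stronglyPositive k q) :
    ‖ev T (fun x => f x • β)‖ ≤ (ev T (fun x => g x • β)).re := by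
  have hsub : tsupport f ⊆ tsupport g := tsupport_subset_of_zero fun x hx => by
    have := hfg x
    rw [hx] at this
    exact abs_nonpos_iff.1 this
  have tf := isTest_smul_const hf (hgc.of_isClosed_subset (isClosed_tsupport f) hsub)
    (hsub.trans hgΩ) β
  have tg := isTest_smul_const hg hgc hgΩ β
  obtain ⟨c, hc, h1⟩ := hT.ev_nonneg (tg.add tf) fun x => by
    rw [← add_smul]
    exact smul_mem_stronglyPositive (by linarith [neg_abs_le (f x), hfg x]) hβ
  obtain ⟨d, hd, h2⟩ := hT.ev_nonneg (tg.sub tf) fun x => by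
    rw [← sub_smul]
    exact smul_mem_stronglyPositive (by linarith [le_abs_self (f x), hfg x]) hβ
  rw [ev_add T tg tf] at h1
  rw [ev_sub T tg tf] at h2
  have h3 : ev T (fun x => f x • β) = ((c - d) / 2 : ℝ) := by
    push_cast
    linear_combination (h1 - h2) / 2
  have h4 : ev T (fun x => g x • β) = ((c + d) / 2 : ℝ) := by
    push_cast
    linear_combination (h1 + h2) / 2
  rw [h3, h4, Complex.norm_real, Complex.ofReal_re, Real.norm_eq_abs, abs_le]
  constructor <;> linarith

theorem IsPositive.re_ev_nonneg {T : Current Ω (2 * q)} (hT : IsPositive q T)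
    {f : CSpace k → Form k (2 * q)} (hf : IsTest Ω f) (hpos : ∀ x, f x ∈ stronglyPositive k q) :
    0 ≤ (ev T f).re := by
  obtain ⟨c, hc, h⟩ := hT.ev_nonneg hf hpos
  rwa [h, Complex.ofReal_re]

theorem ev_smul_frameSum (T : Current Ω (2 * q)) {g : CSpace k → ℝ} (hg : ContDiff ℝ ∞ g)
    (hgc : HasCompactSupport g) (hgΩ : tsupport g ⊆ Ω) :
    ev T (fun x => g x • frameSum k q) = ∑ l, ev T (fun x => g x • frame k q l) := by
  rw [← ev_sum T _ fun l _ => isTest_smul_const hg hgc hgΩ (frame k q l)]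
  congr 1
  funext x
  rw [frameSum, Finset.smul_sum]

/-- A positive current is dominated by its trace against the reference form. -/
theorem exists_positive_bound (k q : ℕ) : ∃ C : ℝ, 0 ≤ C ∧ ∀ (Ω : Opens (CSpace k))
    (T : Current Ω (2 * q)), IsPositive q T → ∀ (ψ : CSpace k → Form k (2 * q)) (g : CSpace k → ℝ),
      IsTest Ω ψ → ContDiff ℝ ∞ g → HasCompactSupport g → tsupport g ⊆ Ω → (∀ x, ‖ψ x‖ ≤ g x) →
      ‖ev T ψ‖ ≤ C * (ev T (fun x => g x • frameSum k q)).re := by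
  obtain ⟨c, M, e, d, he, hdec⟩ := exists_frame_decomposition k q
  refine ⟨∑ l, 2 * ‖c l‖, by positivity, fun Ω T hT ψ g hψ hg hgc hgΩ hψg => ?_⟩
  have hre : ∀ l, ContDiff ℝ ∞ fun x => (c l (ψ x)).re := fun l =>
    Complex.reCLM.contDiff.comp (((c l).restrictScalars ℝ).contDiff.comp hψ.smooth)
  have him : ∀ l, ContDiff ℝ ∞ fun x => (c l (ψ x)).im := fun l =>
    Complex.imCLM.contDiff.comp (((c l).restrictScalars ℝ).contDiff.comp hψ.smooth)
  have t0 : ∀ (c : Form k (2 * q) →L[ℂ] ℂ) (β : Form k (2 * q)),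
      IsTest Ω (fun x => c (ψ x) • β) := fun c β =>
    hψ.of_zero_of_zero (((c.restrictScalars ℝ).contDiff.comp hψ.smooth).smul contDiff_const)
      fun x hx => by simp [hx]
  have t1 : ∀ l, IsTest Ω (fun x => (c l (ψ x)).re • frame k q l) := fun l =>
    hψ.of_zero_of_zero ((hre l).smul contDiff_const) fun x hx => by simp [hx]
  have t2 : ∀ l, IsTest Ω (fun x => (c l (ψ x)).im • frame k q l) := fun l =>
    hψ.of_zero_of_zero ((him l).smul contDiff_const) fun x hx => by simp [hx]
  have h1 : ev T ψ = ∑ l, ev T (fun x => c l (ψ x) • frame k q l) := by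
    have h2 : ψ = fun x => ∑ l, c l (ψ x) • frame k q l + ∑ i, d i (ψ x) • e i :=
      funext fun x => hdec (ψ x)
    conv_lhs => rw [h2]
    rw [ev_add T (IsTest.sum _ fun l _ => t0 _ _) (IsTest.sum _ fun i _ => t0 _ _),
      ev_sum T _ (fun l _ => t0 _ _), ev_sum T _ (fun i _ => t0 _ _)]
    rw [add_eq_left]
    -- The forms `e i` have a type other than `(q,q)`, and `T` vanishes on them.
    refine Finset.sum_eq_zero fun i _ => ?_
    obtain ⟨a, b, hab, ht⟩ := he i
    exact hT.1.ev_eq_zero hab fun x => ht.smul _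
  have htrace : ∀ l, 0 ≤ (ev T (fun x => g x • frame k q l)).re := fun l =>
    hT.re_ev_nonneg (isTest_smul_const hg hgc hgΩ _) fun x =>
      smul_mem_stronglyPositive ((norm_nonneg _).trans (hψg x)) (frame_mem l)
  have htrace' : ∀ l, (ev T (fun x => g x • frame k q l)).re
      ≤ (ev T (fun x => g x • frameSum k q)).re := by
    intro l
    rw [ev_smul_frameSum T hg hgc hgΩ, Complex.re_sum]
    exact Finset.single_le_sum (f := fun l => (ev T (fun x => g x • frame k q l)).re)
      (fun l _ => htrace l) (Finset.mem_univ l)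
  have hbound : ∀ (f : CSpace k → ℝ) l, ContDiff ℝ ∞ f → (∀ x, |f x| ≤ ‖c l (ψ x)‖) →
      ‖ev T (fun x => f x • frame k q l)‖
        ≤ ‖c l‖ * (ev T (fun x => g x • frameSum k q)).re := by
    intro f l hf hfc
    have h3 : ContDiff ℝ ∞ fun x => ‖c l‖ * g x := contDiff_const.mul hg
    have h4 := hT.norm_ev_smul_le hf h3 (hgc.of_isClosed_subset (isClosed_tsupport _)
        (tsupport_subset_of_zero fun x hx => by simp [hx]))
      ((tsupport_subset_of_zero fun x hx => by simp [hx]).trans hgΩ) (fun x => (hfc x).trans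
        (((c l).le_opNorm _).trans (mul_le_mul_of_nonneg_left (hψg x) (norm_nonneg _))))
      (frame_mem l)
    refine h4.trans ?_
    have h5 : ev T (fun x => (‖c l‖ * g x) • frame k q l)
        = (‖c l‖ : ℂ) * ev T (fun x => g x • frame k q l) := by
      rw [← ev_const_smul T (isTest_smul_const hg hgc hgΩ _)]
      congr 1
      funext x
      rw [mul_smul]
      rfl
    rw [h5, Complex.re_ofReal_mul]
    exact mul_le_mul_of_nonneg_left (htrace' l) (norm_nonneg _)
  rw [h1, Finset.sum_mul]
  refine norm_sum_le_of_le _ fun l _ => ?_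
  have h6 : (fun x => c l (ψ x) • frame k q l) = fun x => (c l (ψ x)).re • frame k q l
      + Complex.I • ((c l (ψ x)).im • frame k q l) := by
    funext x
    conv_lhs => rw [← Complex.re_add_im (c l (ψ x)), add_smul, mul_comm _ Complex.I, mul_smul]
    rfl
  rw [h6, ev_add T (t1 l) ((t2 l).const_smul _), ev_const_smul T (t2 l)]
  refine (norm_add_le _ _).trans ?_
  rw [norm_mul, Complex.norm_I, one_mul]
  have h7 := hbound _ l (hre l) fun x => Complex.abs_re_le_norm _
  have h8 := hbound _ l (him l) fun x => Complex.abs_im_le_norm _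
  linarith

/-- Bound for the mass of a positive current on an open set. -/
theorem exists_mass_bound (k q : ℕ) : ∃ C : ℝ, 0 ≤ C ∧ ∀ (Ω : Opens (CSpace k))
    (T : Current Ω (2 * q)), IsPositive q T → ∀ (W : Set (CSpace k)) (g : CSpace k → ℝ),
      IsOpen W → ContDiff ℝ ∞ g → HasCompactSupport g → tsupport g ⊆ Ω → (∀ x, 0 ≤ g x) →
      (∀ x ∈ W, 1 ≤ g x) →
      mass T W ≤ ENNReal.ofReal (C * (ev T (fun x => g x • frameSum k q)).re) := by
  obtain ⟨C, hC, h⟩ := exists_positive_bound k q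
  refine ⟨C, hC, fun Ω T hT W g hW hg hgc hgΩ hg0 hg1 => ?_⟩
  refine mass_le_of_forall T hW subset_rfl fun f hf hfW hf1 => ?_
  rw [← ofReal_norm]
  refine ENNReal.ofReal_le_ofReal (h Ω T hT f g hf hg hgc hgΩ fun x => ?_)
  by_cases hx : x ∈ tsupport f
  · exact (hf1 x).trans (hg1 x (hfW hx))
  · rw [IsTest.eq_zero hx, norm_zero]
    exact hg0 x

theorem IsPositive.isOfOrderZero {T : Current Ω (2 * q)} (hT : IsPositive q T) :
    IsOfOrderZero T := by
  intro K hK hKΩ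
  obtain ⟨C, _, h⟩ := exists_mass_bound k q
  obtain ⟨L, hL, hKL, hLΩ⟩ := exists_compact_between hK Ω.isOpen hKΩ
  obtain ⟨χ, h1, h2, h3, h4, h5, h6⟩ := exists_cutoff hL Ω.isOpen hLΩ
  refine (mass_mono T hKL).trans_lt ((h Ω T hT (interior L) χ isOpen_interior h1 h2 h3 h4
    fun x hx => ?_).trans_lt ENNReal.ofReal_lt_top)
  exact (h6.self_of_nhdsSet x (interior_subset hx)).ge

/-! ### Wedge products with differentials of functions -/

/-- The form `∂w` of a real function `w`. -/
def delFun (w : CSpace k → ℝ) (x : CSpace k) : CSpace k →L[ℝ] ℂ :=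
  linPart k ℂ (fderiv ℝ (fun z => (w z : ℂ)) x)

/-- The form `∂̄w` of a real function `w`. -/
def delbarFun (w : CSpace k → ℝ) (x : CSpace k) : CSpace k →L[ℝ] ℂ :=
  antiPart k ℂ (fderiv ℝ (fun z => (w z : ℂ)) x)

theorem fderiv_ofReal {w : CSpace k → ℝ} {x : CSpace k} (hw : DifferentiableAt ℝ w x) :
    fderiv ℝ (fun z => (w z : ℂ)) x = Complex.ofRealCLM.comp (fderiv ℝ w x) :=
  (Complex.ofRealCLM.hasFDerivAt.comp x hw.hasFDerivAt).fderiv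

theorem delbarFun_eq {w : CSpace k → ℝ} {x : CSpace k} (hw : DifferentiableAt ℝ w x) :
    delbarFun w x = conjForm (delFun w x) := by
  ext v
  rw [conjForm_apply, delFun, delbarFun, fderiv_ofReal hw, linPart_apply, antiPart_apply]
  simp [Complex.conj_ofNat]

theorem contDiff_ofReal_comp {m : ℕ∞ω} {w : CSpace k → ℝ} (hw : ContDiff ℝ m w) :
    ContDiff ℝ m (fun z => (w z : ℂ)) := Complex.ofRealCLM.contDiff.comp hw

theorem contDiff_delFun {w : CSpace k → ℝ} (hw : ContDiff ℝ ∞ w) : ContDiff ℝ ∞ (delFun w) :=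
  ((linPart k ℂ).restrictScalars ℝ).contDiff.comp
    ((contDiff_ofReal_comp hw).fderiv_right (m := ∞) (by simp))

theorem contDiff_conjForm {a : CSpace k → CSpace k →L[ℝ] ℂ} (ha : ContDiff ℝ ∞ a) :
    ContDiff ℝ ∞ (fun x => conjForm (a x)) :=
  (ContinuousLinearMap.compL ℝ (CSpace k) ℂ ℂ (Complex.conjCLE : ℂ →L[ℝ] ℂ)).contDiff.comp ha

theorem contDiff_delbarFun {w : CSpace k → ℝ} (hw : ContDiff ℝ ∞ w) :
    ContDiff ℝ ∞ (delbarFun w) :=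
  ((antiPart k ℂ).restrictScalars ℝ).contDiff.comp
    ((contDiff_ofReal_comp hw).fderiv_right (m := ∞) (by simp))

theorem contDiff_wedge {a : CSpace k → CSpace k →L[ℝ] ℂ} {f : CSpace k → Form k n}
    (ha : ContDiff ℝ ∞ a) (hf : ContDiff ℝ ∞ f) : ContDiff ℝ ∞ (fun x => wedge (a x) (f x)) := by
  have h1 : ContDiff ℝ ∞ fun x =>
      ((ContinuousLinearMap.lsmul ℝ ℂ : ℂ →L[ℝ] Form k n →L[ℝ] Form k n).flip (f x)).comp (a x) :=
    ((ContinuousLinearMap.lsmul ℝ ℂ : ℂ →L[ℝ] Form k n →L[ℝ] Form k n).flip.contDiff.comp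
      hf).clm_comp ha
  exact ((alt k n).restrictScalars ℝ).contDiff.comp h1

theorem wedge_zero (a : CSpace k →L[ℝ] ℂ) : wedge a (0 : Form k n) = 0 := map_zero (wedgeL a)

theorem zero_wedge (β : Form k n) : wedge (0 : CSpace k →L[ℝ] ℂ) β = 0 := by
  rw [← wedgeL_apply, map_zero]; rfl

theorem norm_wedge_le (a : CSpace k →L[ℝ] ℂ) (β : Form k n) :
    ‖wedge a β‖ ≤ (n + 1) * (‖a‖ * ‖β‖) := by
  refine (ContinuousAlternatingMap.norm_alternatizeUncurryFin_le _).trans ?_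
  refine mul_le_mul_of_nonneg_left ?_ (by positivity)
  refine ContinuousLinearMap.opNorm_le_bound _ (by positivity) fun v => ?_
  rw [ContinuousLinearMap.smulRight_apply, norm_smul, mul_right_comm]
  exact mul_le_mul_of_nonneg_right (a.le_opNorm v) (norm_nonneg _)

theorem delFun_eq_zero {w : CSpace k → ℝ} {x : CSpace k} (hx : x ∉ tsupport w) :
    delFun w x = 0 := by
  have h1 : x ∉ tsupport fun z => (w z : ℂ) := fun h => hx
    (tsupport_subset_of_zero (fun y hy => by simp [hy]) h)
  rw [delFun, image_eq_zero_of_notMem_tsupport fun h => h1 (tsupport_fderiv_subset ℝ h), map_zero]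

theorem delbarFun_eq_zero {w : CSpace k → ℝ} {x : CSpace k} (hx : x ∉ tsupport w) :
    delbarFun w x = 0 := by
  have h1 : x ∉ tsupport fun z => (w z : ℂ) := fun h => hx
    (tsupport_subset_of_zero (fun y hy => by simp [hy]) h)
  rw [delbarFun, image_eq_zero_of_notMem_tsupport fun h => h1 (tsupport_fderiv_subset ℝ h),
    map_zero]

/-- If `α` is `ℂ`-linear then `iα ∧ ᾱ ∧ β` is strongly positive for `β` in the frame. -/
theorem wedge_wedge_conj_frame_mem {α : CSpace k →L[ℝ] ℂ} (hα : ∀ (c : ℂ) v, α (c • v) = c * α v)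
    (l : Fin (frameCard k q)) :
    (Complex.I • wedge α (wedge (conjForm α) (frame k q l)) : Form k (2 * q + 1 + 1))
      ∈ stronglyPositive k (q + 1) := by
  obtain ⟨β, hβ⟩ := exists_frame_eq q l
  let α' : CSpace k →L[ℂ] ℂ :=
    { toFun := α
      map_add' := α.map_add
      map_smul' := hα
      cont := α.continuous }
  have hα' : α'.restrictScalars ℝ = α := by ext; rfl
  have h := elementary_succ (Fin.cons α' β)
  refine Submodule.subset_span ⟨Fin.cons α' β, ?_⟩
  rw [h, Fin.cons_zero, Fin.tail_cons, hα', hβ]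

/-- The form `i∂w ∧ ∂̄w ∧ β`. -/
def energyForm (w : CSpace k → ℝ) (β : Form k n) (x : CSpace k) : Form k (n + 1 + 1) :=
  Complex.I • wedge (delFun w x) (wedge (conjForm (delFun w x)) β)

theorem contDiff_energyForm {w : CSpace k → ℝ} (hw : ContDiff ℝ ∞ w) (β : Form k n) :
    ContDiff ℝ ∞ (energyForm w β) :=
  (contDiff_wedge (contDiff_delFun hw) (contDiff_wedge (contDiff_conjForm (contDiff_delFun hw))
    contDiff_const)).const_smul Complex.I

theorem delFun_smul_apply (w : CSpace k → ℝ) (x : CSpace k) (c : ℂ) (v : CSpace k) :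
    delFun w x (c • v) = c * delFun w x v := linPart_smul_apply _ c v

theorem delbarFun_smul_apply (w : CSpace k → ℝ) (x : CSpace k) (c : ℂ) (v : CSpace k) :
    delbarFun w x (c • v) = starRingEnd ℂ c * delbarFun w x v := antiPart_smul_apply _ c v

theorem energyForm_frame_mem (w : CSpace k → ℝ) (l : Fin (frameCard k q)) (x : CSpace k) :
    (energyForm w (frame k q l) x : Form k (2 * q + 1 + 1)) ∈ stronglyPositive k (q + 1) :=
  wedge_wedge_conj_frame_mem (delFun_smul_apply w x) l

theorem energyForm_frameSum (w : CSpace k → ℝ) (x : CSpace k) :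
    energyForm w (frameSum k q) x = ∑ l, energyForm w (frame k q l) x := by
  simp only [energyForm, frameSum]
  simp only [← wedgeL_apply, map_sum, Finset.smul_sum]

/-- The hypotheses are non-negativity of `s + ζ̄ x + ζ y` for `ζ = ±1, ±i`. The real pair gives `‖x
+ y‖ ≤ s`, the imaginary pair `‖x - y‖ ≤ s`, and half their sum bounds `x` and `y` separately. -/
theorem norm_le_of_polarization {s : ℝ} {x y : ℂ}
    (h1 : ∃ c : ℝ, 0 ≤ c ∧ (s : ℂ) + x + y = c) (h2 : ∃ c : ℝ, 0 ≤ c ∧ (s : ℂ) - x - y = c)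
    (h3 : ∃ c : ℝ, 0 ≤ c ∧ (s : ℂ) - Complex.I * x + Complex.I * y = c)
    (h4 : ∃ c : ℝ, 0 ≤ c ∧ (s : ℂ) + Complex.I * x - Complex.I * y = c) :
    ‖x‖ ≤ s ∧ ‖y‖ ≤ s := by
  obtain ⟨a, ha, h1⟩ := h1
  obtain ⟨b, hb, h2⟩ := h2
  obtain ⟨c, hc, h3⟩ := h3
  obtain ⟨d, hd, h4⟩ := h4
  have hab : a + b = 2 * s := by
    have : ((a + b : ℝ) : ℂ) = ((2 * s : ℝ) : ℂ) := by
      push_cast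
      linear_combination -h1 - h2
    exact_mod_cast this
  have hcd : c + d = 2 * s := by
    have : ((c + d : ℝ) : ℂ) = ((2 * s : ℝ) : ℂ) := by
      push_cast
      linear_combination -h3 - h4
    exact_mod_cast this
  have hI := Complex.I_mul_I
  have h5 : ‖x + y‖ ≤ s := by
    have : x + y = ((a - s : ℝ) : ℂ) := by push_cast; linear_combination h1
    rw [this, Complex.norm_real, Real.norm_eq_abs, abs_le]
    constructor <;> linarith
  have h6 : ‖x - y‖ ≤ s := by
    have : x - y = Complex.I * ((c - s : ℝ) : ℂ) := by
      push_cast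
      linear_combination Complex.I * h3 + (x - y) * hI
    rw [this, norm_mul, Complex.norm_I, one_mul, Complex.norm_real, Real.norm_eq_abs, abs_le]
    constructor <;> linarith
  have hx : (2 : ℂ) * x = (x + y) + (x - y) := by ring
  have hy : (2 : ℂ) * y = (x + y) - (x - y) := by ring
  have hx' := norm_add_le (x + y) (x - y)
  have hy' := norm_sub_le (x + y) (x - y)
  rw [← hx, norm_mul, Complex.norm_ofNat] at hx'
  rw [← hy, norm_mul, Complex.norm_ofNat] at hy'
  constructor <;> linarith

theorem wedge_wedge_conj_expand (r : ℝ) (a γ : CSpace k →L[ℝ] ℂ) (η : ℂ) (β : Form k n) :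
    Complex.I • wedge ((r : ℂ) • a + η • γ) (wedge (conjForm ((r : ℂ) • a + η • γ)) β)
      = (r ^ 2) • (Complex.I • wedge a (wedge (conjForm a) β))
        + (‖η‖ ^ 2) • (Complex.I • wedge γ (wedge (conjForm γ) β))
        + (starRingEnd ℂ η * r) • (Complex.I • wedge a (wedge (conjForm γ) β))
        + (η * r) • (Complex.I • wedge γ (wedge (conjForm a) β)) := by
  simp only [conjForm_add, conjForm_smul, wedge_add_left, wedge_add_right, wedge_smul_left,
    wedge_smul_right, Complex.conj_ofReal]
  rw [← ofReal_smul_eq (r ^ 2), ← ofReal_smul_eq (‖η‖ ^ 2)]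
  have h : ((‖η‖ ^ 2 : ℝ) : ℂ) = η * starRingEnd ℂ η := by
    rw [Complex.mul_conj, Complex.normSq_eq_norm_sq]
  rw [h]
  push_cast
  module

/-- Cauchy–Schwarz inequality for a positive current. -/
theorem IsPositive.cauchySchwarz_aux {T : Current Ω (2 * (q + 1))} (hT : IsPositive (q + 1) T)
    {w : CSpace k → ℝ} (hw : ContDiff ℝ ∞ w) (hwc : HasCompactSupport w) (hwΩ : tsupport w ⊆ Ω)
    {a : CSpace k → ℝ} {b : CSpace k → ℂ} (ha : ContDiff ℝ ∞ a) (hb : ContDiff ℝ ∞ b)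
    (hbc : HasCompactSupport b) (hbΩ : tsupport b ⊆ Ω) {γ : CSpace k →L[ℝ] ℂ}
    (hγl : ∀ (c : ℂ) v, γ (c • v) = c * γ v) (l : Fin (frameCard k q)) :
    ‖ev (n := 2 * q + 1 + 1) T (fun x => (b x * a x) • (Complex.I • wedge (delFun w x)
        (wedge (conjForm γ) (frame k q l))))‖
      ≤ (ev (n := 2 * q + 1 + 1) T (fun x => (a x ^ 2) • energyForm w (frame k q l) x)).re
        + (ev (n := 2 * q + 1 + 1) T (fun x => (‖b x‖ ^ 2) • (Complex.I •
          wedge γ (wedge (conjForm γ) (frame k q l))))).re ∧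
    ‖ev (n := 2 * q + 1 + 1) T (fun x => (starRingEnd ℂ (b x) * a x) • (Complex.I • wedge γ
        (wedge (conjForm (delFun w x)) (frame k q l))))‖
      ≤ (ev (n := 2 * q + 1 + 1) T (fun x => (a x ^ 2) • energyForm w (frame k q l) x)).re
        + (ev (n := 2 * q + 1 + 1) T (fun x => (‖b x‖ ^ 2) • (Complex.I •
          wedge γ (wedge (conjForm γ) (frame k q l))))).re := by
  set E := frame k q l with hE
  have hα := contDiff_delFun hw
  have hαc : ∀ x, x ∉ tsupport w → delFun w x = 0 := fun x hx => delFun_eq_zero hx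
  have hac : ContDiff ℝ ∞ fun x => (a x : ℂ) := contDiff_ofReal_comp ha
  have hbb : ContDiff ℝ ∞ fun x => starRingEnd ℂ (b x) :=
    (Complex.conjCLE : ℂ →L[ℝ] ℂ).contDiff.comp hb
  have tP : IsTest (n := 2 * q + 1 + 1) Ω (fun x => (a x ^ 2) • energyForm w E x) :=
    .of_eq_zero ((ha.pow 2).smul (contDiff_energyForm hw E)) hwc hwΩ fun x hx => by
      rw [energyForm, hαc x hx, zero_wedge, smul_zero, smul_zero]
  have tQ : IsTest (n := 2 * q + 1 + 1) Ω
      (fun x => (‖b x‖ ^ 2) • (Complex.I • wedge γ (wedge (conjForm γ) E))) :=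
    .of_eq_zero ((hb.norm_sq ℝ).smul contDiff_const) hbc hbΩ fun x hx => by
      rw [image_eq_zero_of_notMem_tsupport hx, norm_zero, zero_pow two_ne_zero, zero_smul]
  have tX : IsTest (n := 2 * q + 1 + 1) Ω (fun x => (b x * a x) •
      (Complex.I • wedge (delFun w x) (wedge (conjForm γ) E))) :=
    .of_eq_zero ((hb.mul hac).smul ((contDiff_wedge hα contDiff_const).const_smul Complex.I))
      hwc hwΩ fun x hx => by rw [hαc x hx, zero_wedge, smul_zero, smul_zero]
  have tY : IsTest (n := 2 * q + 1 + 1) Ω (fun x => (starRingEnd ℂ (b x) * a x) •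
      (Complex.I • wedge γ (wedge (conjForm (delFun w x)) E))) :=
    .of_eq_zero ((hbb.mul hac).smul ((contDiff_wedge contDiff_const
      (contDiff_wedge (contDiff_conjForm hα) contDiff_const)).const_smul Complex.I)) hwc hwΩ
      fun x hx => by
        have : conjForm (0 : CSpace k →L[ℝ] ℂ) = 0 := by ext; simp [conjForm_apply]
        rw [hαc x hx, this, zero_wedge, wedge_zero, smul_zero, smul_zero]
  obtain ⟨cP, hcP, hP⟩ := hT.ev_nonneg tP fun x =>
    smul_mem_stronglyPositive (sq_nonneg _) (energyForm_frame_mem w l x)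
  obtain ⟨cQ, hcQ, hQ⟩ := hT.ev_nonneg tQ fun x =>
    smul_mem_stronglyPositive (sq_nonneg _) (wedge_wedge_conj_frame_mem hγl l)
  rw [hP, hQ, Complex.ofReal_re, Complex.ofReal_re]
  -- For `α = a ∂w + ζ b̄ γ`, the form `iα ∧ ᾱ` times a frame element is strongly positive. Its
  -- expansion has diagonal terms independent of `ζ` and cross terms multiplied by `ζ̄` and `ζ`.
  have key : ∀ ζ : ℂ, ‖ζ‖ = 1 → ∃ c : ℝ, 0 ≤ c ∧ ((cP + cQ : ℝ) : ℂ)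
      + starRingEnd ℂ ζ * ev (n := 2 * q + 1 + 1) T (fun x => (b x * a x) •
        (Complex.I • wedge (delFun w x) (wedge (conjForm γ) E)))
      + ζ * ev (n := 2 * q + 1 + 1) T (fun x => (starRingEnd ℂ (b x) * a x) •
        (Complex.I • wedge γ (wedge (conjForm (delFun w x)) E))) = c := by
    intro ζ hζ
    have h1 := fun x => wedge_wedge_conj_expand (a x) (delFun w x) γ
      (ζ * starRingEnd ℂ (b x)) E
    have h2 : ∀ x, ∀ (c : ℂ) v, ((a x : ℂ) • delFun w x + (ζ * starRingEnd ℂ (b x)) • γ) (c • v)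
        = c * ((a x : ℂ) • delFun w x + (ζ * starRingEnd ℂ (b x)) • γ) v := fun x c v => by
      simp only [add_apply, FunLike.coe_smul, Pi.smul_apply, smul_eq_mul, hγl,
        delFun_smul_apply]
      ring
    have h3 := fun x => wedge_wedge_conj_frame_mem (q := q) (h2 x) l
    obtain ⟨c, hc, h4⟩ := hT.ev_nonneg (((tP.add tQ).add (tX.const_smul (starRingEnd ℂ ζ))).add
      (tY.const_smul ζ)) fun x => by
        have h5 := h3 x
        rw [← hE, h1 x, norm_mul, hζ, one_mul, RCLike.norm_conj, map_mul, Complex.conj_conj,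
          mul_assoc, mul_assoc, mul_smul (starRingEnd ℂ ζ), mul_smul ζ] at h5
        exact h5
    refine ⟨c, hc, ?_⟩
    rw [← h4]
    rw [ev_add (n := 2 * q + 1 + 1) T ((tP.add tQ).add (tX.const_smul (starRingEnd ℂ ζ)))
      (tY.const_smul ζ), ev_add (n := 2 * q + 1 + 1) T (tP.add tQ)
      (tX.const_smul (starRingEnd ℂ ζ)), ev_add (n := 2 * q + 1 + 1) T tP tQ,
      ev_const_smul (n := 2 * q + 1 + 1) T tX, ev_const_smul (n := 2 * q + 1 + 1) T tY, hP, hQ]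
    push_cast
    ring
  have k1 := key 1 (by simp)
  have k2 := key (-1) (by simp)
  have k3 := key Complex.I (by simp)
  have k4 := key (-Complex.I) (by simp)
  refine norm_le_of_polarization ?_ ?_ ?_ ?_
  · simpa only [map_one, one_mul] using k1
  · simpa only [map_neg, map_one, neg_mul, one_mul, ← sub_eq_add_neg] using k2
  · simpa only [Complex.conj_I, neg_mul, ← sub_eq_add_neg] using k3
  · simpa only [map_neg, Complex.conj_I, neg_neg, neg_mul, ← sub_eq_add_neg] using k4

end Positive

/-! ### Estimate of mixed terms -/

section Mixed

open MeasureTheory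

variable {k n q : ℕ} {Ω : Opens (CSpace k)}

theorem isTest_smul_energyForm {w s : CSpace k → ℝ} (hw : ContDiff ℝ ∞ w)
    (hwc : HasCompactSupport w) (hwΩ : tsupport w ⊆ Ω) (hs : ContDiff ℝ ∞ s) (β : Form k n) :
    IsTest Ω (fun x => s x • energyForm w β x) :=
  .of_eq_zero (hs.smul (contDiff_energyForm hw β)) hwc hwΩ fun x hx => by
    rw [energyForm, delFun_eq_zero hx, zero_wedge, smul_zero, smul_zero]

theorem ev_smul_energyForm_frameSum {T : Current Ω (2 * (q + 1))} {w s : CSpace k → ℝ}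
    (hw : ContDiff ℝ ∞ w) (hwc : HasCompactSupport w) (hwΩ : tsupport w ⊆ Ω)
    (hs : ContDiff ℝ ∞ s) :
    ev (n := 2 * q + 1 + 1) T (fun x => s x • energyForm w (frameSum k q) x)
      = ∑ l, ev (n := 2 * q + 1 + 1) T (fun x => s x • energyForm w (frame k q l) x) := by
  rw [← ev_sum (n := 2 * q + 1 + 1) T _
    fun l _ => isTest_smul_energyForm hw hwc hwΩ hs (frame k q l)]
  congr 1
  funext x
  rw [energyForm_frameSum, Finset.smul_sum]

theorem IsPositive.re_ev_energyForm_nonneg {T : Current Ω (2 * (q + 1))}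
    (hT : IsPositive (q + 1) T) {w s : CSpace k → ℝ}
    (hw : ContDiff ℝ ∞ w) (hwc : HasCompactSupport w) (hwΩ : tsupport w ⊆ Ω)
    (hs : ContDiff ℝ ∞ s) (hs0 : ∀ x, 0 ≤ s x) (l : Fin (frameCard k q)) :
    0 ≤ (ev (n := 2 * q + 1 + 1) T (fun x => s x • energyForm w (frame k q l) x)).re :=
  hT.re_ev_nonneg (isTest_smul_energyForm hw hwc hwΩ hs _) fun x =>
    smul_mem_stronglyPositive (hs0 x) (energyForm_frame_mem w l x)

theorem IsPositive.re_ev_energyForm_le {T : Current Ω (2 * (q + 1))}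
    (hT : IsPositive (q + 1) T) {w s : CSpace k → ℝ}
    (hw : ContDiff ℝ ∞ w) (hwc : HasCompactSupport w) (hwΩ : tsupport w ⊆ Ω)
    (hs : ContDiff ℝ ∞ s) (hs0 : ∀ x, 0 ≤ s x) (l : Fin (frameCard k q)) :
    (ev (n := 2 * q + 1 + 1) T (fun x => s x • energyForm w (frame k q l) x)).re
      ≤ (ev (n := 2 * q + 1 + 1) T (fun x => s x • energyForm w (frameSum k q) x)).re := by
  rw [ev_smul_energyForm_frameSum hw hwc hwΩ hs, Complex.re_sum]
  exact Finset.single_le_sum (f := fun l =>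
    (ev (n := 2 * q + 1 + 1) T (fun x => s x • energyForm w (frame k q l) x)).re)
    (fun l _ => hT.re_ev_energyForm_nonneg hw hwc hwΩ hs hs0 l) (Finset.mem_univ l)

theorem IsDominated.re_ev_le {T : Current Ω n} {μ : Measure (CSpace k)} (hTμ : IsDominated T μ)
    {f : CSpace k → ℝ} {β : Form k n} {C V : ℝ} (hC : 0 ≤ C) (hV : 0 ≤ V)
    {Ψ : CSpace k → ℝ≥0∞} (hΨ : ∫⁻ x, Ψ x ∂μ ≤ ENNReal.ofReal V)
    (hf : ∀ x, ‖f x‖ₑ ≤ ENNReal.ofReal C * Ψ x) :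
    (ev T (fun x => f x • β)).re ≤ ‖β‖ * C * V := by
  refine (Complex.re_le_norm _).trans ?_
  rw [← ENNReal.ofReal_le_ofReal_iff (by positivity), ofReal_norm]
  calc ‖ev T (fun x => f x • β)‖ₑ ≤ ∫⁻ x, ‖f x • β‖ₑ ∂μ := hTμ _
    _ ≤ ∫⁻ x, ENNReal.ofReal (‖β‖ * C) * Ψ x ∂μ := lintegral_mono fun x => by
        rw [enorm_smul, mul_comm, ENNReal.ofReal_mul (norm_nonneg _), ofReal_norm, mul_assoc]
        gcongr
        exact hf x
    _ = ENNReal.ofReal (‖β‖ * C) * ∫⁻ x, Ψ x ∂μ := by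
        rw [lintegral_const_mul' _ _ ENNReal.ofReal_ne_top]
    _ ≤ ENNReal.ofReal (‖β‖ * C * V) := by
        rw [ENNReal.ofReal_mul (by positivity : 0 ≤ ‖β‖ * C)]
        gcongr

theorem dz_smul_apply (j : Fin k) (c : ℂ) (v : CSpace k) :
    (dz j).restrictScalars ℝ (c • v) = c * (dz j).restrictScalars ℝ v := by simp

/-- The reference `(1,1)`-form `i dz_j ∧ dz̄_j` times a form of the frame. -/
def diagForm (j : Fin k) (l : Fin (frameCard k q)) : Form k (2 * q + 1 + 1) :=
  Complex.I • wedge ((dz j).restrictScalars ℝ) (wedge (conjForm ((dz j).restrictScalars ℝ))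
    (frame k q l))

theorem enorm_sq_smul_le {t : ℝ} (ht : 0 < t) (c : Form k n →L[ℂ] ℂ) (β : Form k n) :
    ‖(‖((√t)⁻¹ : ℂ) * c β‖ ^ 2 : ℝ)‖ₑ
      ≤ ENNReal.ofReal (t⁻¹ * ‖c‖ ^ 2) * ‖β‖ₑ ^ 2 := by
  have h : ‖((√t)⁻¹ : ℂ) * c β‖ ^ 2 ≤ t⁻¹ * ‖c‖ ^ 2 * ‖β‖ ^ 2 := by
    rw [norm_mul, mul_pow, norm_inv, Complex.norm_real, Real.norm_eq_abs, inv_pow, sq_abs,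
      Real.sq_sqrt ht.le, mul_assoc, ← mul_pow]
    gcongr
    exact c.le_opNorm β
  rw [Real.enorm_eq_ofReal (by positivity), ← ofReal_norm, ← ENNReal.ofReal_pow (norm_nonneg _),
    ← ENNReal.ofReal_mul (by positivity)]
  exact ENNReal.ofReal_le_ofReal h

/-- Cauchy–Schwarz with `a = √t s` and `b = c(Ψ)/√t`: the product is independent of `t`, while the
squares carry the weights `t` and `1/t`. For the `∂̄w` term, `b` is replaced by its conjugate and
the two linear factors are exchanged, since `∂̄w` is the conjugate of `∂w`. -/
theorem IsPositive.mixed_frame_le {T : Current Ω (2 * (q + 1))}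
    (hT : IsPositive (q + 1) T) {μ : Measure (CSpace k)} (hTμ : IsDominated T μ)
    {w s : CSpace k → ℝ} (hw : ContDiff ℝ ∞ w) (hwc : HasCompactSupport w) (hwΩ : tsupport w ⊆ Ω)
    (hs : ContDiff ℝ ∞ s) {Ψ : CSpace k → Form k n} (hΨ : IsTest Ω Ψ)
    {t V : ℝ} (ht : 0 < t) (hV : 0 ≤ V) (hΨV : ∫⁻ x, ‖Ψ x‖ₑ ^ 2 ∂μ ≤ ENNReal.ofReal V)
    (c : Form k n →L[ℂ] ℂ) (j : Fin k) (l : Fin (frameCard k q)) :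
    ‖ev (n := 2 * q + 1 + 1) T (fun x => ((s x : ℂ) * c (Ψ x)) • wedge (delFun w x)
        (wedge (conjForm ((dz j).restrictScalars ℝ)) (frame k q l)))‖
      ≤ t * (ev (n := 2 * q + 1 + 1) T
          (fun x => (s x ^ 2) • energyForm w (frameSum k q) x)).re
        + t⁻¹ * (‖(diagForm j l : Form k (2 * q + 1 + 1))‖ * ‖c‖ ^ 2 * V) ∧
    ‖ev (n := 2 * q + 1 + 1) T (fun x => ((s x : ℂ) * c (Ψ x)) • wedge (delbarFun w x)
        (wedge ((dz j).restrictScalars ℝ) (frame k q l)))‖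
      ≤ t * (ev (n := 2 * q + 1 + 1) T
          (fun x => (s x ^ 2) • energyForm w (frameSum k q) x)).re
        + t⁻¹ * (‖(diagForm j l : Form k (2 * q + 1 + 1))‖ * ‖c‖ ^ 2 * V) := by
  have hst : 0 < √t := Real.sqrt_pos.2 ht
  have hst' : ((√t : ℝ) : ℂ) ≠ 0 := by exact_mod_cast hst.ne'
  have hcΨ : ContDiff ℝ ∞ fun x => c (Ψ x) := (c.restrictScalars ℝ).contDiff.comp hΨ.smooth
  have ha : ContDiff ℝ ∞ fun x => √t * s x := contDiff_const.mul hs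
  have hb : ContDiff ℝ ∞ fun x => ((√t)⁻¹ : ℂ) * c (Ψ x) := contDiff_const.mul hcΨ
  have hbs : tsupport (fun x => ((√t)⁻¹ : ℂ) * c (Ψ x)) ⊆ tsupport Ψ :=
    tsupport_subset_of_zero fun x hx => by rw [hx, map_zero, mul_zero]
  have hbc : HasCompactSupport fun x => ((√t)⁻¹ : ℂ) * c (Ψ x) :=
    hΨ.compact.of_isClosed_subset (isClosed_tsupport _) hbs
  have hb' : ContDiff ℝ ∞ fun x => starRingEnd ℂ (((√t)⁻¹ : ℂ) * c (Ψ x)) :=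
    (Complex.conjCLE : ℂ →L[ℝ] ℂ).contDiff.comp hb
  have hbs' : tsupport (fun x => starRingEnd ℂ (((√t)⁻¹ : ℂ) * c (Ψ x))) ⊆ tsupport Ψ :=
    tsupport_subset_of_zero fun x hx => by rw [hx, map_zero, mul_zero, map_zero]
  have hbc' : HasCompactSupport fun x => starRingEnd ℂ (((√t)⁻¹ : ℂ) * c (Ψ x)) :=
    hΨ.compact.of_isClosed_subset (isClosed_tsupport _) hbs'
  have h1 := (hT.cauchySchwarz_aux hw hwc hwΩ ha hb hbc (hbs.trans hΨ.subset)
    (dz_smul_apply j) l).1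
  have h2 := (hT.cauchySchwarz_aux hw hwc hwΩ ha hb' hbc' (hbs'.trans hΨ.subset)
    (dz_smul_apply j) l).2
  have hP : (ev (n := 2 * q + 1 + 1) T
      (fun x => ((√t * s x) ^ 2) • energyForm w (frame k q l) x)).re
      ≤ t * (ev (n := 2 * q + 1 + 1) T
          (fun x => (s x ^ 2) • energyForm w (frameSum k q) x)).re := by
    have h3 : (fun x => ((√t * s x) ^ 2) • energyForm w (frame k q l) x)
        = fun x => (t : ℂ) • ((s x ^ 2) • energyForm w (frame k q l) x) := by
      funext x
      rw [mul_pow, Real.sq_sqrt ht.le, mul_smul, ofReal_smul_eq]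
    rw [h3, ev_const_smul (n := 2 * q + 1 + 1) T
      (isTest_smul_energyForm hw hwc hwΩ (hs.pow 2) _), Complex.re_ofReal_mul]
    exact mul_le_mul_of_nonneg_left (hT.re_ev_energyForm_le hw hwc hwΩ (hs.pow 2)
      (fun x => sq_nonneg _) l) ht.le
  have hQ : (ev (n := 2 * q + 1 + 1) T
      (fun x => (‖((√t)⁻¹ : ℂ) * c (Ψ x)‖ ^ 2) • (diagForm j l : Form k (2 * q + 1 + 1)))).re
      ≤ t⁻¹ * (‖(diagForm j l : Form k (2 * q + 1 + 1))‖ * ‖c‖ ^ 2 * V) := by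
    refine (IsDominated.re_ev_le (n := 2 * q + 1 + 1) hTμ (C := t⁻¹ * ‖c‖ ^ 2) (by positivity) hV
      hΨV fun x => enorm_sq_smul_le ht c (Ψ x)).trans (le_of_eq (by ring))
  simp only [RCLike.norm_conj] at h2
  have tX : IsTest (n := 2 * q + 1 + 1) Ω (fun x => ((s x : ℂ) * c (Ψ x)) • wedge (delFun w x)
      (wedge (conjForm ((dz j).restrictScalars ℝ)) (frame k q l))) :=
    hΨ.of_zero_of_zero (((contDiff_ofReal_comp hs).mul hcΨ).smul
      (contDiff_wedge (contDiff_delFun hw) contDiff_const))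
      fun x hx => by rw [hx, map_zero, mul_zero, zero_smul]
  have tY : IsTest (n := 2 * q + 1 + 1) Ω (fun x => ((s x : ℂ) * c (Ψ x)) • wedge (delbarFun w x)
      (wedge ((dz j).restrictScalars ℝ) (frame k q l))) :=
    hΨ.of_zero_of_zero (((contDiff_ofReal_comp hs).mul hcΨ).smul
      (contDiff_wedge (contDiff_delbarFun hw) contDiff_const))
      fun x hx => by rw [hx, map_zero, mul_zero, zero_smul]
  constructor
  · refine le_trans (le_of_eq ?_) (h1.trans (add_le_add hP hQ))
    have : (fun x => (((√t)⁻¹ : ℂ) * c (Ψ x) * ((√t * s x : ℝ) : ℂ)) • (Complex.I •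
        wedge (delFun w x) (wedge (conjForm ((dz j).restrictScalars ℝ)) (frame k q l))))
        = fun x => Complex.I • (((s x : ℂ) * c (Ψ x)) • wedge (delFun w x)
          (wedge (conjForm ((dz j).restrictScalars ℝ)) (frame k q l))) := by
      funext x
      rw [smul_comm]
      congr 2
      push_cast
      field_simp
    rw [this, ev_const_smul (n := 2 * q + 1 + 1) T tX, norm_mul, Complex.norm_I, one_mul]
  · refine le_trans (le_of_eq ?_) (h2.trans (add_le_add hP hQ))
    have : (fun x => (starRingEnd ℂ (starRingEnd ℂ (((√t)⁻¹ : ℂ) * c (Ψ x))) *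
        ((√t * s x : ℝ) : ℂ)) • (Complex.I • wedge ((dz j).restrictScalars ℝ)
          (wedge (conjForm (delFun w x)) (frame k q l))))
        = fun x => (-Complex.I) • (((s x : ℂ) * c (Ψ x)) • wedge (delbarFun w x)
          (wedge ((dz j).restrictScalars ℝ) (frame k q l))) := by
      funext x
      rw [delbarFun_eq (hw.differentiable (by simp) x), wedge_anticomm, Complex.conj_conj,
        smul_neg, smul_neg, neg_smul, smul_comm]
      congr 3
      push_cast
      field_simp
    rw [this, ev_const_smul (n := 2 * q + 1 + 1) T tY, norm_mul, norm_neg, Complex.norm_I, one_mul]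

theorem isOfType_wedge_delFun {w : CSpace k → ℝ} {x : CSpace k} {a b : ℕ} {β : Form k n}
    (hβ : IsOfType a b β) : IsOfType (a + 1) b (wedge (delFun w x) β) :=
  hβ.wedge_lin (delFun_smul_apply w x)

theorem isOfType_wedge_delbarFun {w : CSpace k → ℝ} {x : CSpace k} {a b : ℕ} {β : Form k n}
    (hβ : IsOfType a b β) : IsOfType a (b + 1) (wedge (delbarFun w x) β) :=
  hβ.wedge_anti (delbarFun_smul_apply w x)

theorem isOfType_wedge_dz (j : Fin k) (l : Fin (frameCard k q)) :
    IsOfType (q + 1) q (wedge ((dz j).restrictScalars ℝ) (frame k q l)) :=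
  (isOfType_frame l).wedge_lin (dz_smul_apply j)

theorem isOfType_wedge_conj_dz (j : Fin k) (l : Fin (frameCard k q)) :
    IsOfType q (q + 1) (wedge (conjForm ((dz j).restrictScalars ℝ)) (frame k q l)) :=
  (isOfType_frame l).wedge_anti conjForm_smul_apply

/-- Estimate of the mixed terms `T(s ∂w ∧ Ψ)` and `T(s ∂̄w ∧ Ψ)`, for `Ψ` supported in `Ω`. -/
theorem exists_mixed_bound_of_isTest (k q : ℕ) : ∃ C : ℝ, 0 ≤ C ∧ ∀ (Ω : Opens (CSpace k))
    (T : Current Ω (2 * (q + 1))), IsPositive (q + 1) T → ∀ μ : Measure (CSpace k),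
    IsDominated T μ → ∀ (w s : CSpace k → ℝ), ContDiff ℝ ∞ w → HasCompactSupport w →
    tsupport w ⊆ Ω → ContDiff ℝ ∞ s → ∀ Ψ : CSpace k → Form k (2 * q + 1), IsTest Ω Ψ →
    ∀ t V : ℝ, 0 < t → 0 ≤ V → ∫⁻ x, ‖Ψ x‖ₑ ^ 2 ∂μ ≤ ENNReal.ofReal V →
    ‖ev (n := 2 * q + 1 + 1) T (fun x => s x • wedge (delFun w x) (Ψ x))‖
      ≤ C * (t * (ev (n := 2 * q + 1 + 1) T
          (fun x => (s x ^ 2) • energyForm w (frameSum k q) x)).re + t⁻¹ * V) ∧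
    ‖ev (n := 2 * q + 1 + 1) T (fun x => s x • wedge (delbarFun w x) (Ψ x))‖
      ≤ C * (t * (ev (n := 2 * q + 1 + 1) T
          (fun x => (s x ^ 2) • energyForm w (frameSum k q) x)).re + t⁻¹ * V) := by
  obtain ⟨c, d, M, e, f, he, hdec⟩ := exists_frame_decomposition_odd k q
  -- The summand 1 pays for the energy term, the other two for the terms in `V` coming from the
  -- coefficients `c j l` and `d j l`.
  let B : Fin k → Fin (frameCard k q) → ℝ := fun j l =>
    1 + ‖(diagForm j l : Form k (2 * q + 1 + 1))‖ * ‖c j l‖ ^ 2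
      + ‖(diagForm j l : Form k (2 * q + 1 + 1))‖ * ‖d j l‖ ^ 2
  have hB0 : ∀ j l, 0 ≤ B j l := fun j l => add_nonneg (add_nonneg zero_le_one
    (mul_nonneg (norm_nonneg _) (sq_nonneg _))) (mul_nonneg (norm_nonneg _) (sq_nonneg _))
  refine ⟨∑ j, ∑ l, B j l,
    Finset.sum_nonneg fun j _ => Finset.sum_nonneg fun l _ => hB0 j l, ?_⟩
  intro Ω T hT μ hTμ w s hw hwc hwΩ hs Ψ hΨ t V ht hV hΨV
  set En := (ev (n := 2 * q + 1 + 1) T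
    (fun x => (s x ^ 2) • energyForm w (frameSum k q) x)).re with hEn
  have hEn0 : 0 ≤ En := by
    rw [hEn, ev_smul_energyForm_frameSum hw hwc hwΩ (hs.pow 2), Complex.re_sum]
    exact Finset.sum_nonneg fun l _ => hT.re_ev_energyForm_nonneg hw hwc hwΩ (hs.pow 2)
      (fun x => sq_nonneg _) l
  have hB : ∀ j l (b : Form k (2 * q + 1) →L[ℂ] ℂ), b = c j l ∨ b = d j l →
      t * En + t⁻¹ * (‖(diagForm j l : Form k (2 * q + 1 + 1))‖ * ‖b‖ ^ 2 * V)
        ≤ B j l * (t * En + t⁻¹ * V) := by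
    intro j l b hb
    have hBe : B j l = 1 + ‖(diagForm j l : Form k (2 * q + 1 + 1))‖ * ‖c j l‖ ^ 2
      + ‖(diagForm j l : Form k (2 * q + 1 + 1))‖ * ‖d j l‖ ^ 2 := rfl
    clear_value B
    have h1 : ‖(diagForm j l : Form k (2 * q + 1 + 1))‖ * ‖b‖ ^ 2 ≤ B j l := by
      have h2 : 0 ≤ ‖(diagForm j l : Form k (2 * q + 1 + 1))‖ * ‖c j l‖ ^ 2 := by positivity
      have h3 : 0 ≤ ‖(diagForm j l : Form k (2 * q + 1 + 1))‖ * ‖d j l‖ ^ 2 := by positivity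
      rw [hBe]
      rcases hb with rfl | rfl <;> linarith
    have h4 : 1 ≤ B j l := by
      have : 0 ≤ ‖(diagForm j l : Form k (2 * q + 1 + 1))‖ * ‖c j l‖ ^ 2
        + ‖(diagForm j l : Form k (2 * q + 1 + 1))‖ * ‖d j l‖ ^ 2 := by positivity
      rw [hBe]
      linarith
    have h5 : 0 ≤ t * En := by positivity
    have h6 : 0 ≤ t⁻¹ * V := by positivity
    nlinarith [mul_le_mul_of_nonneg_right h1 h6, mul_le_mul_of_nonneg_right h4 h5]
  have hcΨ : ∀ b : Form k (2 * q + 1) →L[ℂ] ℂ, ContDiff ℝ ∞ fun x => b (Ψ x) := fun b =>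
    (b.restrictScalars ℝ).contDiff.comp hΨ.smooth
  have hsum : ∀ (η : CSpace k → CSpace k →L[ℝ] ℂ) x,
      (s x • wedge (η x) (Ψ x) : Form k (2 * q + 1 + 1)) = ∑ j, ∑ l,
        (((s x : ℂ) * c j l (Ψ x)) • wedge (η x)
          (wedge (conjForm ((dz j).restrictScalars ℝ)) (frame k q l))
        + ((s x : ℂ) * d j l (Ψ x)) • wedge (η x)
          (wedge ((dz j).restrictScalars ℝ) (frame k q l)))
        + ∑ i, ((s x : ℂ) * f i (Ψ x)) • wedge (η x) (e i) := by
    intro η x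
    conv_lhs => rw [hdec (Ψ x), ← ofReal_smul_eq]
    simp only [← wedgeL_apply, map_add, map_sum, map_smul, smul_add, Finset.smul_sum, mul_smul]
  have tt : ∀ (η : CSpace k → CSpace k →L[ℝ] ℂ), ContDiff ℝ ∞ η →
      ∀ (b : Form k (2 * q + 1) →L[ℂ] ℂ) (β : Form k (2 * q + 1)),
      IsTest (n := 2 * q + 1 + 1) Ω (fun x => ((s x : ℂ) * b (Ψ x)) • wedge (η x) β) :=
    fun η hη b β => hΨ.of_zero_of_zero (((contDiff_ofReal_comp hs).mul (hcΨ b)).smul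
      (contDiff_wedge hη contDiff_const))
      fun x hx => by rw [hx, map_zero, mul_zero, zero_smul]
  have hev : ∀ (η : CSpace k → CSpace k →L[ℝ] ℂ), ContDiff ℝ ∞ η →
      ev (n := 2 * q + 1 + 1) T (fun x => s x • wedge (η x) (Ψ x)) = ∑ j, ∑ l,
        (ev (n := 2 * q + 1 + 1) T (fun x => ((s x : ℂ) * c j l (Ψ x)) • wedge (η x)
          (wedge (conjForm ((dz j).restrictScalars ℝ)) (frame k q l)))
        + ev (n := 2 * q + 1 + 1) T (fun x => ((s x : ℂ) * d j l (Ψ x)) • wedge (η x)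
          (wedge ((dz j).restrictScalars ℝ) (frame k q l))))
        + ∑ i, ev (n := 2 * q + 1 + 1) T
          (fun x => ((s x : ℂ) * f i (Ψ x)) • wedge (η x) (e i)) := by
    intro η hη
    have h1 := fun j l => (tt η hη (c j l)
      (wedge (conjForm ((dz j).restrictScalars ℝ)) (frame k q l))).add (tt η hη (d j l)
      (wedge ((dz j).restrictScalars ℝ) (frame k q l)))
    rw [funext (hsum η), ev_add (n := 2 * q + 1 + 1) T
      (IsTest.sum _ fun j _ => IsTest.sum _ fun l _ => h1 j l)
      (IsTest.sum _ fun i _ => tt η hη (f i) (e i)),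
      ev_sum (n := 2 * q + 1 + 1) T _ fun i _ => tt η hη (f i) (e i),
      ev_sum (n := 2 * q + 1 + 1) T _ fun j _ => IsTest.sum _ fun l _ => h1 j l]
    congr 1
    refine Finset.sum_congr rfl fun j _ => ?_
    rw [ev_sum (n := 2 * q + 1 + 1) T _ fun l _ => h1 j l]
    exact Finset.sum_congr rfl fun l _ => ev_add (n := 2 * q + 1 + 1) T (tt η hη (c j l) _)
      (tt η hη (d j l) _)
  constructor
  · rw [hev _ (contDiff_delFun hw), Finset.sum_eq_zero (s := Finset.univ)
      (f := fun i => ev (n := 2 * q + 1 + 1) T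
        (fun x => ((s x : ℂ) * f i (Ψ x)) • wedge (delFun w x) (e i))), add_zero, Finset.sum_mul]
    · refine norm_sum_le_of_le _ fun j _ => ?_
      rw [Finset.sum_mul]
      refine norm_sum_le_of_le _ fun l _ => ?_
      -- Wedging `∂w` with the `dz_j` part gives type `(q+2, q)`, on which `T` vanishes; only the
      -- `dz̄_j` part contributes.
      rw [hT.1.ev_eq_zero (n := 2 * q + 1 + 1) (a := q + 2) (b := q) (by simp)
        (f := fun x => ((s x : ℂ) * d j l (Ψ x)) • wedge (delFun w x)
          (wedge ((dz j).restrictScalars ℝ) (frame k q l)))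
        fun x => (isOfType_wedge_delFun (isOfType_wedge_dz j l)).smul _, add_zero]
      exact (hT.mixed_frame_le hTμ hw hwc hwΩ hs hΨ ht hV hΨV (c j l) j l).1.trans
        (hB j l _ (Or.inl rfl))
    · intro i _
      obtain ⟨a, b, -, hab, ht⟩ := he i
      refine hT.1.ev_eq_zero (n := 2 * q + 1 + 1) (a := a + 1) (b := b) ?_
        fun x => (isOfType_wedge_delFun ht).smul _
      simpa using hab
  · rw [hev _ (contDiff_delbarFun hw), Finset.sum_eq_zero (s := Finset.univ)
      (f := fun i => ev (n := 2 * q + 1 + 1) T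
        (fun x => ((s x : ℂ) * f i (Ψ x)) • wedge (delbarFun w x) (e i))), add_zero,
      Finset.sum_mul]
    · refine norm_sum_le_of_le _ fun j _ => ?_
      rw [Finset.sum_mul]
      refine norm_sum_le_of_le _ fun l _ => ?_
      rw [hT.1.ev_eq_zero (n := 2 * q + 1 + 1) (a := q) (b := q + 2) (by simp)
        (f := fun x => ((s x : ℂ) * c j l (Ψ x)) • wedge (delbarFun w x)
          (wedge (conjForm ((dz j).restrictScalars ℝ)) (frame k q l)))
        fun x => (isOfType_wedge_delbarFun (isOfType_wedge_conj_dz j l)).smul _, zero_add]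
      exact (hT.mixed_frame_le hTμ hw hwc hwΩ hs hΨ ht hV hΨV (d j l) j l).2.trans
        (hB j l _ (Or.inr rfl))
    · intro i _
      obtain ⟨a, b, hab, -, ht⟩ := he i
      refine hT.1.ev_eq_zero (n := 2 * q + 1 + 1) (a := a) (b := b + 1) ?_
        fun x => (isOfType_wedge_delbarFun ht).smul _
      simpa using hab

/-- Estimate of the mixed terms `T(s ∂w ∧ Ψ)` and `T(s ∂̄w ∧ Ψ)`. -/
theorem exists_mixed_bound (k q : ℕ) : ∃ C : ℝ, 0 ≤ C ∧ ∀ (Ω : Opens (CSpace k))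
    (T : Current Ω (2 * (q + 1))), IsPositive (q + 1) T → ∀ μ : Measure (CSpace k),
    IsDominated T μ → ∀ (w s : CSpace k → ℝ), ContDiff ℝ ∞ w → HasCompactSupport w →
    tsupport w ⊆ Ω → ContDiff ℝ ∞ s → ∀ Ψ : CSpace k → Form k (2 * q + 1), ContDiff ℝ ∞ Ψ →
    ∀ t V : ℝ, 0 < t → 0 ≤ V → ∫⁻ x, ‖Ψ x‖ₑ ^ 2 ∂μ ≤ ENNReal.ofReal V →
    ‖ev (n := 2 * q + 1 + 1) T (fun x => s x • wedge (delFun w x) (Ψ x))‖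
      ≤ C * (t * (ev (n := 2 * q + 1 + 1) T
          (fun x => (s x ^ 2) • energyForm w (frameSum k q) x)).re + t⁻¹ * V) ∧
    ‖ev (n := 2 * q + 1 + 1) T (fun x => s x • wedge (delbarFun w x) (Ψ x))‖
      ≤ C * (t * (ev (n := 2 * q + 1 + 1) T
          (fun x => (s x ^ 2) • energyForm w (frameSum k q) x)).re + t⁻¹ * V) := by
  obtain ⟨C, hC, h⟩ := exists_mixed_bound_of_isTest k q
  refine ⟨C, hC, fun Ω T hT μ hTμ w s hw hwc hwΩ hs Ψ hΨ t V ht hV hΨV => ?_⟩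
  -- `Ψ` matters only on the support of `w`, where `χ = 1`; replacing it by `χ • Ψ` makes it a test
  -- form on `Ω` and does not increase the integral.
  obtain ⟨χ, h1, h2, h3, h4, h5, h6⟩ := exists_cutoff hwc Ω.isOpen hwΩ
  have hχ : ∀ x ∈ tsupport w, χ x = 1 := fun x hx => h6.self_of_nhdsSet x hx
  have e1 : (fun x => s x • wedge (delFun w x) (Ψ x))
      = fun x => s x • wedge (delFun w x) (χ x • Ψ x) := by
    funext x
    by_cases hx : x ∈ tsupport w
    · rw [hχ x hx, one_smul]
    · rw [delFun_eq_zero hx, zero_wedge, zero_wedge]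
  have e2 : (fun x => s x • wedge (delbarFun w x) (Ψ x))
      = fun x => s x • wedge (delbarFun w x) (χ x • Ψ x) := by
    funext x
    by_cases hx : x ∈ tsupport w
    · rw [hχ x hx, one_smul]
    · rw [delbarFun_eq_zero hx, zero_wedge, zero_wedge]
  rw [e1, e2]
  refine h Ω T hT μ hTμ w s hw hwc hwΩ hs _ (IsTest.cut h1 h2 h3 hΨ) t V ht hV
    (le_trans (lintegral_mono fun x => ?_) hΨV)
  gcongr
  rw [enorm_smul]
  refine mul_le_of_le_one_left (by positivity) ?_
  rw [Real.enorm_eq_ofReal (h4 x)]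
  exact ENNReal.ofReal_le_one.2 (h5 x)

end Mixed

/-! ### Product formulas -/

section Product

variable {k n q : ℕ} {Ω : Opens (CSpace k)}

theorem ofReal_smul_clm {G : Type*} [NormedAddCommGroup G] [NormedSpace ℝ G] [NormedSpace ℂ G]
    [IsScalarTower ℝ ℂ G] (c : ℝ) (a : CSpace k →L[ℝ] G) : (c : ℂ) • a = c • a := by
  ext1 v
  exact ofReal_smul_eq c (a v)

theorem wedge_real_smul_left (c : ℝ) (a : CSpace k →L[ℝ] ℂ) (β : Form k n) :
    wedge (c • a) β = c • wedge a β := by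
  rw [← ofReal_smul_clm, wedge_smul_left, ofReal_smul_eq]

theorem wedge_real_smul_right (c : ℝ) (a : CSpace k →L[ℝ] ℂ) (β : Form k n) :
    wedge a (c • β) = c • wedge a β := by
  rw [← ofReal_smul_eq, wedge_smul_right, ofReal_smul_eq]

/-- The wedge product as a continuous bilinear map. -/
def wedgeCLM : (CSpace k →L[ℝ] ℂ) →L[ℝ] Form k n →L[ℝ] Form k (n + 1) :=
  LinearMap.mkContinuous₂
    (LinearMap.mk₂ ℝ wedge wedge_add_left wedge_real_smul_left wedge_add_right
      wedge_real_smul_right) (n + 1) fun a β => by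
        rw [mul_assoc]
        exact norm_wedge_le a β

theorem dF_eq (f : CSpace k → Form k n) (x : CSpace k) : dF f x = delF f x + delbarF f x := by
  rw [dF, delF, delbarF, ← map_add, linPart_add_antiPart]

theorem fderiv_smul_form {G : CSpace k → ℝ} {φ : CSpace k → Form k n} {x : CSpace k}
    (hG : DifferentiableAt ℝ G x) (hφ : DifferentiableAt ℝ φ x) :
    fderiv ℝ (fun y => G y • φ y) x
      = (G x : ℂ) • fderiv ℝ φ x + (fderiv ℝ (fun y => (G y : ℂ)) x).smulRight (φ x) := by
  rw [fderiv_fun_smul hG hφ, fderiv_ofReal hG]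
  ext1 v
  change G x • fderiv ℝ φ x v + fderiv ℝ G x v • φ x
    = (G x : ℂ) • fderiv ℝ φ x v + ((fderiv ℝ G x v : ℝ) : ℂ) • φ x
  rw [ofReal_smul_eq, ofReal_smul_eq]

theorem linPart_smulRight (a : CSpace k →L[ℝ] ℂ) (β : Form k n) :
    linPart k (Form k n) (a.smulRight β) = (linPart k ℂ a).smulRight β := by
  ext1 v
  simp only [linPart_apply, ContinuousLinearMap.smulRight_apply, smul_eq_mul]
  module

theorem antiPart_smulRight (a : CSpace k →L[ℝ] ℂ) (β : Form k n) :
    antiPart k (Form k n) (a.smulRight β) = (antiPart k ℂ a).smulRight β := by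
  ext1 v
  simp only [antiPart_apply, ContinuousLinearMap.smulRight_apply, smul_eq_mul]
  module

theorem delF_smul {G : CSpace k → ℝ} {φ : CSpace k → Form k n} {x : CSpace k}
    (hG : DifferentiableAt ℝ G x) (hφ : DifferentiableAt ℝ φ x) :
    delF (fun y => G y • φ y) x = G x • delF φ x + wedge (delFun G x) (φ x) := by
  rw [delF, fderiv_smul_form hG hφ, map_add, map_smul, linPart_smulRight, map_add, map_smul,
    ofReal_smul_eq]
  rfl

theorem delbarF_smul {G : CSpace k → ℝ} {φ : CSpace k → Form k n} {x : CSpace k}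
    (hG : DifferentiableAt ℝ G x) (hφ : DifferentiableAt ℝ φ x) :
    delbarF (fun y => G y • φ y) x = G x • delbarF φ x + wedge (delbarFun G x) (φ x) := by
  rw [delbarF, fderiv_smul_form hG hφ, map_add, map_smul, antiPart_smulRight, map_add, map_smul,
    ofReal_smul_eq]
  rfl

theorem dF_smul {G : CSpace k → ℝ} {φ : CSpace k → Form k n} {x : CSpace k}
    (hG : DifferentiableAt ℝ G x) (hφ : DifferentiableAt ℝ φ x) :
    dF (fun y => G y • φ y) x
      = G x • dF φ x + (wedge (delFun G x) (φ x) + wedge (delbarFun G x) (φ x)) := by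
  rw [dF_eq, dF_eq, delF_smul hG hφ, delbarF_smul hG hφ, smul_add]
  abel

theorem delF_add {f g : CSpace k → Form k n} {x : CSpace k} (hf : DifferentiableAt ℝ f x)
    (hg : DifferentiableAt ℝ g x) : delF (fun y => f y + g y) x = delF f x + delF g x := by
  rw [delF, fderiv_fun_add hf hg, map_add, map_add]
  rfl

theorem levi_eq (u : CSpace k → ℝ) (x : CSpace k) :
    levi u x = linPart k (CSpace k →L[ℝ] ℂ) (fderiv ℝ (delbarFun u) x) := rfl

/-- The Leibniz rule; the minus sign is that of `alt_wedge`. With `a = ∂̄G` the first term becomes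
the Levi form of `G`. -/
theorem delF_wedge {a : CSpace k → CSpace k →L[ℝ] ℂ} {φ : CSpace k → Form k n} {x : CSpace k}
    (ha : DifferentiableAt ℝ a x) (hφ : DifferentiableAt ℝ φ x) :
    delF (fun y => wedge (a y) (φ y)) x
      = wedgeBilin (linPart k (CSpace k →L[ℝ] ℂ) (fderiv ℝ a x)) (φ x)
        - wedge (a x) (delF φ x) := by
  have h := ((wedgeCLM (k := k) (n := n)).hasFDerivAt_of_bilinear ha.hasFDerivAt
    hφ.hasFDerivAt).fderiv
  have h' : fderiv ℝ (fun y => wedge (a y) (φ y)) x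
      = wedgeCLM.precompR (CSpace k) (a x) (fderiv ℝ φ x)
        + wedgeCLM.precompL (CSpace k) (fderiv ℝ a x) (φ x) := h
  rw [delF, h', map_add, map_add]
  have h1 : alt k (n + 1) (linPart k (Form k (n + 1))
      (wedgeCLM.precompR (CSpace k) (a x) (fderiv ℝ φ x))) = -wedge (a x) (delF φ x) := by
    refine alt_wedge (a x) (linPart k (Form k n) (fderiv ℝ φ x)) _ fun v => ?_
    rw [linPart_apply, linPart_apply, wedge_smul_right, ← wedgeL_apply, map_sub, LinearMap.map_smul]
    rfl
  have h2 : wedgeBilin (linPart k (CSpace k →L[ℝ] ℂ) (fderiv ℝ a x)) (φ x)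
      = alt k (n + 1) (linPart k (Form k (n + 1))
        (wedgeCLM.precompL (CSpace k) (fderiv ℝ a x) (φ x))) := by
    refine wedgeBilin_apply _ _ _ fun v => ?_
    rw [linPart_apply, linPart_apply, wedge_smul_left, ← wedgeL_apply, map_sub, LinearMap.map_smul]
    rfl
  rw [h1, h2]
  abel

/-- The product formula for `∂∂̄`. -/
theorem delF_delbarF_smul {G : CSpace k → ℝ} {φ : CSpace k → Form k n} (hG : ContDiff ℝ ∞ G)
    (hφ : ContDiff ℝ ∞ φ) (x : CSpace k) :
    delF (delbarF fun y => G y • φ y) x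
      = G x • delF (delbarF φ) x + wedge (delFun G x) (delbarF φ x)
        - wedge (delbarFun G x) (delF φ x) + wedgeBilin (levi G x) (φ x) := by
  have dG := hG.differentiable (by simp)
  have dφ := hφ.differentiable (by simp)
  have dbφ : Differentiable ℝ (delbarF φ) := by
    have h1 : ContDiff ℝ ∞ fun y =>
        (((alt k n).comp (antiPart k (Form k n))).restrictScalars ℝ) (fderiv ℝ φ y) :=
      (((alt k n).comp (antiPart k (Form k n))).restrictScalars ℝ).contDiff.comp
        (hφ.fderiv_right (m := ∞) (by simp))
    exact h1.differentiable (by simp)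
  have dbG : Differentiable ℝ (delbarFun G) := (contDiff_delbarFun hG).differentiable (by simp)
  have h1 : (delbarF fun y => G y • φ y)
      = fun y => G y • delbarF φ y + wedge (delbarFun G y) (φ y) :=
    funext fun y => delbarF_smul (dG y) (dφ y)
  rw [h1, delF_add (f := fun y => G y • delbarF φ y) ((dG x).smul (dbφ x)) ((contDiff_wedge (contDiff_delbarFun hG) hφ).differentiable
    (by simp) x), delF_smul (dG x) (dbφ x), delF_wedge (dbG x) (dφ x), levi_eq]
  abel

/-! ### Types of derivatives -/

/-- The identity defining the type is differentiated in `x` with the vectors held fixed. Where `f`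
is not differentiable its derivative is zero by convention, and zero has every type. -/
theorem isOfType_fderiv {a b : ℕ} {f : CSpace k → Form k n} (hf : ∀ x, IsOfType a b (f x))
    (x v : CSpace k) : IsOfType a b (fderiv ℝ f x v) := by
  by_cases hd : DifferentiableAt ℝ f x
  · intro c vs
    have h1 : ∀ ws : Fin n → CSpace k,
        HasFDerivAt (fun y => f y ws)
          ((ContinuousAlternatingMap.apply ℝ (CSpace k) ℂ ws).comp (fderiv ℝ f x)) x := fun ws =>
      (ContinuousAlternatingMap.apply ℝ (CSpace k) ℂ ws).hasFDerivAt.comp x hd.hasFDerivAt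
    have h2 := (h1 vs).const_mul (c ^ a * starRingEnd ℂ c ^ b)
    have h3 : (fun y => f y fun j => c • vs j)
        = fun y => c ^ a * starRingEnd ℂ c ^ b * f y vs := funext fun y => hf y c vs
    have h4 := (h1 fun j => c • vs j)
    rw [h3] at h4
    exact congrArg (fun L => L v) (h4.unique h2)
  · rw [fderiv_zero_of_not_differentiableAt hd]
    intro c vs
    simp

theorem isOfType_delF {a b : ℕ} {f : CSpace k → Form k n} (hf : ∀ x, IsOfType a b (f x))
    (x : CSpace k) : IsOfType (a + 1) b (delF f x) := by
  refine IsOfType.alt_lin (fun v => ?_) (linPart_smul_apply _)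
  rw [linPart_apply, sub_eq_add_neg, ← neg_smul]
  exact ((isOfType_fderiv hf x v).add ((isOfType_fderiv hf x _).smul _)).smul _

theorem isOfType_delbarF {a b : ℕ} {f : CSpace k → Form k n} (hf : ∀ x, IsOfType a b (f x))
    (x : CSpace k) : IsOfType a (b + 1) (delbarF f x) := by
  refine IsOfType.alt_anti (fun v => ?_) (antiPart_smul_apply _)
  rw [antiPart_apply]
  exact ((isOfType_fderiv hf x v).add ((isOfType_fderiv hf x _).smul _)).smul _

/-! ### Composition with a function of one real variable -/

theorem fderiv_ofReal_comp {h : ℝ → ℝ} {w : CSpace k → ℝ} (hh : Differentiable ℝ h)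
    (hw : Differentiable ℝ w) (x : CSpace k) :
    fderiv ℝ (fun y => (h (w y) : ℂ)) x
      = ((deriv h (w x) : ℝ) : ℂ) • fderiv ℝ (fun y => (w y : ℂ)) x := by
  have h1 : HasFDerivAt (fun y => h (w y)) (deriv h (w x) • fderiv ℝ w x) x :=
    ((hh (w x)).hasDerivAt).comp_hasFDerivAt x (hw x).hasFDerivAt
  have h2 : DifferentiableAt ℝ (fun y => h (w y)) x := h1.differentiableAt
  rw [fderiv_ofReal h2, h1.fderiv, fderiv_ofReal (hw x)]
  ext v
  simp

theorem delFun_comp {h : ℝ → ℝ} {w : CSpace k → ℝ} (hh : Differentiable ℝ h)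
    (hw : Differentiable ℝ w) (x : CSpace k) :
    delFun (fun y => h (w y)) x = deriv h (w x) • delFun w x := by
  rw [delFun, fderiv_ofReal_comp hh hw, map_smul, ofReal_smul_clm]
  rfl

theorem delbarFun_comp {h : ℝ → ℝ} {w : CSpace k → ℝ} (hh : Differentiable ℝ h)
    (hw : Differentiable ℝ w) (x : CSpace k) :
    delbarFun (fun y => h (w y)) x = deriv h (w x) • delbarFun w x := by
  rw [delbarFun, fderiv_ofReal_comp hh hw, map_smul, ofReal_smul_clm]
  rfl

theorem levi_comp {h : ℝ → ℝ} {w : CSpace k → ℝ} (hh : ContDiff ℝ ∞ h) (hw : ContDiff ℝ ∞ w)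
    (x : CSpace k) :
    levi (fun y => h (w y)) x = ((deriv h (w x) : ℝ) : ℂ) • levi w x
      + ((deriv (deriv h) (w x) : ℝ) : ℂ) • (delFun w x).smulRight (delbarFun w x) := by
  have dh := hh.differentiable (by simp)
  have dw := hw.differentiable (by simp)
  have hh' : ContDiff ℝ ∞ (deriv h) := ContDiff.deriv' (hh.of_le (by simp))
  have dh' : Differentiable ℝ (deriv h) := hh'.differentiable (by simp)
  have dbw : Differentiable ℝ (delbarFun w) := (contDiff_delbarFun hw).differentiable (by simp)
  have h1 : delbarFun (fun y => h (w y)) = fun y => deriv h (w y) • delbarFun w y :=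
    funext fun y => delbarFun_comp dh dw y
  have h2 : DifferentiableAt ℝ (fun y => deriv h (w y)) x := (dh'.comp dw) x
  rw [levi_eq, h1, fderiv_fun_smul h2 (dbw x)]
  have h3 : (fderiv ℝ (fun y => deriv h (w y)) x)
      = deriv (deriv h) (w x) • fderiv ℝ w x :=
    (((dh' (w x)).hasDerivAt).comp_hasFDerivAt x (dw x).hasFDerivAt).fderiv
  rw [h3, map_add, levi_eq]
  congr 1
  · rw [← map_smul, ofReal_smul_clm]
  · ext1 v
    rw [linPart_apply, delFun, fderiv_ofReal (dw x)]
    ext1 u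
    simp [linPart_apply]
    ring

/-- The term in `h''` is the energy of `w`. Taking `h` exponential with a large rate is what makes
it dominate. -/
theorem iddbarWedge_comp {h : ℝ → ℝ} {w : CSpace k → ℝ} (hh : ContDiff ℝ ∞ h)
    (hw : ContDiff ℝ ∞ w) (x : CSpace k) (β : Form k n) :
    iddbarWedge (fun y => h (w y)) x β
      = deriv h (w x) • iddbarWedge w x β + deriv (deriv h) (w x) • energyForm w β x := by
  rw [iddbarWedge, levi_comp hh hw, wedgeBilin_add, wedgeBilin_smul, wedgeBilin_smul,
    wedgeBilin_smulRight, smul_add, smul_comm Complex.I, smul_comm Complex.I,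
    delbarFun_eq (hw.differentiable (by simp) x), ofReal_smul_eq, ofReal_smul_eq]
  rfl

end Product

/-! ### Complex Hessian -/

section Hessian

open MeasureTheory ContinuousLinearMap

variable {k n q : ℕ} {Ω : Opens (CSpace k)}

/-- The map which sends the second derivative of a function to its complex Hessian. -/
def leviOf (D : CSpace k →L[ℝ] CSpace k →L[ℝ] ℝ) : CSpace k →L[ℝ] CSpace k →L[ℝ] ℂ :=
  linPart k (CSpace k →L[ℝ] ℂ) ((((antiPart k ℂ).restrictScalars ℝ).comp
    (compL ℝ (CSpace k) ℝ ℂ Complex.ofRealCLM)).comp D)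

theorem leviOf_sub (D D' : CSpace k →L[ℝ] CSpace k →L[ℝ] ℝ) :
    leviOf (D - D') = leviOf D - leviOf D' := by
  rw [leviOf, ContinuousLinearMap.comp_sub]
  exact (linPart k (CSpace k →L[ℝ] ℂ)).map_sub _ _

section Norms

variable {G : Type*} [NormedAddCommGroup G] [NormedSpace ℝ G] [NormedSpace ℂ G]
  [IsScalarTower ℝ ℂ G]

theorem norm_linPart_le (A : CSpace k →L[ℝ] G) : ‖linPart k G A‖ ≤ ‖A‖ := by
  refine ContinuousLinearMap.opNorm_le_bound _ (norm_nonneg _) fun v => ?_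
  rw [linPart_apply, norm_smul]
  have h1 := A.le_opNorm v
  have h2 := A.le_opNorm (Complex.I • v)
  have h3 := norm_sub_le (A v) (Complex.I • A (Complex.I • v))
  rw [norm_smul Complex.I (A _), Complex.norm_I, one_mul] at h3
  rw [norm_smul, Complex.norm_I, one_mul] at h2
  norm_num
  linarith

theorem norm_antiPart_le (A : CSpace k →L[ℝ] G) : ‖antiPart k G A‖ ≤ ‖A‖ := by
  refine ContinuousLinearMap.opNorm_le_bound _ (norm_nonneg _) fun v => ?_
  rw [antiPart_apply, norm_smul]
  have h1 := A.le_opNorm v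
  have h2 := A.le_opNorm (Complex.I • v)
  have h3 := norm_add_le (A v) (Complex.I • A (Complex.I • v))
  rw [norm_smul Complex.I (A _), Complex.norm_I, one_mul] at h3
  rw [norm_smul, Complex.norm_I, one_mul] at h2
  norm_num
  linarith

end Norms

theorem norm_leviOf_le (D : CSpace k →L[ℝ] CSpace k →L[ℝ] ℝ) : ‖leviOf D‖ ≤ ‖D‖ := by
  refine (norm_linPart_le _).trans ?_
  refine ContinuousLinearMap.opNorm_le_bound _ (norm_nonneg D) fun v => ?_
  refine (norm_antiPart_le (Complex.ofRealCLM.comp (D v))).trans ?_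
  refine le_trans (ContinuousLinearMap.opNorm_le_bound _ (norm_nonneg _) fun w => ?_)
    (D.le_opNorm v)
  change ‖((D v w : ℝ) : ℂ)‖ ≤ _
  rw [Complex.norm_real]
  exact (D v).le_opNorm w

theorem levi_eq_leviOf {u : CSpace k → ℝ} {x : CSpace k} (hu : ContDiffAt ℝ 2 u x) :
    levi u x = leviOf (fderiv ℝ (fderiv ℝ u) x) := by
  have h1 : delbarFun u =ᶠ[𝓝 x] fun y => (((antiPart k ℂ).restrictScalars ℝ).comp
      (compL ℝ (CSpace k) ℝ ℂ Complex.ofRealCLM)) (fderiv ℝ u y) := by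
    filter_upwards [hu.eventually (by simp)] with y hy
    rw [delbarFun, fderiv_ofReal (hy.differentiableAt (by norm_num))]
    rfl
  have h2 : DifferentiableAt ℝ (fderiv ℝ u) x :=
    (hu.fderiv_right (m := 1) (by norm_num)).differentiableAt one_ne_zero
  rw [levi_eq, h1.fderiv_eq]
  have h3 := ((((antiPart k ℂ).restrictScalars ℝ).comp
      (compL ℝ (CSpace k) ℝ ℂ Complex.ofRealCLM)).hasFDerivAt.comp x h2.hasFDerivAt).fderiv
  have h4 : fderiv ℝ (fun y => (((antiPart k ℂ).restrictScalars ℝ).comp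
      (compL ℝ (CSpace k) ℝ ℂ Complex.ofRealCLM)) (fderiv ℝ u y)) x = _ := h3
  rw [h4]
  rfl

theorem norm_wedgeBilin_le (B : CSpace k →L[ℝ] CSpace k →L[ℝ] ℂ) (β : Form k n) :
    ‖wedgeBilin B β‖ ≤ (n + 2) * (n + 1) * ‖B‖ * ‖β‖ := by
  let C : CSpace k →L[ℝ] Form k (n + 1) := (wedgeCLM.flip β).comp B
  rw [wedgeBilin_apply B β C fun v => rfl]
  refine (ContinuousAlternatingMap.norm_alternatizeUncurryFin_le _).trans ?_
  have hC : ‖C‖ ≤ (n + 1) * ‖B‖ * ‖β‖ := by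
    refine ContinuousLinearMap.opNorm_le_bound _ (by positivity) fun v => ?_
    refine (norm_wedge_le (B v) β).trans ?_
    calc ((n : ℝ) + 1) * (‖B v‖ * ‖β‖) ≤ (n + 1) * (‖B‖ * ‖v‖ * ‖β‖) := by
          gcongr
          exact B.le_opNorm v
      _ = (n + 1) * ‖B‖ * ‖β‖ * ‖v‖ := by ring
  calc (((n + 1 : ℕ) : ℝ) + 1) * ‖C‖ ≤ (((n + 1 : ℕ) : ℝ) + 1) * ((n + 1) * ‖B‖ * ‖β‖) := by gcongr
    _ = (n + 2) * (n + 1) * ‖B‖ * ‖β‖ := by push_cast; ring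

/-- The Levi form depends linearly on the second derivative, with norm at most one; hence functions
that are `C²`-close can replace one another in estimates. -/
theorem norm_iddbarWedge_sub_le {u v : CSpace k → ℝ} {x : CSpace k} (hu : ContDiffAt ℝ 2 u x)
    (hv : ContDiffAt ℝ 2 v x) (β : Form k n) :
    ‖iddbarWedge u x β - iddbarWedge v x β‖
      ≤ (n + 2) * (n + 1) * ‖fderiv ℝ (fderiv ℝ u) x - fderiv ℝ (fderiv ℝ v) x‖ * ‖β‖ := by
  have h : iddbarWedge u x β - iddbarWedge v x β = Complex.I •
      wedgeBilin (leviOf (fderiv ℝ (fderiv ℝ u) x - fderiv ℝ (fderiv ℝ v) x)) β := by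
    have h1 := wedgeBilin_add (leviOf (fderiv ℝ (fderiv ℝ u) x - fderiv ℝ (fderiv ℝ v) x))
      (leviOf (fderiv ℝ (fderiv ℝ v) x)) β
    have h2 : leviOf (fderiv ℝ (fderiv ℝ u) x - fderiv ℝ (fderiv ℝ v) x)
        + leviOf (fderiv ℝ (fderiv ℝ v) x) = leviOf (fderiv ℝ (fderiv ℝ u) x) := by
      rw [leviOf_sub]
      exact sub_add_cancel (leviOf (fderiv ℝ (fderiv ℝ u) x)) (leviOf (fderiv ℝ (fderiv ℝ v) x))
    rw [h2] at h1
    rw [iddbarWedge, iddbarWedge, levi_eq_leviOf hu, levi_eq_leviOf hv, h1, smul_add,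
      add_sub_cancel_right]
  rw [h, norm_smul, Complex.norm_I, one_mul]
  refine (norm_wedgeBilin_le _ _).trans ?_
  gcongr
  exact norm_leviOf_le _

theorem contDiff_iddbarWedge {w : CSpace k → ℝ} {φ : CSpace k → Form k n} (hw : ContDiff ℝ ∞ w)
    (hφ : ContDiff ℝ ∞ φ) : ContDiff ℝ ∞ (fun x => iddbarWedge w x (φ x)) := by
  have h1 : ContDiff ℝ ∞ (levi w) :=
    ((linPart k (CSpace k →L[ℝ] ℂ)).restrictScalars ℝ).contDiff.comp
      ((contDiff_delbarFun hw).fderiv_right (m := ∞) (by simp))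
  have h2 : ContDiff ℝ ∞ fun x => (wedgeCLM.flip (φ x)).comp (levi w x) := by
    fun_prop
  have h3 : ContDiff ℝ ∞ fun x => wedgeBilin (levi w x) (φ x) := by
    have h4 : (fun x => wedgeBilin (levi w x) (φ x))
        = fun x => alt k (n + 1) ((wedgeCLM.flip (φ x)).comp (levi w x)) :=
      funext fun x => wedgeBilin_apply _ _ _ fun v => rfl
    rw [h4]
    exact ((alt k (n + 1)).restrictScalars ℝ).contDiff.comp h2
  exact h3.const_smul Complex.I

theorem levi_eq_zero {w : CSpace k → ℝ} {x : CSpace k} (hx : x ∉ tsupport w) : levi w x = 0 := by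
  have h1 : delbarFun w =ᶠ[𝓝 x] fun _ => 0 := by
    filter_upwards [(isClosed_tsupport w).isOpen_compl.mem_nhds hx] with y hy
    exact delbarFun_eq_zero hy
  rw [levi_eq, h1.fderiv_eq, fderiv_fun_const]
  exact map_zero _

theorem zero_wedgeBilin (β : Form k n) : wedgeBilin 0 β = 0 := by
  rw [wedgeBilin_apply 0 β 0 fun v => (zero_wedge β).symm, map_zero]

theorem wedgeBilin_zero (B : CSpace k →L[ℝ] CSpace k →L[ℝ] ℂ) :
    wedgeBilin B (0 : Form k n) = 0 := by
  rw [← zero_smul ℂ (0 : Form k n), wedgeBilin_smul_right, zero_smul]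

theorem iddbarWedge_eq_zero {w : CSpace k → ℝ} {x : CSpace k} (hx : x ∉ tsupport w)
    (β : Form k n) : iddbarWedge w x β = 0 := by
  rw [iddbarWedge, levi_eq_zero hx, zero_wedgeBilin, smul_zero]

theorem iddbarWedge_zero (w : CSpace k → ℝ) (x : CSpace k) :
    iddbarWedge w x (0 : Form k n) = 0 := by
  rw [iddbarWedge, wedgeBilin_zero, smul_zero]

theorem iddbarWedge_real_smul (w : CSpace k → ℝ) (x : CSpace k) (c : ℝ) (β : Form k n) :
    iddbarWedge w x (c • β) = c • iddbarWedge w x β := by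
  rw [iddbarWedge, iddbarWedge, ← ofReal_smul_eq, wedgeBilin_smul_right, smul_comm, ofReal_smul_eq]

theorem iddbarWedge_congr {u w : CSpace k → ℝ} {x : CSpace k} (h : u =ᶠ[𝓝 x] w) (β : Form k n) :
    iddbarWedge u x β = iddbarWedge w x β := by
  have h1 : delbarFun u =ᶠ[𝓝 x] delbarFun w := by
    filter_upwards [h.eventuallyEq_nhds] with y hy
    have : (fun z => (u z : ℂ)) =ᶠ[𝓝 y] fun z => (w z : ℂ) := hy.fun_comp (fun t : ℝ => (t : ℂ))
    rw [delbarFun, delbarFun, this.fderiv_eq]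
  rw [iddbarWedge, iddbarWedge, levi_eq, levi_eq, h1.fderiv_eq]

theorem IsCutoff.isTest_iddbarWedge {w : CSpace k → ℝ} (hw : IsCutoff Ω w)
    {φ : CSpace k → Form k n} (hφ : ContDiff ℝ ∞ φ) :
    IsTest Ω (fun x => iddbarWedge w x (φ x)) :=
  .of_eq_zero (contDiff_iddbarWedge hw.smooth hφ) hw.compact hw.subset
    fun x hx => iddbarWedge_eq_zero hx (φ x)

end Hessian

/-! ### Approximating sequences -/

section Approximation

open MeasureTheory

variable {k n q : ℕ} {Ω U : Opens (CSpace k)} {P : Set (CSpace k → ℝ)} {F : Set (CSpace k)}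
  {hF : IsClosed ((↑) ⁻¹' F : Set U)}

/-- The functions of the cone are only `C²`, so `g` is replaced by a smooth `w` close to it in `C²`.
Directedness of `f` gives a limit `c ≥ 0` along smooth forms converging uniformly; these are built
from approximants `v j` of `g`, with `C²` error `1/(j+1)`. Comparing `w` with `v j` costs at most a
multiple of `(δ + 1/(j+1)) μ B`. -/
theorem IsPDirected.exists_cutoff_approx {T : Current Ω (2 * (q + 1))} (hTP : IsPDirected P T)
    {μ : Measure (CSpace k)} (hTμ : IsDominated T μ) {f g : CSpace k → ℝ} (hf : f ∈ P)
    (hg : ContDiff ℝ 2 g) (hgc : HasCompactSupport g) (hgΩ : tsupport g ⊆ Ω)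
    (hg0 : ∀ x, 0 ≤ g x) (hg1 : ∀ x, g x ≤ 1) {B : Set (CSpace k)}
    (hfg : ∀ x ∈ B, f =ᶠ[𝓝 x] g) (hμB : μ B < ⊤) {ε : ℝ} (hε : 0 < ε) :
    ∃ w : CSpace k → ℝ, IsCutoff Ω w ∧ (∀ x, |w x - g x| ≤ ε) ∧
      ∀ φ : CSpace k → Form k (2 * q), ContDiff ℝ ∞ φ → (∀ x, φ x ∈ stronglyPositive k q) →
        tsupport φ ⊆ B → ∀ M : ℝ, (∀ x, ‖φ x‖ ≤ M) →
        ∃ c : ℝ, 0 ≤ c ∧ ‖ev (n := 2 * q + 1 + 1) T (fun x => iddbarWedge w x (φ x)) - c‖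
          ≤ M * ε := by
  set m : ℝ := (μ B).toReal with hm
  have hm0 : 0 ≤ m := ENNReal.toReal_nonneg
  -- The constant of `norm_iddbarWedge_sub_le` in degree `2q`.
  obtain ⟨C, hC⟩ : ∃ C : ℝ, C = (((2 * q : ℕ) : ℝ) + 2) * (((2 * q : ℕ) : ℝ) + 1) := ⟨_, rfl⟩
  have hC0 : 0 < C := by rw [hC]; positivity
  -- So that `C δ m ≤ ε`; `m + 1` replaces `m`, which may be zero.
  set δ : ℝ := min ε (ε / (C * (m + 1))) with hδ
  have hδ0 : 0 < δ := lt_min hε (by positivity)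
  have hδm : C * δ * m ≤ ε := by
    have h1 : δ ≤ ε / (C * (m + 1)) := min_le_right _ _
    rw [le_div_iff₀ (by positivity)] at h1
    nlinarith [mul_pos hC0 hδ0]
  obtain ⟨w, w1, w2, w3, w4, w5, w6, w7⟩ :=
    exists_smooth_approx Ω.isOpen hg hgc hgΩ hg0 hg1 hδ0
  have hw : IsCutoff Ω w := ⟨w1, w2, w3, w4, w5⟩
  refine ⟨w, hw, fun x => (w6 x).trans (min_le_left _ _), ?_⟩
  intro φ hφ hpos hφB M hM
  have hM0 : 0 ≤ M := (norm_nonneg _).trans (hM 0)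
  choose v v1 v2 v3 v4 v5 v6 v7 using fun j : ℕ =>
    exists_smooth_approx Ω.isOpen hg hgc hgΩ hg0 hg1 (ε := 1 / ((j : ℝ) + 1)) (by positivity)
  have hv : ∀ j, IsCutoff Ω (v j) := fun j => ⟨v1 j, v2 j, v3 j, v4 j, v5 j⟩
  obtain ⟨χ, h1, h2, h3, h4, h5, h6⟩ := exists_cutoff w2 Ω.isOpen w3
  have hχ : ∀ x ∈ tsupport w, χ x = 1 := fun x hx => h6.self_of_nhdsSet x hx
  -- `φ` need not be supported in `Ω`. As `χ = 1` on the support of `w`, multiplication by `χ`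
  -- changes nothing there and keeps the form strongly positive.
  let φ' : CSpace k → Form k (2 * q) := fun x => χ x • φ x
  have tφ' : IsTest Ω φ' := IsTest.cut h1 h2 h3 hφ
  have hφ'M : ∀ x, ‖φ' x‖ ≤ M := fun x => by
    change ‖χ x • φ x‖ ≤ M
    rw [norm_smul, Real.norm_of_nonneg (h4 x)]
    exact (mul_le_of_le_one_left (norm_nonneg _) (h5 x)).trans (hM x)
  have hφ'B : tsupport φ' ⊆ B := (tsupport_subset_of_zero fun x hx => by
    change χ x • φ x = 0
    rw [hx, smul_zero]).trans hφB
  have hwφ : (fun x => iddbarWedge w x (φ x)) = fun x => iddbarWedge w x (φ' x) := by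
    funext x
    by_cases hx : x ∈ tsupport w
    · change _ = iddbarWedge w x (χ x • φ x)
      rw [hχ x hx, one_smul]
    · rw [iddbarWedge_eq_zero hx, iddbarWedge_eq_zero hx]
  rw [hwφ]
  have hsm : ∀ {h : CSpace k → ℝ}, ContDiff ℝ ∞ h → ∀ x, ContDiffAt ℝ 2 h x := fun hh x =>
    (contDiff_infty.1 hh 2).contDiffAt
  have hdiff : ∀ {h : CSpace k → ℝ} {η : ℝ}, ContDiff ℝ ∞ h → 0 ≤ η →
      (∀ x, ‖fderiv ℝ (fderiv ℝ h) x - fderiv ℝ (fderiv ℝ g) x‖ ≤ η) →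
      ∀ x, ‖iddbarWedge h x (φ' x) - iddbarWedge g x (φ' x)‖ ≤ C * η * M := by
    intro h η hh hη hη' x
    refine (norm_iddbarWedge_sub_le (hsm hh x) hg.contDiffAt (φ' x)).trans ?_
    rw [← hC]
    have h1 := hη' x
    have h2 := hφ'M x
    gcongr
  obtain ⟨c, hc, hpair⟩ := hTP f hf tφ'.toTest fun x =>
    smul_mem_stronglyPositive (h4 x) (hpos x)
  refine ⟨c, hc, ?_⟩
  have tψ : ∀ j, IsTest Ω (fun x => iddbarWedge (v j) x (φ' x)) := fun j =>
    (hv j).isTest_iddbarWedge tφ'.smooth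
  have hlim := hpair (fun j => (tψ j).toTest) (tsupport φ') tφ'.compact tφ'.subset
    (fun j => tsupport_subset_of_zero fun x hx => by
      change iddbarWedge (v j) x (φ' x) = 0
      rw [hx, iddbarWedge_zero]) ?_
  · have hlim' : Tendsto (fun j => ev (n := 2 * q + 1 + 1) T
        (fun x => iddbarWedge (v j) x (φ' x))) atTop (𝓝 c) :=
      hlim.congr fun j => (ev_of_isTest (n := 2 * q + 1 + 1) T (tψ j)).symm
    have hb : ∀ j, ‖ev (n := 2 * q + 1 + 1) T (fun x => iddbarWedge w x (φ' x))
        - ev (n := 2 * q + 1 + 1) T (fun x => iddbarWedge (v j) x (φ' x))‖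
        ≤ (C * δ * M + C * (1 / ((j : ℝ) + 1)) * M) * m := by
      intro j
      rw [← ev_sub (n := 2 * q + 1 + 1) T (hw.isTest_iddbarWedge tφ'.smooth) (tψ j)]
      have hsup : tsupport (fun x => iddbarWedge w x (φ' x) - iddbarWedge (v j) x (φ' x)) ⊆ B :=
        (tsupport_subset_of_zero fun x hx => by
          rw [hx, iddbarWedge_zero, iddbarWedge_zero, sub_zero]).trans hφ'B
      have h0 : 0 ≤ C * δ * M + C * (1 / ((j : ℝ) + 1)) * M := by positivity
      have := (hTμ _).trans (lintegral_enorm_le (μ := μ) hsup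
        (C := C * δ * M + C * (1 / ((j : ℝ) + 1)) * M) fun x => by
          have e1 := hdiff w1 hδ0.le w7 x
          have e2 := hdiff (v1 j) (by positivity) (v7 j) x
          rw [norm_sub_rev] at e2
          exact (norm_sub_le_norm_sub_add_norm_sub _ (iddbarWedge g x (φ' x)) _).trans
            (add_le_add e1 e2))
      rw [← ofReal_norm, ← ENNReal.ofReal_toReal hμB.ne, ← ENNReal.ofReal_mul h0,
        ENNReal.ofReal_le_ofReal_iff (by positivity)] at this
      exact this
    have hl : Tendsto (fun j : ℕ => (C * δ * M + C * (1 / ((j : ℝ) + 1)) * M) * m) atTop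
        (𝓝 ((C * δ * M + C * 0 * M) * m)) :=
      ((tendsto_const_nhds.add ((tendsto_const_nhds.mul
        tendsto_one_div_add_atTop_nhds_zero_nat).mul_const M)).mul_const m)
    have h9 := le_of_tendsto_of_tendsto (tendsto_const_nhds.sub hlim').norm hl
      (Filter.Eventually.of_forall hb)
    refine h9.trans ?_
    nlinarith
  · have hz : Tendsto (fun j : ℕ => C * (1 / ((j : ℝ) + 1)) * M) atTop (𝓝 (C * 0 * M)) :=
      (tendsto_const_nhds.mul tendsto_one_div_add_atTop_nhds_zero_nat).mul_const M
    rw [mul_zero, zero_mul] at hz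
    rw [Metric.tendstoUniformly_iff]
    intro η hη
    filter_upwards [hz.eventually (gt_mem_nhds hη)] with j hj x
    refine lt_of_le_of_lt ?_ hj
    change dist (iddbarWedge f x (φ' x)) (iddbarWedge (v j) x (φ' x)) ≤ _
    by_cases hx : x ∈ tsupport φ'
    · rw [iddbarWedge_congr (hfg x (hφ'B hx)), dist_comm, dist_eq_norm]
      exact hdiff (v1 j) (by positivity) (v7 j) x
    · rw [IsTest.eq_zero hx, iddbarWedge_zero, iddbarWedge_zero, dist_self]
      positivity

theorem contDiff_of_forall_mem_tsupport {f : CSpace k → ℝ} {m : ℕ∞ω}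
    (h : ∀ x ∈ tsupport f, ContDiffAt ℝ m f x) : ContDiff ℝ m f :=
  contDiff_iff_contDiffAt.2 fun x => by
    by_cases hx : x ∈ tsupport f
    · exact h x hx
    · exact contDiffAt_const.congr_of_eventuallyEq (notMem_tsupport_iff_eventuallyEq.1 hx)

/-- A Dini argument: the sets `{u j < t}` are open, increase with `j` and cover `K`, so one of them
contains `K`. -/
theorem exists_index_lt {V K : Set (CSpace k)} (hV : IsOpen V) (hK : IsCompact K)
    (hKV : K ⊆ V) {u : ℕ → CSpace k → ℝ} (hu : ∀ j, ContinuousOn (u j) V)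
    (hanti : ∀ x ∈ V, Antitone fun j => u j x)
    (hlim : ∀ x ∈ K, Tendsto (fun j => ((u j x : ℝ) : EReal)) atTop (𝓝 ⊥)) (t : ℝ) :
    ∃ j, ∀ x ∈ K, u j x < t := by
  have ho : ∀ j, IsOpen {x ∈ V | u j x < t} := fun j =>
    (hu j).isOpen_inter_preimage hV isOpen_Iio
  obtain ⟨j, hj⟩ := hK.elim_directed_cover (fun j => {x ∈ V | u j x < t}) ho (fun x hx => by
    obtain ⟨j, hj⟩ := ((hlim x hx).eventually (gt_mem_nhds (EReal.bot_lt_coe t))).exists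
    exact Set.mem_iUnion.2 ⟨j, hKV hx, EReal.coe_lt_coe_iff.1 hj⟩)
    (directed_of_isDirected_le fun i j hij x hx => ⟨hx.1, (hanti x hx.1 hij).trans_lt hx.2⟩)
  exact ⟨j, fun x hx => (hj hx).2⟩

/-- A sequence of cut-off functions of `U \ F` on the ball of centre `a` and radius `r`, which tends
to one off `F` and is almost directed for `T`. -/
structure IsApproxSequence (T : Current (sdiffOpens U F hF) (2 * (q + 1))) (a : CSpace k) (r : ℝ)
    (w : ℕ → CSpace k → ℝ) : Prop where
  pos : 0 < r
  subset : Metric.closedBall a r ⊆ U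
  isCutoff : ∀ n, IsCutoff (sdiffOpens U F hF) (w n)
  tendsto : ∀ x ∈ Metric.closedBall a r, x ∉ F → Tendsto (fun n => w n x) atTop (𝓝 1)
  directed : ∀ n, ∀ φ : CSpace k → Form k (2 * q), ContDiff ℝ ∞ φ →
    (∀ x, φ x ∈ stronglyPositive k q) → tsupport φ ⊆ Metric.closedBall a r →
    ∀ M : ℝ, (∀ x, ‖φ x‖ ≤ M) →
    ∃ c : ℝ, 0 ≤ c ∧ ‖ev (n := 2 * q + 1 + 1) T (fun x => iddbarWedge (w n) x (φ x)) - c‖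
      ≤ M * (1 / ((n : ℝ) + 1))

/-- On a ball where all `u j ≤ M`, take `f n = H(1 + (u (j n) - M)/(n+1))`, an element of the cone
with values in `[0,1]`. If `j n` is large enough, the argument of `H` is negative near `F`, so `f n`
vanishes there. Off `F` the `u j` are bounded below by a finite value of `v`, so the argument tends
to one. Cutting off and smoothing then give `w n`. -/
theorem exists_isApproxSequence (hP : IsAdmissibleCone U P)
    (hFP : IsLocallyCompletePluripolar P U F) {T : Current (sdiffOpens U F hF) (2 * (q + 1))}
    (hTP : IsPDirected P T) {μ : Measure (CSpace k)} (hTμ : IsDominated T μ)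
    (hμ : IsFiniteNear U μ) {a : CSpace k} (ha : a ∈ F) :
    ∃ r w, IsApproxSequence T a r w := by
  obtain ⟨V, hV, haV, hVU, v, ⟨u, huP, hanti, hlim⟩, -, hFV⟩ := hFP a ha
  obtain ⟨R, hR, hRV⟩ := Metric.nhds_basis_closedBall.mem_iff.1 (hV.mem_nhds haV)
  have hr : 0 < R / 2 := half_pos hR
  have hrR : Metric.closedBall a (R / 2) ⊆ Metric.ball a R :=
    Metric.closedBall_subset_ball (half_lt_self hR)
  have hrV : Metric.closedBall a (R / 2) ⊆ V :=
    hrR.trans (Metric.ball_subset_closedBall.trans hRV)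
  have hK : IsCompact (Metric.closedBall a R) := isCompact_closedBall a R
  have huc : ∀ j, ContinuousOn (u j) V := fun j =>
    (hP.contDiffOn _ (huP j)).continuousOn.mono hVU
  obtain ⟨M, hM⟩ := hK.exists_bound_of_continuousOn ((huc 0).mono hRV)
  have hM' : ∀ j, ∀ x ∈ Metric.closedBall a R, u j x ≤ M := fun j x hx =>
    (hanti x (hRV hx) (Nat.zero_le j)).trans ((le_abs_self _).trans (hM x hx))
  -- The part of `F` in the ball, written with the complement of the open set `U \ F` because `F`
  -- need not be closed in the whole space.
  have hKF : IsCompact (Metric.closedBall a R ∩ (sdiffOpens U F hF : Set (CSpace k))ᶜ) :=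
    hK.inter_right (sdiffOpens U F hF).isOpen.isClosed_compl
  have hmemF : ∀ x ∈ Metric.closedBall a R ∩ (sdiffOpens U F hF : Set (CSpace k))ᶜ, x ∈ F :=
    fun x hx => by
      by_contra h
      exact hx.2 ⟨hVU (hRV hx.1), h⟩
  -- The level `M - (n+1)` is where the argument of `H` changes sign.
  choose j hj using fun n : ℕ => exists_index_lt hV hKF (Set.inter_subset_left.trans hRV) huc hanti
    (fun x hx => by
      have h1 : x ∈ {x ∈ V | v x = ⊥} := hFV ▸ ⟨hmemF x hx, hRV hx.1⟩
      rw [← h1.2]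
      exact hlim x h1.1) (M - ((n : ℝ) + 1))
  obtain ⟨H, hH, hHc, hHm, hH0, hH1⟩ := exists_convex_transition
  have hHnn : ∀ t, 0 ≤ H t := fun t => by
    rcases le_total t 0 with h | h
    · exact (hH0 t h).ge
    · exact (hH0 0 le_rfl).ge.trans (hHm h)
  let f : ℕ → CSpace k → ℝ := fun n =>
    H ∘ (((1 / ((n : ℝ) + 1)) • u (j n)) + fun _ => 1 - M / ((n : ℝ) + 1))
  have hfP : ∀ n, f n ∈ P := fun n => hP.comp_mem _ (hP.add_mem _ (hP.smul_mem _ (by positivity) _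
    (huP _)) _ (hP.const_mem _)) H hH hHc hHm
  have hfx : ∀ n x, f n x = H (1 + (u (j n) x - M) / ((n : ℝ) + 1)) := fun n x => by
    change H ((1 / ((n : ℝ) + 1)) * u (j n) x + (1 - M / ((n : ℝ) + 1))) = _
    congr 1
    ring
  obtain ⟨χ, h1, h2, h3, h4, h5, h6⟩ := exists_cutoff (isCompact_closedBall a (R / 2))
    Metric.isOpen_ball hrR
  let g : ℕ → CSpace k → ℝ := fun n x => χ x * f n x
  have hχV : tsupport χ ⊆ V := h3.trans (Metric.ball_subset_closedBall.trans hRV)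
  have hgχ : ∀ n, tsupport (g n) ⊆ tsupport χ := fun n =>
    tsupport_subset_of_zero fun x hx => by
      change χ x * f n x = 0
      rw [hx, zero_mul]
  have hg : ∀ n, ContDiff ℝ 2 (g n) := fun n => contDiff_of_forall_mem_tsupport fun x hx =>
    (contDiff_infty.1 h1 2).contDiffAt.mul
      ((hP.contDiffOn _ (hfP n)).contDiffAt (U.isOpen.mem_nhds (hVU (hχV (hgχ n hx)))))
  have hgc : ∀ n, HasCompactSupport (g n) := fun n =>
    h2.of_isClosed_subset (isClosed_tsupport _) (hgχ n)
  have hgΩ : ∀ n, tsupport (g n) ⊆ sdiffOpens U F hF := by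
    intro n x hx
    have hxV := hχV (hgχ n hx)
    refine ⟨hVU hxV, fun hxF => ?_⟩
    have h7 : u (j n) x < M - ((n : ℝ) + 1) := hj n x
      ⟨Metric.ball_subset_closedBall (h3 (hgχ n hx)), fun h => h.2 hxF⟩
    have h8 : ∀ᶠ y in 𝓝 x, u (j n) y < M - ((n : ℝ) + 1) :=
      ((huc (j n)).continuousAt (hV.mem_nhds hxV)).eventually (gt_mem_nhds h7)
    refine (notMem_tsupport_iff_eventuallyEq.2 ?_) hx
    filter_upwards [h8] with y hy
    change χ y * f n y = 0
    rw [hfx, hH0 _ ?_, mul_zero]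
    have : (u (j n) y - M) / ((n : ℝ) + 1) ≤ -1 := by
      rw [div_le_iff₀ (by positivity)]
      linarith
    linarith
  have hg0 : ∀ n x, 0 ≤ g n x := fun n x => mul_nonneg (h4 x) (hHnn _)
  have hg1 : ∀ n x, g n x ≤ 1 := by
    intro n x
    by_cases hx : x ∈ tsupport χ
    · refine mul_le_one₀ (h5 x) (hHnn _) ?_
      change f n x ≤ 1
      rw [hfx]
      refine (hHm ?_).trans hH1.le
      have : (u (j n) x - M) / ((n : ℝ) + 1) ≤ 0 := div_nonpos_of_nonpos_of_nonneg
        (by linarith [hM' (j n) x (Metric.ball_subset_closedBall (h3 hx))]) (by positivity)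
      linarith
    · change χ x * f n x ≤ 1
      rw [image_eq_zero_of_notMem_tsupport hx, zero_mul]
      exact zero_le_one
  have hfg : ∀ n, ∀ x ∈ Metric.closedBall a (R / 2), f n =ᶠ[𝓝 x] g n := by
    intro n x hx
    filter_upwards [(eventually_nhdsSet_iff_forall.1 h6) x hx] with y hy
    change f n y = χ y * f n y
    rw [hy, one_mul]
  choose w hw hwg hwT using fun n : ℕ => hTP.exists_cutoff_approx hTμ (hfP n) (hg n) (hgc n) (hgΩ n)
    (hg0 n) (hg1 n) (hfg n) (hμ.measure_lt_top (isCompact_closedBall a (R / 2)) (hrV.trans hVU))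
    (ε := 1 / ((n : ℝ) + 1)) (by positivity)
  refine ⟨R / 2, w, hr, hrV.trans hVU, hw, fun x hx hxF => ?_, hwT⟩
  have hxV := hrV hx
  have hvx : v x ≠ ⊥ := fun h => hxF (by
    have : x ∈ F ∩ V := by rw [hFV]; exact ⟨hxV, h⟩
    exact this.1)
  have hle : ∀ i, v x ≤ ((u i x : ℝ) : EReal) := fun i =>
    (show Antitone fun i => ((u i x : ℝ) : EReal) from fun i i' h =>
      EReal.coe_le_coe_iff.2 (hanti x hxV h)).le_of_tendsto (hlim x hxV) i
  -- Thus `v x` is a real number. It bounds every `u i x` from below, so `(u (j n) x - M)/(n+1)` is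
  -- at least a quantity tending to zero.
  have hvt : v x ≠ ⊤ := ((hle 0).trans_lt (EReal.coe_lt_top _)).ne
  have hL : ∀ i, (v x).toReal ≤ u i x := fun i => by
    rw [← EReal.coe_le_coe_iff, EReal.coe_toReal hvt hvx]
    exact hle i
  have h0 := tendsto_one_div_add_atTop_nhds_zero_nat (𝕜 := ℝ)
  have hgx : ∀ n, g n x = f n x := fun n => ((hfg n x hx).self_of_nhds).symm
  have hlow : Tendsto (fun n : ℕ => H (1 + ((v x).toReal - M) * (1 / ((n : ℝ) + 1))) -
      1 / ((n : ℝ) + 1)) atTop (𝓝 1) := by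
    have h7 : Tendsto (fun n : ℕ => 1 + ((v x).toReal - M) * (1 / ((n : ℝ) + 1))) atTop
        (𝓝 (1 + ((v x).toReal - M) * 0)) := tendsto_const_nhds.add (tendsto_const_nhds.mul h0)
    have h8 := ((hH.continuous.tendsto _).comp h7).sub h0
    rwa [mul_zero, add_zero, hH1, sub_zero] at h8
  refine tendsto_of_tendsto_of_tendsto_of_le_of_le hlow tendsto_const_nhds (fun n => ?_)
    fun n => (hw n).le_one x
  have h7 := (abs_le.1 (hwg n x)).1
  rw [hgx n, hfx] at h7
  have h8 : H (1 + ((v x).toReal - M) * (1 / ((n : ℝ) + 1)))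
      ≤ H (1 + (u (j n) x - M) / ((n : ℝ) + 1)) := by
    refine hHm ?_
    rw [mul_one_div]
    gcongr
    exact hL _
  change _ - _ ≤ w n x
  linarith

end Approximation

/-! ### Energy estimate -/

section Energy

open MeasureTheory

variable {k n q : ℕ} {Ω U : Opens (CSpace k)}

theorem contDiff_delF {f : CSpace k → Form k n} (hf : ContDiff ℝ ∞ f) : ContDiff ℝ ∞ (delF f) :=
  (((alt k n).comp (linPart k (Form k n))).restrictScalars ℝ).contDiff.comp
    (hf.fderiv_right (m := ∞) (by simp))

theorem contDiff_delbarF {f : CSpace k → Form k n} (hf : ContDiff ℝ ∞ f) :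
    ContDiff ℝ ∞ (delbarF f) :=
  (((alt k n).comp (antiPart k (Form k n))).restrictScalars ℝ).contDiff.comp
    (hf.fderiv_right (m := ∞) (by simp))

theorem isTest_wedge_delFun {G : CSpace k → ℝ} (hG : ContDiff ℝ ∞ G) (hGc : HasCompactSupport G)
    (hGΩ : tsupport G ⊆ Ω) {φ : CSpace k → Form k n} (hφ : ContDiff ℝ ∞ φ) :
    IsTest Ω (fun x => wedge (delFun G x) (φ x)) :=
  .of_eq_zero (contDiff_wedge (contDiff_delFun hG) hφ) hGc hGΩ fun x hx => by
    rw [delFun_eq_zero hx, zero_wedge]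

theorem isTest_wedge_delbarFun {G : CSpace k → ℝ} (hG : ContDiff ℝ ∞ G)
    (hGc : HasCompactSupport G) (hGΩ : tsupport G ⊆ Ω) {φ : CSpace k → Form k n}
    (hφ : ContDiff ℝ ∞ φ) : IsTest Ω (fun x => wedge (delbarFun G x) (φ x)) :=
  .of_eq_zero (contDiff_wedge (contDiff_delbarFun hG) hφ) hGc hGΩ fun x hx => by
    rw [delbarFun_eq_zero hx, zero_wedge]

/-- The product formula for `i∂∂̄T`. -/
theorem ev_currentIddbar_smul (T : Current Ω (n + 1 + 1)) {G : CSpace k → ℝ}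
    (hG : ContDiff ℝ ∞ G) (hGc : HasCompactSupport G) (hGΩ : tsupport G ⊆ Ω)
    {φ : CSpace k → Form k n} (hφ : ContDiff ℝ ∞ φ) :
    ev (currentIddbar T) (fun x => G x • φ x)
      = Complex.I * ev T (fun x => G x • delF (delbarF φ) x)
        + Complex.I * ev T (fun x => wedge (delFun G x) (delbarF φ x))
        - Complex.I * ev T (fun x => wedge (delbarFun G x) (delF φ x))
        + ev T (fun x => iddbarWedge G x (φ x)) := by
  have t0 : IsTest Ω (fun x => G x • φ x) := IsTest.cut hG hGc hGΩ hφ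
  have t1 : IsTest Ω (fun x => G x • delF (delbarF φ) x) :=
    IsTest.cut hG hGc hGΩ (contDiff_delF (contDiff_delbarF hφ))
  have t2 := isTest_wedge_delFun hG hGc hGΩ (contDiff_delbarF hφ)
  have t3 := isTest_wedge_delbarFun hG hGc hGΩ (contDiff_delF hφ)
  have t4 : IsTest Ω (fun x => iddbarWedge G x (φ x)) :=
    .of_eq_zero (contDiff_iddbarWedge hG hφ) hGc hGΩ fun x hx => iddbarWedge_eq_zero hx (φ x)
  have h : delF (delbarF fun x => G x • φ x) = fun x => ((G x • delF (delbarF φ) x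
      + wedge (delFun G x) (delbarF φ x)) - wedge (delbarFun G x) (delF φ x))
      + (-Complex.I) • iddbarWedge G x (φ x) := by
    funext x
    rw [delF_delbarF_smul hG hφ, iddbarWedge, smul_smul, neg_mul, Complex.I_mul_I, neg_neg,
      one_smul]
  rw [ev_currentIddbar T t0, h, ev_add T ((t1.add t2).sub t3) (t4.const_smul _),
    ev_sub T (t1.add t2) t3, ev_add T t1 t2, ev_const_smul T t4]
  linear_combination (-(ev T fun x => iddbarWedge G x (φ x))) * Complex.I_mul_I

/-- The product formula for `dT`. -/
theorem ev_currentD_smul (T : Current Ω (n + 1)) {G : CSpace k → ℝ}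
    (hG : ContDiff ℝ ∞ G) (hGc : HasCompactSupport G) (hGΩ : tsupport G ⊆ Ω)
    {φ : CSpace k → Form k n} (hφ : ContDiff ℝ ∞ φ) :
    ev (currentD T) (fun x => G x • φ x) = (-1 : ℂ) ^ n * (ev T (fun x => G x • dF φ x)
      + (ev T (fun x => wedge (delFun G x) (φ x)) + ev T (fun x => wedge (delbarFun G x) (φ x)))) := by
  have t0 : IsTest Ω (fun x => G x • φ x) := IsTest.cut hG hGc hGΩ hφ
  have hd : ContDiff ℝ ∞ (dF φ) := by
    rw [funext (dF_eq φ)]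
    exact (contDiff_delF hφ).add (contDiff_delbarF hφ)
  have t1 : IsTest Ω (fun x => G x • dF φ x) := IsTest.cut hG hGc hGΩ hd
  have t2 := isTest_wedge_delFun hG hGc hGΩ hφ
  have t3 := isTest_wedge_delbarFun hG hGc hGΩ hφ
  have h : dF (fun x => G x • φ x) = fun x => G x • dF φ x
      + (wedge (delFun G x) (φ x) + wedge (delbarFun G x) (φ x)) :=
    funext fun x => dF_smul (hG.differentiable (by simp) x) (hφ.differentiable (by simp) x)
  rw [ev_currentD T t0, h, ev_add T t1 (t2.add t3), ev_add T t2 t3]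

theorem delF_const (β : Form k n) (x : CSpace k) : delF (fun _ => β) x = 0 := by
  rw [delF, fderiv_fun_const]
  simp

theorem delbarF_const (β : Form k n) (x : CSpace k) : delbarF (fun _ => β) x = 0 := by
  rw [delbarF, fderiv_fun_const]
  simp

/-- The reason for cutting off with `ψ²`: one factor `ψ` survives differentiation and goes with
`∂̄w` in Cauchy–Schwarz, so that the mixed term is absorbed by an energy weighted by `ψ²`. -/
theorem delF_sq_smul {ψ : CSpace k → ℝ} (hψ : Differentiable ℝ ψ) (β : Form k n) (x : CSpace k) :
    delF (fun y => (ψ y ^ 2) • β) x = ψ x • wedge (delFun ψ x) ((2 : ℝ) • β) := by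
  have h := delFun_comp (h := fun t => t ^ 2) (differentiable_pow 2) hψ x
  rw [delF_smul (G := fun y => ψ y ^ 2) (hψ.pow 2 x) (differentiableAt_const β), delF_const, smul_zero, zero_add, h,
    wedge_real_smul_left, wedge_real_smul_right, smul_smul]
  congr 1
  simp [mul_comm]

theorem delbarF_sq_smul {ψ : CSpace k → ℝ} (hψ : Differentiable ℝ ψ) (β : Form k n)
    (x : CSpace k) :
    delbarF (fun y => (ψ y ^ 2) • β) x = ψ x • wedge (delbarFun ψ x) ((2 : ℝ) • β) := by
  have h := delbarFun_comp (h := fun t => t ^ 2) (differentiable_pow 2) hψ x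
  rw [delbarF_smul (G := fun y => ψ y ^ 2) (hψ.pow 2 x) (differentiableAt_const β), delbarF_const, smul_zero, zero_add, h,
    wedge_real_smul_left, wedge_real_smul_right, smul_smul]
  congr 1
  simp [mul_comm]

theorem energyForm_real_smul (w : CSpace k → ℝ) (c : ℝ) (β : Form k n) (x : CSpace k) :
    energyForm w (c • β) x = c • energyForm w β x := by
  rw [energyForm, energyForm, wedge_real_smul_right, wedge_real_smul_right, smul_comm]

theorem IsDominated.norm_ev_smul_le {N : Current Ω n} {μ : Measure (CSpace k)}
    (hN : IsDominated N μ) {f : CSpace k → ℝ} {φ : CSpace k → Form k n} {B : ℝ}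
    (hf : ∀ x, |f x| ≤ B) (hφ : ∫⁻ x, ‖φ x‖ₑ ∂μ < ⊤) :
    ‖ev N (fun x => f x • φ x)‖ ≤ B * (∫⁻ x, ‖φ x‖ₑ ∂μ).toReal := by
  have hB : 0 ≤ B := (abs_nonneg _).trans (hf 0)
  rw [← ENNReal.ofReal_le_ofReal_iff (by positivity), ofReal_norm, ENNReal.ofReal_mul hB,
    ENNReal.ofReal_toReal hφ.ne, ← lintegral_const_mul' _ _ ENNReal.ofReal_ne_top]
  refine (hN _).trans (lintegral_mono fun x => ?_)
  rw [enorm_smul]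
  gcongr
  rw [← ofReal_norm]
  exact ENNReal.ofReal_le_ofReal (hf x)

theorem lintegral_sq_lt_top {μ : Measure (CSpace k)} (hμ : IsFiniteNear U μ)
    {f : CSpace k → Form k n} (hf : IsTest U f) : ∫⁻ x, ‖f x‖ₑ ^ 2 ∂μ < ⊤ := by
  obtain ⟨C, hC0, hC⟩ := hf.exists_bound
  calc ∫⁻ x, ‖f x‖ₑ ^ 2 ∂μ ≤ ∫⁻ x, ENNReal.ofReal C * ‖f x‖ₑ ∂μ := lintegral_mono fun x => by
        rw [sq]
        gcongr
        rw [← ofReal_norm]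
        exact ENNReal.ofReal_le_ofReal (hC x)
    _ = ENNReal.ofReal C * ∫⁻ x, ‖f x‖ₑ ∂μ := lintegral_const_mul' _ _ ENNReal.ofReal_ne_top
    _ < ⊤ := ENNReal.mul_lt_top ENNReal.ofReal_lt_top (hf.lintegral_lt_top hμ)

theorem lintegral_sq_smul_le {μ : Measure (CSpace k)} {s : CSpace k → ℝ} {B : ℝ}
    (hs0 : ∀ x, 0 ≤ s x) (hs : ∀ x, s x ^ 2 ≤ B) {f : CSpace k → Form k n}
    (hf : ∫⁻ x, ‖f x‖ₑ ^ 2 ∂μ < ⊤) :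
    ∫⁻ x, ‖s x • f x‖ₑ ^ 2 ∂μ ≤ ENNReal.ofReal (B * (∫⁻ x, ‖f x‖ₑ ^ 2 ∂μ).toReal) := by
  have hB : 0 ≤ B := (sq_nonneg _).trans (hs 0)
  rw [ENNReal.ofReal_mul hB, ENNReal.ofReal_toReal hf.ne,
    ← lintegral_const_mul' _ _ ENNReal.ofReal_ne_top]
  refine lintegral_mono fun x => ?_
  rw [enorm_smul, mul_pow]
  gcongr
  rw [Real.enorm_eq_ofReal (hs0 x), ← ENNReal.ofReal_pow (hs0 x)]
  exact ENNReal.ofReal_le_ofReal (hs x)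

/-- The basic energy estimate. -/
theorem exists_energy_bound {T : Current Ω (2 * (q + 1))} (hT : IsPositive (q + 1) T)
    {S : Current Ω (2 * q)}
    {μ ν : Measure (CSpace k)} (hTμ : IsDominated T μ) (hμ : IsFiniteNear U μ)
    (hSν : IsDominated S ν) (hν : IsFiniteNear U ν) {ψ : CSpace k → ℝ} (hψ : ContDiff ℝ ∞ ψ)
    (hψc : HasCompactSupport ψ) (hψU : tsupport ψ ⊆ U) :
    ∃ C : ℝ, 0 ≤ C ∧ ∀ w : CSpace k → ℝ, IsCutoff Ω w → ∀ m : ℝ, 1 ≤ m → ∀ η : ℝ,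
      (∃ c : ℝ, 0 ≤ c ∧ ‖ev (n := 2 * q + 1 + 1) T (fun x => iddbarWedge w x
        ((m * Real.exp (m * w x)) • (ψ x ^ 2) • frameSum k q)) - c‖ ≤ η) →
      (ev (n := 2 * q + 1 + 1) T (fun x => (m * Real.exp (m * w x / 2) * ψ x) ^ 2 •
        energyForm w (frameSum k q) x)).re / 2
      + (ev (S - currentIddbar (n := 2 * q) T) (fun x => (Real.exp (m * w x) - 1) •
        (ψ x ^ 2) • frameSum k q)).re ≤ C * Real.exp m + η := by
  obtain ⟨C₀, hC₀, hmix⟩ := exists_mixed_bound k q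
  let β : CSpace k → Form k (2 * q) := fun x => (ψ x ^ 2) • frameSum k q
  have dψ : Differentiable ℝ ψ := hψ.differentiable (by simp)
  have hβ : ContDiff ℝ ∞ β := (hψ.pow 2).smul contDiff_const
  have tβ : IsTest U β := .of_eq_zero hβ hψc hψU fun x hx => by
    change (ψ x ^ 2) • frameSum k q = 0
    rw [image_eq_zero_of_notMem_tsupport hx, zero_pow two_ne_zero, zero_smul]
  let A : CSpace k → Form k (2 * q + 1) := fun x =>
    wedge (delbarFun ψ x) ((2 : ℝ) • frameSum k q)
  let A' : CSpace k → Form k (2 * q + 1) := fun x =>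
    wedge (delFun ψ x) ((2 : ℝ) • frameSum k q)
  have tA : IsTest U A := isTest_wedge_delbarFun hψ hψc hψU contDiff_const
  have tA' : IsTest U A' := isTest_wedge_delFun hψ hψc hψU contDiff_const
  have fA := lintegral_sq_lt_top hμ tA
  have fA' := lintegral_sq_lt_top hμ tA'
  have fβ := tβ.lintegral_lt_top hν
  have fD := tβ.delbarF.delF.lintegral_lt_top hμ
  set a := (∫⁻ x, ‖A x‖ₑ ^ 2 ∂μ).toReal with ha
  set a' := (∫⁻ x, ‖A' x‖ₑ ^ 2 ∂μ).toReal with ha'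
  set b := (∫⁻ x, ‖β x‖ₑ ∂ν).toReal with hb
  set d := (∫⁻ x, ‖delF (delbarF β) x‖ₑ ∂μ).toReal with hd
  have ha0 : 0 ≤ a := ENNReal.toReal_nonneg
  have ha0' : 0 ≤ a' := ENNReal.toReal_nonneg
  have hb0 : 0 ≤ b := ENNReal.toReal_nonneg
  have hd0 : 0 ≤ d := ENNReal.toReal_nonneg
  -- The two mixed terms then absorb at most a quarter of the energy each, which leaves one half.
  obtain ⟨t, ht, htC⟩ : ∃ t : ℝ, 0 < t ∧ C₀ * t ≤ 1 / 4 := by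
    refine ⟨1 / (4 * (C₀ + 1)), by positivity, ?_⟩
    rw [mul_one_div, div_le_div_iff₀ (by positivity) (by positivity)]
    linarith
  refine ⟨b + d + C₀ * t⁻¹ * (a + a'), by positivity, fun w hw m hm η hη => ?_⟩
  obtain ⟨c, hc, hcη⟩ := hη
  have hm0 : 0 ≤ m := zero_le_one.trans hm
  -- Subtracting 1 makes `G` vanish where `w` does, so that it is supported in `Ω`; derivatives are
  -- unaffected.
  let G : CSpace k → ℝ := fun x => Real.exp (m * w x) - 1
  have hh : ContDiff ℝ ∞ fun t : ℝ => Real.exp (m * t) - 1 :=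
    (Real.contDiff_exp.comp (contDiff_const.mul contDiff_id)).sub contDiff_const
  have hder : ∀ t, HasDerivAt (fun t : ℝ => Real.exp (m * t) - 1) (m * Real.exp (m * t)) t :=
    fun t => by
      have := (((hasDerivAt_id t).const_mul m).exp).sub_const 1
      simpa [mul_comm] using this
  have hder1 : deriv (fun t : ℝ => Real.exp (m * t) - 1) = fun t => m * Real.exp (m * t) :=
    funext fun t => (hder t).deriv
  have hder2 : deriv (fun t : ℝ => m * Real.exp (m * t)) = fun t => m ^ 2 * Real.exp (m * t) :=
    funext fun t => by
      have := (((hasDerivAt_id t).const_mul m).exp).const_mul m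
      rw [HasDerivAt.deriv (f' := m ^ 2 * Real.exp (m * t))]
      refine this.congr_deriv ?_
      change m * (Real.exp (m * t) * (m * 1)) = _
      ring
  have hG : ContDiff ℝ ∞ G := hh.comp hw.smooth
  have hGw : tsupport G ⊆ tsupport w := tsupport_subset_of_zero fun x hx => by
    change Real.exp (m * w x) - 1 = 0
    rw [hx, mul_zero, Real.exp_zero, sub_self]
  have hGc : HasCompactSupport G := hw.compact.of_isClosed_subset (isClosed_tsupport _) hGw
  have hGΩ : tsupport G ⊆ Ω := hGw.trans hw.subset
  have hexp : ∀ x, Real.exp (m * w x) ≤ Real.exp m := fun x =>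
    Real.exp_le_exp.2 (mul_le_of_le_one_right hm0 (hw.le_one x))
  have hG0 : ∀ x, 0 ≤ G x := fun x =>
    sub_nonneg.2 (Real.one_le_exp (mul_nonneg hm0 (hw.nonneg x)))
  have hGm : ∀ x, |G x| ≤ Real.exp m := fun x => by
    rw [abs_of_nonneg (hG0 x)]
    exact (sub_le_self _ zero_le_one).trans (hexp x)
  -- The exponential is shared equally: `s * s'` is the coefficient `m exp(m w) ψ` of the mixed
  -- terms, `s²` is exactly the weight of the energy, and `s'² ≤ exp m`.
  let s : CSpace k → ℝ := fun x => m * Real.exp (m * w x / 2) * ψ x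
  let s' : CSpace k → ℝ := fun x => Real.exp (m * w x / 2)
  have hs' : ContDiff ℝ ∞ s' :=
    Real.contDiff_exp.comp ((contDiff_const.mul hw.smooth).div_const 2)
  have hs : ContDiff ℝ ∞ s := (contDiff_const.mul hs').mul hψ
  have hs'2 : ∀ x, s' x * s' x = Real.exp (m * w x) := fun x => by
    change Real.exp _ * Real.exp _ = _
    rw [← Real.exp_add]
    congr 1
    ring
  have hs'm : ∀ x, s' x ^ 2 ≤ Real.exp m := fun x => by
    rw [sq, hs'2]
    exact hexp x
  have ds : ∀ x, m * Real.exp (m * w x) * ψ x = s x * s' x := fun x => by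
    change _ = m * s' x * ψ x * s' x
    rw [← hs'2]
    ring
  set En := (ev (n := 2 * q + 1 + 1) T (fun x => (s x) ^ 2 •
    energyForm w (frameSum k q) x)).re with hEn
  -- the mixed terms
  have e2 : (fun x => wedge (delFun G x) (delbarF β x))
      = fun x => s x • wedge (delFun w x) (s' x • A x) := by
    funext x
    have h1 : delFun G x = _ := delFun_comp (hh.differentiable (by simp))
      (hw.smooth.differentiable (by simp)) x
    rw [h1, hder1, delbarF_sq_smul dψ]
    change wedge ((m * Real.exp (m * w x)) • delFun w x) (ψ x • A x) = _
    rw [wedge_real_smul_left, wedge_real_smul_right, wedge_real_smul_right, smul_smul, smul_smul,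
      ← ds]
  have e3 : (fun x => wedge (delbarFun G x) (delF β x))
      = fun x => s x • wedge (delbarFun w x) (s' x • A' x) := by
    funext x
    have h1 : delbarFun G x = _ := delbarFun_comp (hh.differentiable (by simp))
      (hw.smooth.differentiable (by simp)) x
    rw [h1, hder1, delF_sq_smul dψ]
    change wedge ((m * Real.exp (m * w x)) • delbarFun w x) (ψ x • A' x) = _
    rw [wedge_real_smul_left, wedge_real_smul_right, wedge_real_smul_right, smul_smul, smul_smul,
      ← ds]
  have m2 := (hmix Ω T hT μ hTμ w s hw.smooth hw.compact hw.subset hs (fun x => s' x • A x)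
    (hs'.smul tA.smooth) t (Real.exp m * a) ht (by positivity)
    (lintegral_sq_smul_le (fun x => (Real.exp_pos _).le) hs'm fA)).1
  have m3 := (hmix Ω T hT μ hTμ w s hw.smooth hw.compact hw.subset hs (fun x => s' x • A' x)
    (hs'.smul tA'.smooth) t (Real.exp m * a') ht (by positivity)
    (lintegral_sq_smul_le (fun x => (Real.exp_pos _).le) hs'm fA')).2
  rw [← e2, ← hEn] at m2
  rw [← e3, ← hEn] at m3
  -- the directed term
  have t4 : IsTest (n := 2 * q + 1 + 1) Ω (fun x => iddbarWedge w x
      ((m * Real.exp (m * w x)) • β x)) := hw.isTest_iddbarWedge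
    ((contDiff_const.mul (Real.contDiff_exp.comp (contDiff_const.mul hw.smooth))).smul hβ)
  have t5 : IsTest (n := 2 * q + 1 + 1) Ω (fun x => (s x) ^ 2 • energyForm w (frameSum k q) x) :=
    isTest_smul_energyForm hw.smooth hw.compact hw.subset (hs.pow 2) _
  have e4 : (fun x => iddbarWedge G x (β x)) = fun x => iddbarWedge w x
      ((m * Real.exp (m * w x)) • β x) + (s x) ^ 2 • energyForm w (frameSum k q) x := by
    funext x
    have h1 : iddbarWedge G x (β x) = _ := iddbarWedge_comp hh hw.smooth x (β x)
    rw [h1, hder1, hder2, iddbarWedge_real_smul w x (m * Real.exp (m * w x)) (β x)]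
    congr 1
    change (m ^ 2 * Real.exp (m * w x)) • energyForm w ((ψ x ^ 2) • frameSum k q) x = _
    rw [energyForm_real_smul, smul_smul]
    congr 1
    change _ = (m * s' x * ψ x) ^ 2
    rw [← hs'2]
    ring
  -- In this identity the energy and the directed term enter `i∂∂̄T` with a plus sign, hence `S -
  -- i∂∂̄T` with a minus sign. The directed term is at least `-η`, and everything else is bounded.
  have key := ev_currentIddbar_smul (n := 2 * q) T hG hGc hGΩ hβ
  rw [e4, ev_add (n := 2 * q + 1 + 1) T t4 t5] at key
  have h1 := hTμ.norm_ev_smul_le (n := 2 * q + 1 + 1) hGm fD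
  have h2 := hSν.norm_ev_smul_le hGm fβ
  have h3 : ev (S - currentIddbar (n := 2 * q) T) (fun x => G x • β x)
      = ev S (fun x => G x • β x) - ev (currentIddbar (n := 2 * q) T) (fun x => G x • β x) :=
    ev_sub_current _ _ _
  change En / 2 + (ev (S - currentIddbar (n := 2 * q) T) (fun x => G x • β x)).re ≤ _
  rw [h3, key]
  have hI : ∀ z : ℂ, |(Complex.I * z).re| ≤ ‖z‖ := fun z => by
    have := Complex.abs_re_le_norm (Complex.I * z)
    rwa [norm_mul, Complex.norm_I, one_mul] at this
  have r1 := (neg_le_of_abs_le (hI (ev (n := 2 * q + 1 + 1) T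
    (fun x => G x • delF (delbarF β) x)))).trans' (neg_le_neg h1)
  have r2 := (neg_le_of_abs_le (hI (ev (n := 2 * q + 1 + 1) T
    (fun x => wedge (delFun G x) (delbarF β x))))).trans' (neg_le_neg m2)
  have r3 := (le_of_abs_le (hI (ev (n := 2 * q + 1 + 1) T
    (fun x => wedge (delbarFun G x) (delF β x))))).trans m3
  have r4 := (Complex.re_le_norm (ev S (fun x => G x • β x))).trans h2
  have r5 : -η ≤ (ev (n := 2 * q + 1 + 1) T
      (fun x => iddbarWedge w x ((m * Real.exp (m * w x)) • β x))).re := by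
    have := (Complex.abs_re_le_norm _).trans hcη
    rw [Complex.sub_re, Complex.ofReal_re] at this
    have h4 := neg_le_of_abs_le this
    change -η ≤ (ev (n := 2 * q + 1 + 1) T (fun x => iddbarWedge w x
        ((m * Real.exp (m * w x)) • (ψ x ^ 2) • frameSum k q))).re
    linarith
  have hEn0 : 0 ≤ En := by
    rw [hEn, ev_smul_energyForm_frameSum hw.smooth hw.compact hw.subset (hs.pow 2), Complex.re_sum]
    exact Finset.sum_nonneg fun l _ => hT.re_ev_energyForm_nonneg hw.smooth hw.compact hw.subset
      (hs.pow 2) (fun x => sq_nonneg _) l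
  have h5 := mul_le_mul_of_nonneg_right htC hEn0
  simp only [Complex.sub_re, Complex.add_re]
  rw [← hEn]
  nlinarith

end Energy

/-! ### Consequences of the energy estimate -/

section Consequences

open MeasureTheory

variable {k n q : ℕ} {Ω U : Opens (CSpace k)} {F : Set (CSpace k)}
  {hF : IsClosed ((↑) ⁻¹' F : Set U)}

theorem IsOfOrderZero.ev_tendsto {N : Current Ω n} (hN : IsOfOrderZero N) {w : ℕ → CSpace k → ℝ}
    (hw : ∀ j, IsCutoff Ω (w j)) {φ : CSpace k → Form k n} (hφ : IsTest Ω φ)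
    (hlim : ∀ x ∈ Ω, φ x ≠ 0 → Tendsto (fun j => w j x) atTop (𝓝 1)) :
    Tendsto (fun j => ev N (fun x => w j x • φ x)) atTop (𝓝 (ev N φ)) := by
  obtain ⟨μ, h0, hO, hdom⟩ := exists_dominating_measure hN
  refine ev_tendsto_of_isDominated hdom (fun x hx => ?_) h0 le_rfl (fun _ _ _ => rfl) hw hφ hlim
  obtain ⟨K, hK, hxK, hKΩ⟩ := exists_compact_subset Ω.isOpen hx
  exact ⟨interior K, isOpen_interior.mem_nhds hxK,
    (hO _ isOpen_interior (interior_subset.trans hKΩ)).trans_lt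
      ((mass_mono N interior_subset).trans_lt (hN K hK hKΩ))⟩

section

variable {T : Current (sdiffOpens U F hF) (2 * (q + 1))} {S : Current (sdiffOpens U F hF) (2 * q)}
  {a : CSpace k} {r : ℝ} {w : ℕ → CSpace k → ℝ} {μ ν : Measure (CSpace k)}

/-- The form paired with `i∂∂̄(w n)` has norm at most `m exp(m) B`, so the defect of directedness is
`m exp(m) B/(n+1)`. This is `O(exp m)` as long as `m ≤ n + 1`. -/
theorem IsApproxSequence.energy_bound (hw : IsApproxSequence T a r w) (hT : IsPositive (q + 1) T)
    (hTμ : IsDominated T μ) (hμ : IsFiniteNear U μ)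
    (hSν : IsDominated S ν) (hν : IsFiniteNear U ν) {ψ : CSpace k → ℝ} (hψ : ContDiff ℝ ∞ ψ)
    (hψc : HasCompactSupport ψ) (hψr : tsupport ψ ⊆ Metric.closedBall a r) :
    ∃ C : ℝ, 0 ≤ C ∧ ∀ m : ℝ, 1 ≤ m → ∀ n : ℕ, m ≤ (n : ℝ) + 1 →
      (ev (n := 2 * q + 1 + 1) T (fun x => (m * Real.exp (m * w n x / 2) * ψ x) ^ 2 •
        energyForm (w n) (frameSum k q) x)).re / 2
      + (ev (S - currentIddbar (n := 2 * q) T) (fun x => (Real.exp (m * w n x) - 1) •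
        (ψ x ^ 2) • frameSum k q)).re ≤ C * Real.exp m := by
  obtain ⟨C, hC, h⟩ := exists_energy_bound hT hTμ hμ hSν hν hψ hψc (hψr.trans hw.subset)
  have hβ : ContDiff ℝ ∞ fun x => (ψ x ^ 2) • (frameSum k q : Form k (2 * q)) :=
    (hψ.pow 2).smul contDiff_const
  have hβψ : ∀ x, x ∉ tsupport ψ → (ψ x ^ 2) • (frameSum k q : Form k (2 * q)) = 0 :=
    fun x hx => by rw [image_eq_zero_of_notMem_tsupport hx, zero_pow two_ne_zero, zero_smul]
  obtain ⟨B, hB, hβB⟩ := (IsTest.of_eq_zero hβ hψc (hψr.trans hw.subset) hβψ).exists_bound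
  refine ⟨C + B, by positivity, fun m hm n hmn => ?_⟩
  have hm0 : 0 < m := zero_lt_one.trans_le hm
  have hexp : ContDiff ℝ ∞ fun x => m * Real.exp (m * w n x) :=
    contDiff_const.mul (Real.contDiff_exp.comp (contDiff_const.mul (hw.isCutoff n).smooth))
  have h1 := hw.directed n (fun x => (m * Real.exp (m * w n x)) • (ψ x ^ 2) • frameSum k q)
    (hexp.smul hβ) (fun x => smul_mem_stronglyPositive (by positivity)
      (smul_mem_stronglyPositive (sq_nonneg _) frameSum_mem))
    ((tsupport_subset_of_zero fun x hx => by
      rw [hx, zero_pow two_ne_zero, zero_smul, smul_zero]).trans hψr) (m * Real.exp m * B)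
    fun x => by
      rw [norm_smul, Real.norm_of_nonneg (by positivity)]
      have h2 : Real.exp (m * w n x) ≤ Real.exp m :=
        Real.exp_le_exp.2 (mul_le_of_le_one_right hm0.le ((hw.isCutoff n).le_one x))
      have h3 := hβB x
      gcongr
  refine (h (w n) (hw.isCutoff n) m hm _ h1).trans ?_
  rw [add_mul]
  have h4 : m * (1 / ((n : ℝ) + 1)) ≤ 1 := by
    rw [mul_one_div]
    exact div_le_one_of_le₀ hmn (by positivity)
  have h5 : m * Real.exp m * B * (1 / ((n : ℝ) + 1))
      = m * (1 / ((n : ℝ) + 1)) * (B * Real.exp m) := by ring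
  rw [h5]
  have h6 : m * (1 / ((n : ℝ) + 1)) * (B * Real.exp m) ≤ 1 * (B * Real.exp m) := by gcongr
  linarith

theorem IsApproxSequence.exists_bump (hw : IsApproxSequence T a r w) :
    ∃ ψ : CSpace k → ℝ, ContDiff ℝ ∞ ψ ∧ HasCompactSupport ψ ∧
      tsupport ψ ⊆ Metric.closedBall a r ∧ ∀ x ∈ Metric.closedBall a (r / 2), ψ x = 1 := by
  obtain ⟨ψ, h1, h2, h3, -, -, h6⟩ := exists_cutoff (isCompact_closedBall a (r / 2))
    Metric.isOpen_ball (Metric.closedBall_subset_ball (half_lt_self hw.pos))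
  exact ⟨ψ, h1, h2, h3.trans Metric.ball_subset_closedBall, fun x hx =>
    h6.self_of_nhdsSet x hx⟩

/-- The case `m = 1` of the energy bound, with the non-negative energy dropped. As `w ≤ exp w - 1`,
it controls the positive current on forms `w n • f` uniformly in `n`, and these values converge to
the one at `f`. -/
theorem IsApproxSequence.mass_lt_top (hw : IsApproxSequence T a r w) (hT : IsPositive (q + 1) T)
    (hTS : IsPositive q (S - currentIddbar (n := 2 * q) T))
    (hTμ : IsDominated T μ) (hμ : IsFiniteNear U μ)
    (hSν : IsDominated S ν) (hν : IsFiniteNear U ν) :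
    mass (S - currentIddbar (n := 2 * q) T)
      (Metric.ball a (r / 2) ∩ sdiffOpens U F hF) < ⊤ := by
  set R := S - currentIddbar (n := 2 * q) T with hR
  obtain ⟨ψ, hψ, hψc, hψr, hψ1⟩ := hw.exists_bump
  obtain ⟨C, hC, h⟩ := hw.energy_bound hT hTμ hμ hSν hν hψ hψc hψr
  obtain ⟨C₁, hC₁, h₁⟩ := exists_positive_bound k q
  refine (mass_le_of_forall R (Metric.isOpen_ball.inter (sdiffOpens U F hF).isOpen) subset_rfl
    (C := ENNReal.ofReal (C₁ * (C * Real.exp 1))) fun f hf hfW hf1 => ?_).trans_lt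
    ENNReal.ofReal_lt_top
  rw [← ofReal_norm]
  refine ENNReal.ofReal_le_ofReal ?_
  have hlim := hTS.isOfOrderZero.ev_tendsto hw.isCutoff hf fun x hx hfx =>
    hw.tendsto x (Metric.closedBall_subset_closedBall (half_le_self hw.pos.le)
      (Metric.ball_subset_closedBall (hfW (subset_tsupport _ hfx)).1)) hx.2
  refine le_of_tendsto hlim.norm (Filter.Eventually.of_forall fun n => ?_)
  have hwn := hw.isCutoff n
  let g : CSpace k → ℝ := fun x => (Real.exp (1 * w n x) - 1) * ψ x ^ 2
  have hg : ContDiff ℝ ∞ g := ((Real.contDiff_exp.comp (contDiff_const.mul hwn.smooth)).sub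
    contDiff_const).mul (hψ.pow 2)
  have hgw : tsupport g ⊆ tsupport (w n) := tsupport_subset_of_zero fun x hx => by
    change (Real.exp (1 * w n x) - 1) * ψ x ^ 2 = 0
    rw [hx, mul_zero, Real.exp_zero, sub_self, zero_mul]
  have hwg : ∀ x, w n x * ψ x ^ 2 ≤ g x := fun x =>
    mul_le_mul_of_nonneg_right (by linarith [Real.add_one_le_exp (1 * w n x)]) (sq_nonneg _)
  have h2 := h₁ _ R hTS (fun x => w n x • f x) g (hwn.isTest_smul hf.smooth) hg
    (hwn.compact.of_isClosed_subset (isClosed_tsupport _) hgw) (hgw.trans hwn.subset) fun x => by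
      rw [norm_smul, Real.norm_of_nonneg (hwn.nonneg x)]
      refine le_trans ?_ (hwg x)
      refine mul_le_mul_of_nonneg_left ?_ (hwn.nonneg x)
      by_cases hx : x ∈ tsupport f
      · rw [hψ1 x (Metric.ball_subset_closedBall (hfW hx).1), one_pow]
        exact hf1 x
      · rw [IsTest.eq_zero hx, norm_zero]
        exact sq_nonneg _
  refine h2.trans (mul_le_mul_of_nonneg_left ?_ hC₁)
  have h3 := h 1 le_rfl n (by linarith [(Nat.cast_nonneg n : (0 : ℝ) ≤ n)])
  have h4 : 0 ≤ (ev (n := 2 * q + 1 + 1) T (fun x => (1 * Real.exp (1 * w n x / 2) * ψ x) ^ 2 •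
        energyForm (w n) (frameSum k q) x)).re := by
    have hs : ContDiff ℝ ∞ fun x => (1 * Real.exp (1 * w n x / 2) * ψ x) ^ 2 :=
      ((contDiff_const.mul (Real.contDiff_exp.comp
        ((contDiff_const.mul hwn.smooth).div_const 2))).mul hψ).pow 2
    rw [ev_smul_energyForm_frameSum hwn.smooth hwn.compact hwn.subset hs, Complex.re_sum]
    exact Finset.sum_nonneg fun l _ => hT.re_ev_energyForm_nonneg hwn.smooth hwn.compact hwn.subset
      hs (fun x => sq_nonneg _) l
  have h5 : (fun x => g x • frameSum k q) = fun x => (Real.exp (1 * w n x) - 1) •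
      (ψ x ^ 2) • frameSum k q := funext fun x => mul_smul _ _ _
  rw [h5]
  linarith

/-- Here the term of the positive current `S - i∂∂̄T` is dropped and the bound divided by `exp m`.
The surviving factor `m²` is the gain that makes the mixed terms vanish. -/
theorem IsApproxSequence.energy_le (hw : IsApproxSequence T a r w) (hT : IsPositive (q + 1) T)
    (hTS : IsPositive q (S - currentIddbar (n := 2 * q) T))
    (hTμ : IsDominated T μ) (hμ : IsFiniteNear U μ)
    (hSν : IsDominated S ν) (hν : IsFiniteNear U ν) {ψ : CSpace k → ℝ} (hψ : ContDiff ℝ ∞ ψ)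
    (hψc : HasCompactSupport ψ) (hψr : tsupport ψ ⊆ Metric.closedBall a r) :
    ∃ C : ℝ, 0 ≤ C ∧ ∀ m : ℝ, 1 ≤ m → ∀ n : ℕ, m ≤ (n : ℝ) + 1 →
      m ^ 2 * (ev (n := 2 * q + 1 + 1) T (fun x => (Real.exp (-(m * (1 - w n x) / 2)) * ψ x) ^ 2 •
        energyForm (w n) (frameSum k q) x)).re ≤ C := by
  obtain ⟨C, hC, h⟩ := hw.energy_bound hT hTμ hμ hSν hν hψ hψc hψr
  refine ⟨2 * C, by positivity, fun m hm n hmn => ?_⟩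
  have hm0 : 0 < m := zero_lt_one.trans_le hm
  have hwn := hw.isCutoff n
  have h1 := h m hm n hmn
  have h2 : 0 ≤ (ev (S - currentIddbar (n := 2 * q) T) (fun x => (Real.exp (m * w n x) - 1) •
      (ψ x ^ 2) • frameSum k q)).re := by
    refine hTS.re_ev_nonneg (.of_eq_zero (((Real.contDiff_exp.comp
      (contDiff_const.mul hwn.smooth)).sub contDiff_const).smul ((hψ.pow 2).smul contDiff_const))
      hwn.compact hwn.subset fun x hx => ?_) fun x => smul_mem_stronglyPositive
        (sub_nonneg.2 (Real.one_le_exp (mul_nonneg hm0.le (hwn.nonneg x))))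
        (smul_mem_stronglyPositive (sq_nonneg _) frameSum_mem)
    rw [image_eq_zero_of_notMem_tsupport hx]
    rw [mul_zero, Real.exp_zero, sub_self, zero_smul]
  have hs : ContDiff ℝ ∞ fun x => (Real.exp (-(m * (1 - w n x) / 2)) * ψ x) ^ 2 :=
    ((Real.contDiff_exp.comp ((contDiff_const.mul
      (contDiff_const.sub hwn.smooth)).div_const 2).neg).mul hψ).pow 2
  have h3 : (fun x => (m * Real.exp (m * w n x / 2) * ψ x) ^ 2 •
      energyForm (w n) (frameSum k q) x) = fun x => ((m ^ 2 * Real.exp m : ℝ) : ℂ) •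
        ((Real.exp (-(m * (1 - w n x) / 2)) * ψ x) ^ 2 •
          energyForm (w n) (frameSum k q) x) := by
    funext x
    rw [ofReal_smul_eq, smul_smul]
    congr 1
    have h4 : Real.exp (m * w n x / 2) ^ 2 = Real.exp m * Real.exp (-(m * (1 - w n x) / 2)) ^ 2 := by
      rw [← Real.exp_nat_mul, ← Real.exp_nat_mul, ← Real.exp_add]
      congr 1
      push_cast
      ring
    rw [mul_pow, mul_pow, h4]
    ring
  rw [h3, ev_const_smul (n := 2 * q + 1 + 1) T
    (isTest_smul_energyForm hwn.smooth hwn.compact hwn.subset hs _), Complex.re_ofReal_mul] at h1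
  have h5 : Real.exp m * (m ^ 2 * (ev (n := 2 * q + 1 + 1) T
      (fun x => (Real.exp (-(m * (1 - w n x) / 2)) * ψ x) ^ 2 •
        energyForm (w n) (frameSum k q) x)).re) ≤ Real.exp m * (2 * C) := by linarith
  exact le_of_mul_le_mul_left h5 (Real.exp_pos m)

/-- For fixed `m` the squared weight is at most `exp m`, and it tends to one off `F`, that is,
almost everywhere for `μ` on the support of `Ψ`. -/
theorem IsApproxSequence.tendsto_lintegral (hw : IsApproxSequence T a r w)
    (hμ0 : μ (sdiffOpens U F hF : Set (CSpace k))ᶜ = 0)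
    {Ψ : CSpace k → Form k n} (hΨ : Continuous Ψ) (hΨμ : ∫⁻ x, ‖Ψ x‖ₑ ^ 2 ∂μ < ⊤)
    (hΨr : tsupport Ψ ⊆ Metric.closedBall a r) {m : ℝ} (hm : 0 ≤ m) :
    Tendsto (fun n => ∫⁻ x, ‖Real.exp (m * (1 - w n x) / 2) • Ψ x‖ₑ ^ 2 ∂μ) atTop
      (𝓝 (∫⁻ x, ‖Ψ x‖ₑ ^ 2 ∂μ)) := by
  refine tendsto_lintegral_of_dominated_convergence
    (fun x => ENNReal.ofReal (Real.exp m) * ‖Ψ x‖ₑ ^ 2) (fun n => ?_) (fun n => ?_) ?_ ?_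
  · have := (hw.isCutoff n).smooth.continuous
    exact (Continuous.enorm (by fun_prop)).measurable.pow_const 2
  · refine Filter.Eventually.of_forall fun x => ?_
    change ‖Real.exp (m * (1 - w n x) / 2) • Ψ x‖ₑ ^ 2 ≤ _
    rw [enorm_smul, mul_pow]
    refine mul_le_mul' ?_ le_rfl
    rw [Real.enorm_eq_ofReal (Real.exp_pos _).le, ← ENNReal.ofReal_pow (Real.exp_pos _).le,
      ← Real.exp_nat_mul]
    refine ENNReal.ofReal_le_ofReal (Real.exp_le_exp.2 ?_)
    have := (hw.isCutoff n).nonneg x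
    push_cast
    nlinarith
  · rw [lintegral_const_mul' _ _ ENNReal.ofReal_ne_top]
    exact (ENNReal.mul_lt_top ENNReal.ofReal_lt_top hΨμ).ne
  · have hae : ∀ᵐ x ∂μ, x ∈ (sdiffOpens U F hF : Set (CSpace k)) := by
      rw [ae_iff]
      exact hμ0
    filter_upwards [hae] with x hx
    by_cases hxΨ : x ∈ tsupport Ψ
    · have h1 : Tendsto (fun n => Real.exp (m * (1 - w n x) / 2) • Ψ x) atTop
          (𝓝 (Real.exp (m * (1 - 1) / 2) • Ψ x)) :=
        ((Real.continuous_exp.tendsto _).comp ((tendsto_const_nhds.mul (tendsto_const_nhds.sub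
          (hw.tendsto x (hΨr hxΨ) hx.2))).div_const 2)).smul_const _
      rw [sub_self, mul_zero, zero_div, Real.exp_zero, one_smul] at h1
      exact (ENNReal.continuous_pow 2).tendsto _ |>.comp h1.enorm
    · simp only [IsTest.eq_zero hxΨ, smul_zero]
      exact tendsto_const_nhds

/-- The mixed terms tend to zero. -/
theorem IsApproxSequence.tendsto_mixed (hw : IsApproxSequence T a r w) (hT : IsPositive (q + 1) T)
    (hTS : IsPositive q (S - currentIddbar (n := 2 * q) T))
    (hTμ : IsDominated T μ) (hμ : IsFiniteNear U μ)
    (hμ0 : μ (sdiffOpens U F hF : Set (CSpace k))ᶜ = 0)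
    (hSν : IsDominated S ν) (hν : IsFiniteNear U ν) {Ψ : CSpace k → Form k (2 * q + 1)}
    (hΨ : ContDiff ℝ ∞ Ψ) (hΨr : tsupport Ψ ⊆ Metric.closedBall a (r / 2)) :
    Tendsto (fun n => ev (n := 2 * q + 1 + 1) T fun x => wedge (delFun (w n) x) (Ψ x)) atTop
      (𝓝 0) ∧
    Tendsto (fun n => ev (n := 2 * q + 1 + 1) T fun x => wedge (delbarFun (w n) x) (Ψ x)) atTop
      (𝓝 0) := by
  obtain ⟨ψ, hψ, hψc, hψr, hψ1⟩ := hw.exists_bump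
  obtain ⟨C, hC, h⟩ := hw.energy_le hT hTS hTμ hμ hSν hν hψ hψc hψr
  obtain ⟨C₀, hC₀, hmix⟩ := exists_mixed_bound k q
  have hΨr' : tsupport Ψ ⊆ Metric.closedBall a r :=
    hΨr.trans (Metric.closedBall_subset_closedBall (half_le_self hw.pos.le))
  have hΨμ := lintegral_sq_lt_top hμ (⟨hΨ, (isCompact_closedBall a r).of_isClosed_subset
    (isClosed_tsupport _) hΨr', hΨr'.trans hw.subset⟩ : IsTest U Ψ)
  set V := (∫⁻ x, ‖Ψ x‖ₑ ^ 2 ∂μ).toReal with hV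
  have hV0 : 0 ≤ V := ENNReal.toReal_nonneg
  have hVlt : ∫⁻ x, ‖Ψ x‖ₑ ^ 2 ∂μ < ENNReal.ofReal (V + 1) := by
    rw [← ENNReal.ofReal_toReal hΨμ.ne]
    exact (ENNReal.ofReal_lt_ofReal_iff (by positivity)).2 (lt_add_one V)
  -- Order of limits: for fixed `m` the bound `O(1/m)` holds for all large `n`, and only then is `m`
  -- taken large.
  have key : ∀ m : ℝ, 1 ≤ m → ∀ᶠ n : ℕ in atTop,
      ‖ev (n := 2 * q + 1 + 1) T fun x => wedge (delFun (w n) x) (Ψ x)‖ ≤ C₀ * (C + (V + 1)) / m ∧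
      ‖ev (n := 2 * q + 1 + 1) T fun x => wedge (delbarFun (w n) x) (Ψ x)‖
        ≤ C₀ * (C + (V + 1)) / m := by
    intro m hm
    have hm0 : 0 < m := zero_lt_one.trans_le hm
    filter_upwards [(hw.tendsto_lintegral hμ0 hΨ.continuous hΨμ hΨr' hm0.le).eventually
      (gt_mem_nhds hVlt), eventually_ge_atTop ⌈m⌉₊] with n hn hnm
    have hmn : m ≤ (n : ℝ) + 1 :=
      (Nat.le_ceil m).trans ((Nat.cast_le.2 hnm).trans (le_add_of_nonneg_right zero_le_one))
    have hwn := hw.isCutoff n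
    -- The exponentials in `s` and `s'` are inverse to each other and `ψ = 1` on the support of `Ψ`,
    -- so `s * s' = 1` there. The small weight goes to the energy, the large one to `Ψ`.
    let s : CSpace k → ℝ := fun x => Real.exp (-(m * (1 - w n x) / 2)) * ψ x
    let s' : CSpace k → ℝ := fun x => Real.exp (m * (1 - w n x) / 2)
    have hs' : ContDiff ℝ ∞ s' := Real.contDiff_exp.comp ((contDiff_const.mul
      (contDiff_const.sub hwn.smooth)).div_const 2)
    have hs : ContDiff ℝ ∞ s := (Real.contDiff_exp.comp ((contDiff_const.mul
      (contDiff_const.sub hwn.smooth)).div_const 2).neg).mul hψ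
    have h1 := hmix _ T hT μ hTμ (w n) s hwn.smooth hwn.compact hwn.subset hs
      (fun x => s' x • Ψ x) (hs'.smul hΨ) m (V + 1) hm0 (by positivity) hn.le
    have e : ∀ (η : CSpace k →L[ℝ] ℂ) x, s x • wedge η (s' x • Ψ x) = wedge η (Ψ x) := by
      intro η x
      by_cases hx : x ∈ tsupport Ψ
      · rw [wedge_real_smul_right, smul_smul]
        change (Real.exp (-(m * (1 - w n x) / 2)) * ψ x * Real.exp (m * (1 - w n x) / 2)) • _ = _
        rw [hψ1 x (hΨr hx), mul_one, ← Real.exp_add, neg_add_cancel, Real.exp_zero, one_smul]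
      · rw [IsTest.eq_zero hx, smul_zero, wedge_zero, smul_zero]
    have e1 : (fun x => s x • wedge (delFun (w n) x) (s' x • Ψ x))
        = fun x => wedge (delFun (w n) x) (Ψ x) := funext fun x => e _ x
    have e2 : (fun x => s x • wedge (delbarFun (w n) x) (s' x • Ψ x))
        = fun x => wedge (delbarFun (w n) x) (Ψ x) := funext fun x => e _ x
    rw [e1, e2] at h1
    have h2 := h m hm n hmn
    -- Cauchy–Schwarz with parameter `t = m`: the energy is at most `C/m²`, so both summands are
    -- `O(1/m)`.
    have h3 : C₀ * (m * (ev (n := 2 * q + 1 + 1) T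
        (fun x => (s x ^ 2) • energyForm (w n) (frameSum k q) x)).re + m⁻¹ * (V + 1))
        ≤ C₀ * (C + (V + 1)) / m := by
      rw [mul_div_assoc]
      refine mul_le_mul_of_nonneg_left ?_ hC₀
      rw [le_div_iff₀ hm0, add_mul, mul_right_comm, ← sq, mul_right_comm m⁻¹,
        inv_mul_cancel₀ hm0.ne', one_mul]
      linarith
    exact ⟨h1.1.trans h3, h1.2.trans h3⟩
  have key' : ∀ ε : ℝ, 0 < ε → ∃ m : ℝ, 1 ≤ m ∧ C₀ * (C + (V + 1)) / m < ε := by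
    intro ε hε
    refine ⟨C₀ * (C + (V + 1)) / ε + 1, by
      have : 0 ≤ C₀ * (C + (V + 1)) / ε := by positivity
      linarith, ?_⟩
    have h1 : ε * (C₀ * (C + (V + 1)) / ε) = C₀ * (C + (V + 1)) := mul_div_cancel₀ _ hε.ne'
    rw [div_lt_iff₀ (by positivity), mul_add ε, h1]
    linarith
  constructor
  · refine Metric.tendsto_nhds.2 fun ε hε => ?_
    obtain ⟨m, hm, hmε⟩ := key' ε hε
    filter_upwards [key m hm] with n hn
    rw [dist_zero_right]
    exact hn.1.trans_lt hmε
  · refine Metric.tendsto_nhds.2 fun ε hε => ?_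
    obtain ⟨m, hm, hmε⟩ := key' ε hε
    filter_upwards [key m hm] with n hn
    rw [dist_zero_right]
    exact hn.2.trans_lt hmε

end

end Consequences

/-! ### Localization -/

section Localization

open MeasureTheory
open scoped Manifold

variable {k n q : ℕ} {Ω U : Opens (CSpace k)} {F : Set (CSpace k)}
  {hF : IsClosed ((↑) ⁻¹' F : Set U)}

theorem exists_finite_partition {K : Set (CSpace k)} (hK : IsCompact K)
    {V : CSpace k → Set (CSpace k)} (hV : ∀ x ∈ K, IsOpen (V x) ∧ x ∈ V x) :
    ∃ (s : Finset (CSpace k)) (χ : s → CSpace k → ℝ), (∀ i ∈ s, i ∈ K) ∧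
      (∀ i, ContDiff ℝ ∞ (χ i) ∧ (∀ x, 0 ≤ χ i x) ∧ tsupport (χ i) ⊆ V i) ∧
      ∀ x ∈ K, ∑ i, χ i x = 1 := by
  obtain ⟨s, hsK, hs⟩ := hK.elim_nhds_subcover V fun x hx => (hV x hx).1.mem_nhds (hV x hx).2
  obtain ⟨f, hf⟩ := SmoothPartitionOfUnity.exists_isSubordinate 𝓘(ℝ, CSpace k) hK.isClosed
    (fun i : s => V i) (fun i => (hV i (hsK i i.2)).1) fun x hx => by
      obtain ⟨i, hi, hxi⟩ := Set.mem_iUnion₂.1 (hs hx)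
      exact Set.mem_iUnion.2 ⟨⟨i, hi⟩, hxi⟩
  refine ⟨s, fun i => f i, hsK, fun i => ⟨(f i).contMDiff.contDiff, fun x => f.nonneg i x, hf i⟩,
    fun x hx => ?_⟩
  rw [← finsum_eq_sum_of_fintype]
  exact f.sum_eq_one hx

/-- A test form on `U` is a finite sum of test forms supported in `U \ F` or near a point of `F`. -/
theorem IsTest.exists_decomposition {ρ : CSpace k → ℝ} (hρ : ∀ a ∈ F, 0 < ρ a)
    {φ : CSpace k → Form k n} (hφ : IsTest U φ) :
    ∃ (s : Finset (CSpace k)) (χ : s → CSpace k → ℝ), (∀ i, ContDiff ℝ ∞ (χ i)) ∧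
      (∀ i x, 0 ≤ χ i x) ∧ (∀ i, IsTest U (fun x => χ i x • φ x)) ∧
      (∀ i, IsTest (sdiffOpens U F hF) (fun x => χ i x • φ x) ∨
        ∃ a ∈ F, tsupport (fun x => χ i x • φ x) ⊆ Metric.closedBall a (ρ a)) ∧
      φ = fun x => ∑ i, χ i x • φ x := by
  classical
  -- Each point of `F` gets its ball, each other point the open set `U \ F`.
  obtain ⟨s, χ, hsK, hχ, h1⟩ := exists_finite_partition hφ.compact
    (V := fun x => if x ∈ F then Metric.ball x (ρ x) else sdiffOpens U F hF) fun x hx => by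
      by_cases hxF : x ∈ F
      · simp only [hxF, if_true]
        exact ⟨Metric.isOpen_ball, Metric.mem_ball_self (hρ x hxF)⟩
      · simp only [hxF, if_false]
        exact ⟨(sdiffOpens U F hF).isOpen, hφ.subset hx, hxF⟩
  have ht : ∀ i, IsTest U (fun x => χ i x • φ x) := fun i => hφ.smul_real (hχ i).1
  have hsub : ∀ i, tsupport (fun x => χ i x • φ x) ⊆ tsupport (χ i) := fun i =>
    tsupport_subset_of_zero fun x hx => by rw [hx, zero_smul]
  refine ⟨s, χ, fun i => (hχ i).1, fun i => (hχ i).2.1, ht, fun i => ?_, funext fun x => ?_⟩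
  · have h2 := (hsub i).trans (hχ i).2.2
    by_cases hi : (i : CSpace k) ∈ F
    · simp only [hi, if_true] at h2
      exact Or.inr ⟨i, hi, h2.trans Metric.ball_subset_closedBall⟩
    · simp only [hi, if_false] at h2
      exact Or.inl ⟨(ht i).smooth, (ht i).compact, h2⟩
  · by_cases hx : x ∈ tsupport φ
    · rw [← Finset.sum_smul, h1 x hx, one_smul]
    · simp [IsTest.eq_zero hx]

theorem IsDominated.isOfOrderZero {N : Current Ω n} {μ : Measure (CSpace k)}
    (hN : IsDominated N μ) (hμ : IsFiniteNear U μ) (hΩU : Ω ≤ U) : IsOfOrderZero N := by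
  intro K hK hKΩ
  obtain ⟨V, hKV, hV, hμV⟩ := hK.exists_open_superset_measure_lt_top' (μ := μ) fun x hx => by
    obtain ⟨W, hW, hμW⟩ := hμ x (hΩU (hKΩ hx))
    exact ⟨W, hW, hμW⟩
  exact (mass_le_of_forall N hV hKV fun f _ hfV hf1 => (hN f).trans
    (lintegral_enorm_le hfV hf1)).trans_lt (ENNReal.mul_lt_top ENNReal.ofReal_lt_top hμV)

theorem IsDominated.hasLocallyFiniteMassNear {N : Current Ω n} {μ : Measure (CSpace k)}
    (hN : IsDominated N μ) (hμ : IsFiniteNear U μ) (hFU : F ⊆ U) :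
    HasLocallyFiniteMassNear F N := by
  intro a ha
  obtain ⟨W, hW, hμW⟩ := hμ a (hFU ha)
  refine ⟨interior W, interior_mem_nhds.2 hW, ?_⟩
  refine (mass_le_of_forall N isOpen_interior Set.inter_subset_left fun f _ hfV hf1 =>
    (hN f).trans (lintegral_enorm_le hfV hf1)).trans_lt
      (ENNReal.mul_lt_top ENNReal.ofReal_lt_top ?_)
  exact (measure_mono interior_subset).trans_lt hμW

theorem IsDominated.sub {N N' : Current Ω n} {μ ν : Measure (CSpace k)}
    (hN : IsDominated N μ) (hN' : IsDominated N' ν) : IsDominated (N - N') (μ + ν) := fun f => by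
  rw [ev_sub_current, lintegral_add_measure]
  exact enorm_sub_le.trans (add_le_add (hN f) (hN' f))

theorem IsFiniteNear.add {μ ν : Measure (CSpace k)} (hμ : IsFiniteNear U μ)
    (hν : IsFiniteNear U ν) : IsFiniteNear U (μ + ν) := fun x hx => by
  obtain ⟨W, hW, hμW⟩ := hμ x hx
  obtain ⟨W', hW', hνW⟩ := hν x hx
  refine ⟨W ∩ W', Filter.inter_mem hW hW', ?_⟩
  rw [Measure.add_apply]
  exact ENNReal.add_lt_top.2 ⟨(measure_mono Set.inter_subset_left).trans_lt hμW,
    (measure_mono Set.inter_subset_right).trans_lt hνW⟩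

end Localization

/-! ### The extension theorem -/

section Extension

open MeasureTheory

variable {k q : ℕ} {U : Opens (CSpace k)} {F : Set (CSpace k)}
  {hF : IsClosed ((↑) ⁻¹' F : Set U)}
  {T : Current (sdiffOpens U F hF) (2 * (q + 1))} {S : Current (sdiffOpens U F hF) (2 * q)}
  {a : CSpace k} {r : ℝ} {w : ℕ → CSpace k → ℝ} {μ ν : Measure (CSpace k)}

/-- `i∂∂̄T` is the difference of the positive currents `S` and `S - i∂∂̄T`, and the energy estimate
bounds the mass of the second near `F`. -/
theorem exists_isDominated_currentIddbar {P : Set (CSpace k → ℝ)} (hP : IsAdmissibleCone U P)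
    (hFP : IsLocallyCompletePluripolar P U F) (hT : IsPositive (q + 1) T)
    (hTP : IsPDirected P T) (hTS : IsPositive q (S - currentIddbar (n := 2 * q) T))
    (hTμ : IsDominated T μ) (hμ : IsFiniteNear U μ) (hSν : IsDominated S ν)
    (hν : IsFiniteNear U ν) :
    ∃ σ, IsDominated (currentIddbar (n := 2 * q) T) σ ∧ IsFiniteNear U σ := by
  have hR : HasLocallyFiniteMassNear F (S - currentIddbar (n := 2 * q) T) := fun a ha => by
    obtain ⟨r, w, hw⟩ := exists_isApproxSequence hP hFP hTP hTμ hμ ha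
    exact ⟨_, Metric.ball_mem_nhds a (half_pos hw.pos), hw.mass_lt_top hT hTS hTμ hμ hSν hν⟩
  obtain ⟨σ, -, hσ, hσU⟩ := exists_measure_isFiniteNear hTS.isOfOrderZero hR
  refine ⟨ν + σ, ?_, hν.add hσU⟩
  have := hSν.sub hσ
  rwa [sub_sub_cancel] at this

/-- Solve the product formula for the term in `i∂∂̄(w n)`. Against `w n • φ`, the current `i∂∂̄T`
converges to `D`; against `w n • ∂∂̄φ`, `T` converges to `T'`; the mixed terms disappear. -/
theorem IsApproxSequence.tendsto_iddbarWedge (hw : IsApproxSequence T a r w) (hFU : F ⊆ U)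
    (hT : IsPositive (q + 1) T) (hTF : HasLocallyFiniteMassNear F T)
    (hTS : IsPositive q (S - currentIddbar (n := 2 * q) T))
    (hTμ : IsDominated T μ) (hμ : IsFiniteNear U μ)
    (hμ0 : μ (sdiffOpens U F hF : Set (CSpace k))ᶜ = 0)
    (hSν : IsDominated S ν) (hν : IsFiniteNear U ν)
    (h0 : IsOfOrderZero (currentIddbar (n := 2 * q) T))
    (h0F : HasLocallyFiniteMassNear F (currentIddbar (n := 2 * q) T))
    {T' : Current U (2 * (q + 1))} (hT' : IsZeroExtension F T T') {D : Current U (2 * q)}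
    (hD : IsZeroExtension F (currentIddbar (n := 2 * q) T) D)
    {φ : CSpace k → Form k (2 * q)} (hφ : IsTest U φ)
    (hφr : tsupport φ ⊆ Metric.closedBall a (r / 2)) :
    Tendsto (fun n => ev (n := 2 * q + 1 + 1) T (fun x => iddbarWedge (w n) x (φ x))) atTop
      (𝓝 (ev (D - currentIddbar (n := 2 * q) T') φ)) := by
  have hlim : ∀ (m : ℕ) (f : CSpace k → Form k m), tsupport f ⊆ tsupport φ →
      ∀ x ∈ sdiffOpens U F hF, f x ≠ 0 → Tendsto (fun j => w j x) atTop (𝓝 1) :=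
    fun m f hf x hx hfx => hw.tendsto x (Metric.closedBall_subset_closedBall
      (half_le_self hw.pos.le) (hφr (hf (subset_tsupport _ hfx)))) hx.2
  have t1 : IsTest U (delF (delbarF φ)) := hφ.delbarF.delF
  have s1 : tsupport (delF (delbarF φ)) ⊆ tsupport φ :=
    (tsupport_delF _).trans (tsupport_delbarF _)
  have l0 := hD.ev_tendsto hFU h0 h0F hw.isCutoff hφ (hlim _ φ subset_rfl)
  have l1 := IsZeroExtension.ev_tendsto (n := 2 * q + 1 + 1) hFU hT' hT.isOfOrderZero hTF
    hw.isCutoff t1 (hlim _ _ s1)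
  have l2 := (hw.tendsto_mixed hT hTS hTμ hμ hμ0 hSν hν hφ.delbarF.smooth
    ((tsupport_delbarF φ).trans hφr)).1
  have l3 := (hw.tendsto_mixed hT hTS hTμ hμ hμ0 hSν hν hφ.delF.smooth
    ((tsupport_delF φ).trans hφr)).2
  have h := ((l0.sub (l1.const_mul Complex.I)).sub (l2.const_mul Complex.I)).add
    (l3.const_mul Complex.I)
  rw [ev_sub_current, ev_currentIddbar (n := 2 * q) T' hφ]
  rw [mul_zero, sub_zero, add_zero] at h
  refine h.congr fun n => ?_
  rw [ev_currentIddbar_smul (n := 2 * q) T (hw.isCutoff n).smooth (hw.isCutoff n).compact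
    (hw.isCutoff n).subset hφ.smooth]
  ring

/-- The errors `M/(n+1)` of directedness vanish, so `c` is a limit of non-negative real numbers. -/
theorem IsApproxSequence.ev_nonneg (hw : IsApproxSequence T a r w) {c : ℂ}
    {φ : CSpace k → Form k (2 * q)} (hφ : IsTest U φ) (hpos : ∀ x, φ x ∈ stronglyPositive k q)
    (hφr : tsupport φ ⊆ Metric.closedBall a (r / 2))
    (h : Tendsto (fun n => ev (n := 2 * q + 1 + 1) T (fun x => iddbarWedge (w n) x (φ x))) atTop
      (𝓝 c)) :
    ∃ t : ℝ, 0 ≤ t ∧ c = t := by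
  obtain ⟨M, -, hM⟩ := hφ.exists_bound
  choose t ht0 ht using fun n => hw.directed n φ hφ.smooth hpos (hφr.trans
    (Metric.closedBall_subset_closedBall (half_le_self hw.pos.le))) M hM
  have h1 : Tendsto (fun n : ℕ => M * (1 / ((n : ℝ) + 1))) atTop (𝓝 0) := by
    simpa using tendsto_one_div_add_atTop_nhds_zero_nat.const_mul M
  have h2 : Tendsto (fun n => (t n : ℂ)) atTop (𝓝 c) := by
    simpa using h.sub (squeeze_zero_norm ht h1)
  have h3 := (Complex.continuous_re.tendsto c).comp h2
  have h4 := (Complex.continuous_im.tendsto c).comp h2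
  refine ⟨c.re, ge_of_tendsto' h3 ht0, Complex.ext (by simp) ?_⟩
  exact tendsto_nhds_unique h4 tendsto_const_nhds

theorem IsZeroExtension.ev_currentIddbar_eq {T' : Current U (2 * (q + 1))}
    (hT' : IsZeroExtension F T T') {φ : CSpace k → Form k (2 * q)}
    (hφ : IsTest (sdiffOpens U F hF) φ) :
    ev (currentIddbar (n := 2 * q) T') φ = ev (currentIddbar (n := 2 * q) T) φ := by
  rw [ev_currentIddbar (n := 2 * q) T' (hφ.mono sdiffOpens_le),
    ev_currentIddbar (n := 2 * q) T hφ]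
  congr 1
  exact IsZeroExtension.ev_eq (n := 2 * q + 1 + 1) hT' hφ.delbarF.delF

/-- The current `D - i∂∂̄T'` has bidimension `(q,q)`. -/
theorem isOfBidimension_sub (hFU : F ⊆ U) (hT : IsPositive (q + 1) T)
    (hTF : HasLocallyFiniteMassNear F T) (h0 : IsOfOrderZero (currentIddbar (n := 2 * q) T))
    (h0F : HasLocallyFiniteMassNear F (currentIddbar (n := 2 * q) T))
    {T' : Current U (2 * (q + 1))} (hT' : IsZeroExtension F T T') {D : Current U (2 * q)}
    (hD : IsZeroExtension F (currentIddbar (n := 2 * q) T) D) :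
    IsOfBidimension q q (D - currentIddbar (n := 2 * q) T') := by
  intro b c hbc φ hφ
  obtain ⟨w, hw, hlim⟩ := exists_cutoff_seq (sdiffOpens U F hF)
  have hbc' : (b + 1, c + 1) ≠ (q + 1, q + 1) := fun h => hbc (by simpa using h)
  have ht : ∀ ψ : CSpace k → Form k (2 * q), (∀ x, IsOfType b c (ψ x)) →
      ∀ x, IsOfType (b + 1) (c + 1) (delF (delbarF ψ) x) := fun ψ hψ =>
    isOfType_delF (isOfType_delbarF hψ)
  have hs : ∀ {m b c : ℕ} {ψ : CSpace k → Form k m}, (∀ x, IsOfType b c (ψ x)) →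
      ∀ j x, IsOfType b c (w j x • ψ x) := fun hψ j x => by
    rw [← ofReal_smul_eq]
    exact (hψ x).smul _
  rw [← ev_coe, ev_sub_current, ev_currentIddbar (n := 2 * q) T' (isTest_coe φ)]
  have l0 := hD.ev_tendsto hFU h0 h0F hw (isTest_coe φ) fun x hx _ => hlim x hx
  have l1 := IsZeroExtension.ev_tendsto (n := 2 * q + 1 + 1) hFU hT' hT.isOfOrderZero hTF hw
    (isTest_coe φ).delbarF.delF fun x hx _ => hlim x hx
  -- `∂∂̄` raises both degrees by one, so `w j • φ` is sent to a type on which `T` vanishes.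
  have e0 : ∀ j, ev (currentIddbar (n := 2 * q) T) (fun x => w j x • φ x) = 0 := fun j => by
    rw [ev_currentIddbar (n := 2 * q) T ((hw j).isTest_smul φ.contDiff)]
    rw [IsOfBidimension.ev_eq_zero (n := 2 * q + 1 + 1) hT.1 hbc' (ht _ (hs hφ j)), mul_zero]
  have e1 : ∀ j, ev (n := 2 * q + 1 + 1) T (fun x => w j x • delF (delbarF φ) x) = 0 := fun j =>
    IsOfBidimension.ev_eq_zero (n := 2 * q + 1 + 1) hT.1 hbc' (hs (ht _ hφ) j)
  rw [tendsto_nhds_unique (l0.congr e0) tendsto_const_nhds,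
    tendsto_nhds_unique (l1.congr e1) tendsto_const_nhds, mul_zero, sub_zero]

/-- The exterior derivative of the extension by zero is the extension by zero of the exterior
derivative, near a point of `F`. -/
theorem IsApproxSequence.ev_currentD_eq (hw : IsApproxSequence T a r w) (hFU : F ⊆ U)
    (hT : IsPositive (q + 1) T) (hTF : HasLocallyFiniteMassNear F T)
    (hTS : IsPositive q (S - currentIddbar (n := 2 * q) T))
    (hTμ : IsDominated T μ) (hμ : IsFiniteNear U μ)
    (hμ0 : μ (sdiffOpens U F hF : Set (CSpace k))ᶜ = 0)
    (hSν : IsDominated S ν) (hν : IsFiniteNear U ν)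
    (h0 : IsOfOrderZero (currentD (n := 2 * q + 1) T))
    (h0F : HasLocallyFiniteMassNear F (currentD (n := 2 * q + 1) T))
    {T' : Current U (2 * (q + 1))} (hT' : IsZeroExtension F T T') {D : Current U (2 * q + 1)}
    (hD : IsZeroExtension F (currentD (n := 2 * q + 1) T) D)
    {φ : CSpace k → Form k (2 * q + 1)} (hφ : IsTest U φ)
    (hφr : tsupport φ ⊆ Metric.closedBall a (r / 2)) :
    ev D φ = ev (currentD (n := 2 * q + 1) T') φ := by
  have hlim : ∀ (m : ℕ) (f : CSpace k → Form k m), tsupport f ⊆ tsupport φ →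
      ∀ x ∈ sdiffOpens U F hF, f x ≠ 0 → Tendsto (fun j => w j x) atTop (𝓝 1) :=
    fun m f hf x hx hfx => hw.tendsto x (Metric.closedBall_subset_closedBall
      (half_le_self hw.pos.le) (hφr (hf (subset_tsupport _ hfx)))) hx.2
  have l0 := hD.ev_tendsto hFU h0 h0F hw.isCutoff hφ (hlim _ φ subset_rfl)
  have l1 := IsZeroExtension.ev_tendsto (n := 2 * q + 1 + 1) hFU hT' hT.isOfOrderZero hTF
    hw.isCutoff hφ.dF (hlim _ _ (tsupport_dF φ))
  -- The only error is `⟨T, d(w n) ∧ φ⟩`, whose `∂` and `∂̄` parts are mixed terms.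
  obtain ⟨l2, l3⟩ := hw.tendsto_mixed hT hTS hTμ hμ hμ0 hSν hν hφ.smooth hφr
  have h := (l1.add (l2.add l3)).const_mul ((-1 : ℂ) ^ (2 * q + 1))
  rw [add_zero, add_zero] at h
  rw [ev_currentD (n := 2 * q + 1) T' hφ]
  refine tendsto_nhds_unique l0 (h.congr fun n => ?_)
  rw [ev_currentD_smul (n := 2 * q + 1) T (hw.isCutoff n).smooth (hw.isCutoff n).compact
    (hw.isCutoff n).subset hφ.smooth]

theorem IsZeroExtension.ev_currentD_eq {T' : Current U (2 * (q + 1))}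
    (hT' : IsZeroExtension F T T') {φ : CSpace k → Form k (2 * q + 1)}
    (hφ : IsTest (sdiffOpens U F hF) φ) :
    ev (currentD (n := 2 * q + 1) T') φ = ev (currentD (n := 2 * q + 1) T) φ := by
  rw [ev_currentD (n := 2 * q + 1) T' (hφ.mono sdiffOpens_le),
    ev_currentD (n := 2 * q + 1) T hφ]
  congr 1
  exact IsZeroExtension.ev_eq (n := 2 * q + 1 + 1) hT' hφ.dF

end Extension


end DirectedCurrents

end

/-! ### The theorem, assembled from its local forms. -/

theorem theorem6p4 {k p q : ℕ} (hk : p + q + 1 = k)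
    (U : Opens (CSpace k)) (hU : IsConnected (U : Set (CSpace k)))
    (P : Set (CSpace k → ℝ)) (hP : IsAdmissibleCone U P)
    (F : Set (CSpace k)) (hFU : F ⊆ U) (hF : IsClosed ((↑) ⁻¹' F : Set U))
    (hFP : IsLocallyCompletePluripolar P U F)
    -- `T` has bidimension `(q+1,q+1)`, that is, bidegree `(p,p)`
    (T : Current (sdiffOpens U F hF) (2 * (q + 1)))
    (hT : IsPositive (q + 1) T) (hTP : IsPDirected P T) (hTF : HasLocallyFiniteMassNear F T)
    -- `S` has bidimension `(q,q)`, that is, bidegree `(p+1,p+1)`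
    (S : Current (sdiffOpens U F hF) (2 * q))
    (hS : IsPositive q S) (hSF : HasLocallyFiniteMassNear F S)
    (hTS : IsPositive q (S - currentIddbar (n := 2 * q) T)) :
    IsOfOrderZero (currentIddbar (n := 2 * q) T) ∧
    HasLocallyFiniteMassNear F (currentIddbar (n := 2 * q) T) ∧
    (∃ T' : Current U (2 * (q + 1)), IsZeroExtension F T T') ∧
    (∃ D : Current U (2 * q), IsZeroExtension F (currentIddbar (n := 2 * q) T) D) ∧
    ∀ T' : Current U (2 * (q + 1)), IsZeroExtension F T T' →
      (∀ D : Current U (2 * q), IsZeroExtension F (currentIddbar (n := 2 * q) T) D →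
        IsPositive q (D - currentIddbar (n := 2 * q) T')) ∧
      (IsOfOrderZero (currentD (n := 2 * q + 1) T) →
        HasLocallyFiniteMassNear F (currentD (n := 2 * q + 1) T) →
        IsZeroExtension F (currentD (n := 2 * q + 1) T) (currentD (n := 2 * q + 1) T')) := by
  obtain ⟨μ, hμ0, hTμ, hμ⟩ := exists_measure_isFiniteNear hT.isOfOrderZero hTF
  obtain ⟨ν, -, hSν, hν⟩ := exists_measure_isFiniteNear hS.isOfOrderZero hSF
  obtain ⟨σ, hσ, hσU⟩ := exists_isDominated_currentIddbar hP hFP hT hTP hTS hTμ hμ hSν hν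
  have h0 := hσ.isOfOrderZero hσU sdiffOpens_le
  have h0F := hσ.hasLocallyFiniteMassNear hσU hFU
  obtain ⟨T₀, -, hT₀, -⟩ := exists_isZeroExtension hFU hT.isOfOrderZero hTF
  obtain ⟨D₀, -, hD₀, -⟩ := exists_isZeroExtension hFU h0 h0F
  refine ⟨h0, h0F, ⟨T₀, hT₀⟩, ⟨D₀, hD₀⟩, fun T' hT' => ⟨fun D hD => ?_, fun hd hdF => ?_⟩⟩
  all_goals
    have hex : ∀ a, ∃ (r : ℝ) (w : ℕ → CSpace k → ℝ), a ∈ F → IsApproxSequence T a r w := fun a => by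
      by_cases ha : a ∈ F
      · obtain ⟨r, w, h⟩ := exists_isApproxSequence hP hFP hTP hTμ hμ ha
        exact ⟨r, w, fun _ => h⟩
      -- Dummy data off `F`, so that radii and sequences can be chosen for all points at once.
      · exact ⟨0, fun _ _ => 0, fun h => absurd h ha⟩
    choose r w hw using hex
  · refine ⟨isOfBidimension_sub hFU hT hTF h0 h0F hT' hD, fun φ hφ => ?_⟩
    -- The half radius is where the bump function of the estimates equals one. The weights `χ i` are
    -- non-negative, so every piece of `φ` stays strongly positive.
    obtain ⟨s, χ, -, hχ0, hχt, hχ, hsum⟩ := (isTest_coe φ).exists_decomposition (hF := hF)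
      fun a ha => half_pos (hw a ha).pos
    have hloc : ∀ i, ∃ c : ℝ, 0 ≤ c ∧
        ev (D - currentIddbar (n := 2 * q) T') (fun x => χ i x • φ x) = c := fun i => by
      rcases hχ i with h | ⟨a, ha, har⟩
      · refine ⟨0, le_rfl, ?_⟩
        -- On pieces supported off `F` both currents restrict to `i∂∂̄T`, so the difference vanishes
        -- there.
        rw [ev_sub_current, hD.ev_eq h, hT'.ev_currentIddbar_eq h, sub_self, Complex.ofReal_zero]
      · exact (hw a ha).ev_nonneg (hχt i)
          (fun x => smul_mem_stronglyPositive (hχ0 i x) (hφ x)) har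
          ((hw a ha).tendsto_iddbarWedge hFU hT hTF hTS hTμ hμ hμ0 hSν hν h0 h0F hT' hD (hχt i) har)
    choose c hc0 hc using hloc
    refine ⟨∑ i, c i, Finset.sum_nonneg fun i _ => hc0 i, ?_⟩
    rw [← ev_coe, hsum, ev_sum _ _ fun i _ => hχt i, Complex.ofReal_sum]
    exact Finset.sum_congr rfl fun i _ => hc i
  · obtain ⟨D, -, hD, -⟩ := exists_isZeroExtension hFU hd hdF
    -- Equality with an existing extension by zero yields at once the order, the restriction and the
    -- null mass on `F`.
    have h : D = currentD (n := 2 * q + 1) T' := ContinuousLinearMap.ext fun φ => by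
      obtain ⟨s, χ, -, -, hχt, hχ, hsum⟩ := (isTest_coe φ).exists_decomposition (hF := hF)
        fun a ha => half_pos (hw a ha).pos
      rw [← ev_coe, ← ev_coe, hsum, ev_sum _ _ fun i _ => hχt i, ev_sum _ _ fun i _ => hχt i]
      refine Finset.sum_congr rfl fun i _ => ?_
      rcases hχ i with h | ⟨a, ha, har⟩
      · rw [hD.ev_eq h, hT'.ev_currentD_eq h]
      · exact (hw a ha).ev_currentD_eq hFU hT hTF hTS hTμ hμ hμ0 hSν hν hd hdF hT' hD (hχt i) har
    exact h ▸ hD
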